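/- Let $k$ be a field and let $\tilde A$ be the Hopf algebra over $k$ generated as an algebra by $a,b,x,y$ subject to the relations $$ba=ab,\quad ya=ay,\quad bx=xb,\quad yx=xy,\quad by=-yb,\quad y^2=x^2+x^3,\quad b^2=a^3=1,$$ $$a^2x+axa+xa^2+a^2-a^3=0,\qquad x^2a+xax+ax^2+xa+ax=0,$$ with $\Delta(a)=a\otimes a$, $\Delta(b)=b\otimes b$, $\Delta(x)=1\otimes x+x\otimes a$, $\Delta(y)=1\otimes y+y\otimes b$. For a group-like $g\in\tilde A$ put $P_{(1,g)}=\{h\in\tilde A:\Delta(h)=1\otimes h+h\otimes g\}$ and $V_g=P_{(1,g)}/k(g-1)$. Let $V=\bigoplus_g V_g$, the sum over all group-like elements, with the Yetter-Drinfel'd braiding $\chi(p\otimes q)=gqg^{-1}\otimes p$ for $p\in V_g$, $q\in V$. For a braided vector space $(W,\chi)$ let $B(W)$ denote its Nichols algebra, i.e. the quotient of the tensor algebra $T(W)$ by the ideal formed by the kernels of the quantum symmetrisers of $\chi$ on $W^{\otimes n}$, $n\ge 1$. The Nichols algebra of $\tilde A$ is $B(V)$. 1. The group-likes $1,a,b$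 are distinct and $V_g=0$ for all group-like $g\notin\{1,a,b\}$. The map $\chi$ is bijective and satisfies the braid equation. It restricts to each $V_g$, and $\chi(p\otimes q)=q\otimes p$ for $p\in V_g$, $q\in V_h$, $g\neq h$; so $V=V_1\oplus V_a\oplus V_b$ as a braided vector space. On $V_1$ the braiding is the flip $\tau$, and on $V_b$, which has the basis $[y]$, it is $-\tau$. 2. $V_a$ has the basis $u=[x]$, $v=[axa^2]$, and its braiding is given by $$u\otimes u\mapsto v\otimes u,\quad v\otimes u\mapsto v\otimes v,\quad u\otimes v\mapsto -u\otimes u-v\otimes u,\quad v\otimes v\mapsto -u\otimes v-v\otimes v.$$ If $k$ contains no primitive third root of unity, this braiding is not of diagonal type (i.e. there are no basis $(e_i)$ of $V_a$ and scalars $q_{ij}$ with $\chi(e_i\otimes e_j)=q_{ij}\,e_j\otimes e_i$). 3. The algebra $B(V_a)$ is generated by $u,v$ with defining relations $$u^3=v^3=0,\qquad u^2v+uvu+vu^2=0,\qquad u^2+uv+v^2=0.$$ It is $9$-dimensional with basis $\{1,u,v,u^2,vu,v^2,vuv,v^2u,v^2uv\}$, and $vuv^2=-v^2uv$ in $B(V_a)$.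 4. The canonical maps $V_b\to B(V_b)$ and $V_g\to V$ induce algebra isomorphisms $\Lambda(V_b)\cong B(V_b)$ (exterior algebra) and $B(V_1)\otimes B(V_a)\otimes B(V_b)\cong B(V)$. 5. Suppose that $\mathrm{char}(k)=0$. Then $V_1$ has the basis $[x^2+x^3],[c]$, where $$c=(xa)^3+2a(xa)^2x+a(xa)^2-3a^2(xa)x^2-2a^2(xa)x-(xa)x+ax^2+ax-2x^2-2x,$$ and $B(V_1)$ is the polynomial ring in these two elements. In total, the Nichols algebra $B(V)$ of $\tilde A$ is isomorphic to the tensor product $k[X_0,X_1]\otimes\Lambda(k)\otimes B(V_a)$ of a polynomial ring in two variables, an exterior algebra on one generator, and $B(V_a)$, by an algebra isomorphism that maps $X_0$, $X_1$ and the exterior generator to $[x^2+x^3]$, $[c]$ and $[y]$, and is the canonical map on $V_a\subset B(V_a)$. -/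

import Mathlib

open scoped TensorProduct

noncomputable section

/-! ## Nichols algebras of braided vector spaces -/

namespace Nichols

universe u v

variable (k : Type u) [Field k] (V : Type v) [AddCommGroup V] [Module k V]

/-- The tensor powers of `V` without the degree zero one: `TPow k V n` is `V^{⊗(n+1)}`, defined by
`V^{⊗1} = V` and `V^{⊗(n+2)} = V ⊗ V^{⊗(n+1)}`. -/
def TPow : ℕ → ModuleCat.{v} k
  | 0 => ModuleCat.of k V
  | n + 1 => ModuleCat.of k (V ⊗[k] (TPow n))

/-- The embedding of `V^{⊗(n+1)}` into the tensor algebra, `v₀ ⊗ ⋯ ⊗ vₙ ↦ v₀ ⋯ vₙ`. -/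
def toTensorAlgebra : (n : ℕ) → (TPow k V n →ₗ[k] TensorAlgebra k V)
  | 0 => (TensorAlgebra.ι k : V →ₗ[k] TensorAlgebra k V)
  | n + 1 => (TensorProduct.lift
      (((LinearMap.mul k (TensorAlgebra k V)).comp (TensorAlgebra.ι k)).compl₂
        (toTensorAlgebra n)) : V ⊗[k] (TPow k V n) →ₗ[k] TensorAlgebra k V)

variable {k V}

/-- `χ` applied to the first two factors of `V ⊗ (V ⊗ W)`. -/
def braidFirst (χ : V ⊗[k] V →ₗ[k] V ⊗[k] V) (W : Type v) [AddCommGroup W] [Module k W] :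
    V ⊗[k] (V ⊗[k] W) →ₗ[k] V ⊗[k] (V ⊗[k] W) :=
  (TensorProduct.assoc k V V W).toLinearMap ∘ₗ χ.rTensor W ∘ₗ
    (TensorProduct.assoc k V V W).symm.toLinearMap

/-- A braiding on `V`: a bijective linear map `χ : V ⊗ V → V ⊗ V` that satisfies the braid equation
`χ₁ χ₂ χ₁ = χ₂ χ₁ χ₂` on `V ⊗ V ⊗ V`. -/
def IsBraiding (χ : V ⊗[k] V →ₗ[k] V ⊗[k] V) : Prop :=
  Function.Bijective χ ∧
    braidFirst χ V ∘ₗ χ.lTensor V ∘ₗ braidFirst χ V =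
      χ.lTensor V ∘ₗ braidFirst χ V ∘ₗ χ.lTensor V

/-- The braiding `χ` is of diagonal type: `χ (eᵢ ⊗ eⱼ) = qᵢⱼ eⱼ ⊗ eᵢ` for some basis `(eᵢ)` of `V`
and some scalars `qᵢⱼ`. -/
def IsDiagonalType (χ : V ⊗[k] V →ₗ[k] V ⊗[k] V) : Prop :=
  ∃ (I : Type v) (e : Module.Basis I k V) (q : I → I → k),
    ∀ i j, χ (e i ⊗ₜ[k] e j) = q i j • (e j ⊗ₜ[k] e i)

/-- The operator `1 + χ₁ + χ₂ χ₁ + ⋯ + χₙ₊₁ ⋯ χ₂ χ₁` on `V^{⊗(n+2)} = V ⊗ V^{⊗(n+1)}`, where `χᵢ` is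
`χ` applied to the tensor factors `i` and `i + 1`. -/
def insertion (χ : V ⊗[k] V →ₗ[k] V ⊗[k] V) :
    (n : ℕ) → (V ⊗[k] (TPow k V n) →ₗ[k] V ⊗[k] (TPow k V n))
  | 0 => (LinearMap.id + χ : V ⊗[k] V →ₗ[k] V ⊗[k] V)
  | n + 1 => (LinearMap.id + (insertion χ n).lTensor V ∘ₗ braidFirst χ (TPow k V n) :
      V ⊗[k] (V ⊗[k] (TPow k V n)) →ₗ[k] V ⊗[k] (V ⊗[k] (TPow k V n)))

/-- The quantum symmetriser `∑_σ χ_σ` on `V^{⊗(n+1)}`, the sum over all permutations `σ` of `n + 1`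
letters, where `χ_σ = χ_{i₁} ⋯ χ_{iₗ}` for a reduced expression of `σ`. As every permutation is
uniquely a product (of length equal to the sum of the lengths) of one of the cycles `1, s₁, s₂ s₁, …`
and a permutation that fixes the first letter, it is given by
`S_{m+1} = (1 + χ₁ + χ₂ χ₁ + ⋯ + χₘ ⋯ χ₁) (id ⊗ S_m)`. -/
def quantumSymmetriser (χ : V ⊗[k] V →ₗ[k] V ⊗[k] V) : (n : ℕ) → (TPow k V n →ₗ[k] TPow k V n)
  | 0 => LinearMap.id
  | n + 1 => (insertion χ n ∘ₗ (quantumSymmetriser χ n).lTensor V :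
      V ⊗[k] (TPow k V n) →ₗ[k] V ⊗[k] (TPow k V n))

/-- The elements of the kernels of the quantum symmetrisers are set to zero. -/
inductive Rel (χ : V ⊗[k] V →ₗ[k] V ⊗[k] V) : TensorAlgebra k V → TensorAlgebra k V → Prop
  | ker (n : ℕ) (t : TPow k V n) (ht : quantumSymmetriser χ n t = 0) :
      Rel χ (toTensorAlgebra k V n t) 0

/-- The Nichols algebra `B(V)` of the braided vector space `(V, χ)`: the quotient of the tensor
algebra by the (ideal generated by the) kernels of all quantum symmetrisers. -/
def NicholsAlgebra (χ : V ⊗[k] V →ₗ[k] V ⊗[k] V) : Type _ := RingQuot (Rel χ)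

instance (χ : V ⊗[k] V →ₗ[k] V ⊗[k] V) : Ring (NicholsAlgebra χ) :=
  inferInstanceAs (Ring (RingQuot (Rel χ)))

instance (χ : V ⊗[k] V →ₗ[k] V ⊗[k] V) : Algebra k (NicholsAlgebra χ) :=
  inferInstanceAs (Algebra k (RingQuot (Rel χ)))

/-- The canonical map `V → B(V)`. -/
def ι (χ : V ⊗[k] V →ₗ[k] V ⊗[k] V) : V →ₗ[k] NicholsAlgebra χ :=
  (RingQuot.mkAlgHom k (Rel χ)).toLinearMap ∘ₗ TensorAlgebra.ι k

end Nichols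

/-! ## The Yetter-Drinfel'd module of skew primitives of a Hopf algebra -/

namespace SkewPrim

universe u v

variable (k : Type u) [Field k] {H : Type v} [Ring H] [HopfAlgebra k H]

/-- `P_{(1,g)}(H)`: the elements `h` with `Δ(h) = 1 ⊗ h + h ⊗ g`. -/
def P (g : GroupLike k H) : Submodule k H where
  carrier := {h | Coalgebra.comul (R := k) h = 1 ⊗ₜ[k] h + h ⊗ₜ[k] (g : H)}
  add_mem' {p q} hp hq := by
    simp only [Set.mem_ofPred_eq] at hp hq ⊢
    rw [map_add, hp, hq, TensorProduct.tmul_add, TensorProduct.add_tmul]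
    abel
  zero_mem' := by simp
  smul_mem' r p hp := by
    simp only [Set.mem_ofPred_eq] at hp ⊢
    rw [map_smul, hp, smul_add, ← TensorProduct.tmul_smul, TensorProduct.smul_tmul']

variable {k}

theorem mem_P {g : GroupLike k H} {h : H} :
    h ∈ P k g ↔ Coalgebra.comul (R := k) h = 1 ⊗ₜ[k] h + h ⊗ₜ[k] (g : H) := Iff.rfl

variable (k) in
/-- `V_g(H) = P_{(1,g)}(H) / k (g - 1)`. -/
def VG (g : GroupLike k H) : Type v :=
  P k g ⧸ (Submodule.span k {(g : H) - 1}).submoduleOf (P k g)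

instance (g : GroupLike k H) : AddCommGroup (VG k g) :=
  inferInstanceAs (AddCommGroup (P k g ⧸ (Submodule.span k {(g : H) - 1}).submoduleOf (P k g)))

instance (g : GroupLike k H) : Module k (VG k g) :=
  inferInstanceAs (Module k (P k g ⧸ (Submodule.span k {(g : H) - 1}).submoduleOf (P k g)))

/-- The projection `P_{(1,g)}(H) → V_g(H)`. -/
def proj (g : GroupLike k H) : P k g →ₗ[k] VG k g :=
  ((Submodule.span k {(g : H) - 1}).submoduleOf (P k g)).mkQ

/-- The class in `V_g(H)` of a skew primitive element. -/
def cls (g : GroupLike k H) (h : H) (hh : h ∈ P k g) : VG k g :=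
  proj g ⟨h, hh⟩

theorem val_mul_inv (g : GroupLike k H) : (g : H) * ((g⁻¹ : GroupLike k H) : H) = 1 := by
  rw [← GroupLike.val_mul, mul_inv_cancel, GroupLike.val_one]

theorem conj_mem {g g' h : GroupLike k H} (e : g' = h * g * h⁻¹) {p : H} (hp : p ∈ P k g) :
    (h : H) * p * ((h⁻¹ : GroupLike k H) : H) ∈ P k g' := by
  rw [mem_P] at hp ⊢
  rw [Bialgebra.comul_mul, Bialgebra.comul_mul, hp, h.2.comul_eq_tmul_self,
    (h⁻¹).2.comul_eq_tmul_self, e]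
  simp only [mul_add, add_mul, Algebra.TensorProduct.tmul_mul_tmul, mul_one, GroupLike.val_mul,
    val_mul_inv]

/-- Conjugation `p ↦ h p h⁻¹` on skew primitive elements. -/
def conjP {g g' : GroupLike k H} (h : GroupLike k H) (e : g' = h * g * h⁻¹) : P k g →ₗ[k] P k g' :=
  ((LinearMap.mulLeft k (h : H)).comp
    (LinearMap.mulRight k ((h⁻¹ : GroupLike k H) : H))).restrict (fun p hp => by
      simpa [mul_assoc] using conj_mem e hp)

/-- The action of `h` by conjugation, `V_g(H) → V_{h g h⁻¹}(H)`, `[p] ↦ [h p h⁻¹]`. -/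
def conjV {g g' : GroupLike k H} (h : GroupLike k H) (e : g' = h * g * h⁻¹) :
    VG k g →ₗ[k] VG k g' :=
  Submodule.mapQ ((Submodule.span k {(g : H) - 1}).submoduleOf (P k g))
    ((Submodule.span k {(g' : H) - 1}).submoduleOf (P k g')) (conjP h e) (by
    rintro ⟨p, hp⟩ hpp
    rw [Submodule.mem_comap]
    simp only [Submodule.submoduleOf, Submodule.mem_comap, Submodule.subtype_apply,
      Submodule.mem_span_singleton] at hpp ⊢
    obtain ⟨r, rfl⟩ := hpp
    refine ⟨r, ?_⟩
    subst e
    simp [conjP, mul_sub, sub_mul, mul_assoc, -GroupLike.val_inv, val_mul_inv])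

/-- The Yetter-Drinfel'd braiding on `V_g(H)`: `p ⊗ q ↦ (g q g⁻¹) ⊗ p`. -/
def braidingVG (g : GroupLike k H) : VG k g ⊗[k] VG k g →ₗ[k] VG k g ⊗[k] VG k g :=
  TensorProduct.lift
    ((TensorProduct.mk k (VG k g) (VG k g)).flip.compl₂ (conjV g (by simp)))

variable (k H)

/-- The Yetter-Drinfel'd module `V(H) = ⨁_g V_g(H)` of skew primitives of `H`, where `g` runs over
all group-like elements. The coaction is `p ↦ g ⊗ p` on `V_g(H)`, the action is conjugation. -/
def V : Type v := DirectSum (GroupLike k H) (fun g => VG k g)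

instance : AddCommGroup (V k H) :=
  inferInstanceAs (AddCommGroup (DirectSum (GroupLike k H) (fun g => VG k g)))

instance : Module k (V k H) :=
  inferInstanceAs (Module k (DirectSum (GroupLike k H) (fun g => VG k g)))

variable {k H}

open Classical in
/-- The inclusion of `V_g(H)` into `V(H)`. -/
def incl (g : GroupLike k H) : VG k g →ₗ[k] V k H :=
  DirectSum.lof k (GroupLike k H) (fun g => VG k g) g

open Classical in
/-- The action of a group-like element on `V(H)` by conjugation. -/
def act (h : GroupLike k H) : V k H →ₗ[k] V k H :=
  DirectSum.toModule k (GroupLike k H) (V k H)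
    (fun g => (incl (h * g * h⁻¹)).comp (conjV h rfl))

variable (k H)

open Classical in
/-- The Yetter-Drinfel'd braiding of `V(H)`: `p ⊗ q ↦ (g q g⁻¹) ⊗ p` for `p ∈ V_g(H)`,
`q ∈ V(H)`. -/
def braiding : V k H ⊗[k] V k H →ₗ[k] V k H ⊗[k] V k H :=
  TensorProduct.lift (DirectSum.toModule k (GroupLike k H) (V k H →ₗ[k] V k H ⊗[k] V k H)
    (fun g => ((TensorProduct.mk k (V k H) (V k H)).flip.comp (incl g)).compl₂ (act g)))

end SkewPrim

/-! ## The Hopf algebra `Ã` -/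

namespace NodalCubic

universe u

/-- The generators of `Ã`. -/
inductive Gen
  | a | b | x | y

section
set_option linter.unusedSimpArgs false
variable (k : Type u) [Field k]

/-- The free algebra generators. -/
abbrev X (g : Gen) : FreeAlgebra k Gen := FreeAlgebra.ι k g

open Gen in
/-- The defining relations of `Ã`. -/
inductive Rel : FreeAlgebra k Gen → FreeAlgebra k Gen → Prop
  | ba : Rel (X k b * X k a) (X k a * X k b)
  | ya : Rel (X k y * X k a) (X k a * X k y)
  | bx : Rel (X k b * X k x) (X k x * X k b)
  | yx : Rel (X k y * X k x) (X k x * X k y)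
  | yb : Rel (X k b * X k y) (-(X k y * X k b))
  | aax : Rel (X k a ^ 2 * X k x + X k a * X k x * X k a + X k x * X k a ^ 2 + X k a ^ 2 - X k a ^ 3) 0
  | xxa : Rel (X k x ^ 2 * X k a + X k x * X k a * X k x + X k a * X k x ^ 2 + X k x * X k a
      + X k a * X k x) 0
  | yy : Rel (X k y ^ 2) (X k x ^ 2 + X k x ^ 3)
  | bb : Rel (X k b ^ 2) (X k a ^ 3)
  | aaa : Rel (X k a ^ 3) 1

/-- The algebra `Ã`, generated by `a, b, x, y` subject to the above relations. -/
def Atilde : Type u := RingQuot (Rel k)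

instance : Ring (Atilde k) := inferInstanceAs (Ring (RingQuot (Rel k)))

instance : Algebra k (Atilde k) := inferInstanceAs (Algebra k (RingQuot (Rel k)))

namespace Atilde

def mk : FreeAlgebra k Gen →ₐ[k] Atilde k := RingQuot.mkAlgHom k (Rel k)

def a : Atilde k := mk k (X k Gen.a)
def b : Atilde k := mk k (X k Gen.b)
def x : Atilde k := mk k (X k Gen.x)
def y : Atilde k := mk k (X k Gen.y)

theorem mk_rel {s t : FreeAlgebra k Gen} (h : Rel k s t) : mk k s = mk k t :=
  RingQuot.mkAlgHom_rel k h

theorem rba : b k * a k = a k * b k := by simpa [a, b, x, y] using mk_rel k .ba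
theorem rya : y k * a k = a k * y k := by simpa [a, b, x, y] using mk_rel k .ya
theorem rbx : b k * x k = x k * b k := by simpa [a, b, x, y] using mk_rel k .bx
theorem ryx : y k * x k = x k * y k := by simpa [a, b, x, y] using mk_rel k .yx
theorem ryb : b k * y k = -(y k * b k) := by simpa [a, b, x, y] using mk_rel k .yb
theorem raax : a k ^ 2 * x k + a k * x k * a k + x k * a k ^ 2 + a k ^ 2 - a k ^ 3 = 0 := by
  simpa [a, b, x, y] using mk_rel k .aax
theorem rxxa : x k ^ 2 * a k + x k * a k * x k + a k * x k ^ 2 + x k * a k + a k * x k = 0 := by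
  simpa [a, b, x, y] using mk_rel k .xxa
theorem ryy : y k ^ 2 = x k ^ 2 + x k ^ 3 := by simpa [a, b, x, y] using mk_rel k .yy
theorem rbb : b k ^ 2 = a k ^ 3 := by simpa [a, b, x, y] using mk_rel k .bb
theorem raaa : a k ^ 3 = 1 := by simpa [a, b, x, y] using mk_rel k .aaa

variable {k}

/-- The defining relations of `Ã` for four elements of an algebra. -/
structure Rels {S : Type*} [Ring S] (a b x y : S) : Prop where
  ba : b * a = a * b
  ya : y * a = a * y
  bx : b * x = x * b
  yx : y * x = x * y
  yb : b * y = -(y * b)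
  aax : a ^ 2 * x + a * x * a + x * a ^ 2 + a ^ 2 - a ^ 3 = 0
  xxa : x ^ 2 * a + x * a * x + a * x ^ 2 + x * a + a * x = 0
  yy : y ^ 2 = x ^ 2 + x ^ 3
  bb : b ^ 2 = a ^ 3
  aaa : a ^ 3 = 1

/-- The universal property of `Ã`. -/
def lift {S : Type*} [Ring S] [Algebra k S] {a b x y : S} (h : Rels a b x y) : Atilde k →ₐ[k] S :=
  RingQuot.liftAlgHom k ⟨FreeAlgebra.lift k (fun g => Gen.rec a b x y g), by
    intro s t hst
    obtain ⟨h1, h2, h3, h4, h5, h6, h7, h8, h9, h10⟩ := h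
    cases hst <;> simpa⟩

section
variable {S : Type*} [Ring S] [Algebra k S] {a' b' x' y' : S} (h : Rels a' b' x' y')

theorem lift_mk (z : FreeAlgebra k Gen) :
    lift (k := k) h (mk k z) = FreeAlgebra.lift k (fun g => Gen.rec a' b' x' y' g) z :=
  RingQuot.liftAlgHom_mkAlgHom_apply ..

theorem lift_a : lift (k := k) h (a k) = a' := by simp [a, lift_mk]
theorem lift_b : lift (k := k) h (b k) = b' := by simp [b, lift_mk]
theorem lift_x : lift (k := k) h (x k) = x' := by simp [x, lift_mk]
theorem lift_y : lift (k := k) h (y k) = y' := by simp [y, lift_mk]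
end

theorem hom_ext {S : Type*} [Semiring S] [Algebra k S] {f g : Atilde k →ₐ[k] S}
    (ha : f (a k) = g (a k)) (hb : f (b k) = g (b k)) (hx : f (x k) = g (x k))
    (hy : f (y k) = g (y k)) : f = g := by
  apply RingQuot.ringQuot_ext' (S := k)
  apply FreeAlgebra.hom_ext
  funext i
  cases i
  · exact ha
  · exact hb
  · exact hx
  · exact hy

variable (k)

open Algebra.TensorProduct in
theorem comul_rels : Rels (a k ⊗ₜ[k] a k) (b k ⊗ₜ[k] b k) (1 ⊗ₜ[k] x k + x k ⊗ₜ[k] a k)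
    (1 ⊗ₜ[k] y k + y k ⊗ₜ[k] b k) where
  ba := by simp [rba]
  ya := by simp [mul_add, add_mul, rya, rba]
  bx := by simp [mul_add, add_mul, rbx, rba]
  yx := by
    simp only [mul_add, add_mul, tmul_mul_tmul, mul_one, one_mul, ryx, rya, rbx, rba]
    abel
  yb := by
    simp only [mul_add, add_mul, tmul_mul_tmul, mul_one, one_mul, ryb, TensorProduct.tmul_neg,
      TensorProduct.neg_tmul]
    abel
  aax := by
    have h1 : (a k ^ 2) ⊗ₜ[k] (a k ^ 2 * x k + a k * x k * a k + x k * a k ^ 2 + a k ^ 2 - a k ^ 3)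
      + (a k ^ 2 * x k + a k * x k * a k + x k * a k ^ 2 + a k ^ 2 - a k ^ 3) ⊗ₜ[k] (a k ^ 3)
        = 0 := by simp [raax]
    rw [← h1]
    simp only [pow_succ, pow_zero, one_mul, mul_add, add_mul, tmul_mul_tmul, mul_one,
      TensorProduct.tmul_add, TensorProduct.add_tmul, TensorProduct.tmul_sub,
      TensorProduct.sub_tmul, mul_assoc]
    abel
  xxa := by
    have h1 : a k ⊗ₜ[k]
          (x k ^ 2 * a k + x k * a k * x k + a k * x k ^ 2 + x k * a k + a k * x k)
        + (x k * a k + a k * x k) ⊗ₜ[k]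
          (a k ^ 2 * x k + a k * x k * a k + x k * a k ^ 2 + a k ^ 2 - a k ^ 3)
        + (x k ^ 2 * a k + x k * a k * x k + a k * x k ^ 2 + x k * a k + a k * x k) ⊗ₜ[k]
          (a k ^ 3) = 0 := by simp [raax, rxxa]
    rw [← h1]
    simp only [pow_succ, pow_zero, one_mul, mul_add, add_mul, tmul_mul_tmul, mul_one,
      TensorProduct.tmul_add, TensorProduct.add_tmul, TensorProduct.tmul_sub,
      TensorProduct.sub_tmul, mul_assoc]
    abel
  yy := by
    have h1 : x k ⊗ₜ[k]
          (x k ^ 2 * a k + x k * a k * x k + a k * x k ^ 2 + x k * a k + a k * x k)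
        + (x k ^ 2) ⊗ₜ[k]
          (a k ^ 2 * x k + a k * x k * a k + x k * a k ^ 2 + a k ^ 2 - a k ^ 3) = 0 := by
      simp [raax, rxxa]
    have h2 : (1 ⊗ₜ[k] y k + y k ⊗ₜ[k] b k) ^ 2
        = 1 ⊗ₜ[k] (x k ^ 2 + x k ^ 3) + (x k ^ 2 + x k ^ 3) ⊗ₜ[k] (a k ^ 3) := by
      rw [← rbb, ← ryy]
      simp only [pow_succ, pow_zero, one_mul, mul_add, add_mul, tmul_mul_tmul, mul_one, ryb,
        TensorProduct.tmul_neg]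
      abel
    rw [h2, ← sub_eq_zero, ← neg_eq_zero, ← h1]
    simp only [pow_succ, pow_zero, one_mul, mul_add, add_mul, tmul_mul_tmul, mul_one,
      TensorProduct.tmul_add, TensorProduct.add_tmul, TensorProduct.tmul_sub,
      TensorProduct.sub_tmul, mul_assoc]
    abel
  bb := by simp [rbb]
  aaa := by simp [raaa, one_def]

/-- The comultiplication: `Δ(a) = a ⊗ a`, `Δ(b) = b ⊗ b`, `Δ(x) = 1 ⊗ x + x ⊗ a`,
`Δ(y) = 1 ⊗ y + y ⊗ b`. -/
def comulHom : Atilde k →ₐ[k] Atilde k ⊗[k] Atilde k := lift (comul_rels k)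

theorem counit_rels : Rels (1 : k) 1 0 0 := by constructor <;> simp

/-- The counit: `ε(a) = ε(b) = 1`, `ε(x) = ε(y) = 0`. -/
def counitHom : Atilde k →ₐ[k] k :=
  lift (counit_rels k)

@[simp] theorem comulHom_a : comulHom k (a k) = a k ⊗ₜ a k := lift_a _
@[simp] theorem comulHom_b : comulHom k (b k) = b k ⊗ₜ b k := lift_b _
@[simp] theorem comulHom_x : comulHom k (x k) = 1 ⊗ₜ x k + x k ⊗ₜ a k := lift_x _
@[simp] theorem comulHom_y : comulHom k (y k) = 1 ⊗ₜ y k + y k ⊗ₜ b k := lift_y _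
@[simp] theorem counitHom_a : counitHom k (a k) = 1 := lift_a _
@[simp] theorem counitHom_b : counitHom k (b k) = 1 := lift_b _
@[simp] theorem counitHom_x : counitHom k (x k) = 0 := lift_x _
@[simp] theorem counitHom_y : counitHom k (y k) = 0 := lift_y _

instance : Bialgebra k (Atilde k) :=
  Bialgebra.ofAlgHom (comulHom k) (counitHom k)
    (by
      apply hom_ext <;>
        simp [TensorProduct.tmul_add, TensorProduct.add_tmul, Algebra.TensorProduct.one_def,
          add_assoc])
    (by apply hom_ext <;> simp)
    (by apply hom_ext <;> simp)

theorem comul_eq (z : Atilde k) : Coalgebra.comul (R := k) z = comulHom k z := rfl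
theorem counit_eq (z : Atilde k) : Coalgebra.counit (R := k) z = counitHom k z := rfl

/-- Rewriting rules of `Ã`. -/
theorem raa (t : Atilde k) : a k * (a k * (a k * t)) = t := by
  have := congrArg (· * t) (raaa k)
  simpa [pow_succ, mul_assoc] using this

theorem raa' : a k * (a k * a k) = 1 := by
  simpa using raa k 1

theorem rxaa (t : Atilde k) : x k * (a k * (a k * t)) =
    t - a k * (a k * (x k * t)) - a k * (x k * (a k * t)) - a k * (a k * t) := by
  have h := congrArg (· * t) (raax k)
  simp only [pow_succ, pow_zero, one_mul, add_mul, sub_mul, zero_mul, mul_assoc, raa] at h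
  rw [← sub_eq_zero, ← h]
  abel

theorem rxaa' : x k * (a k * a k) =
    1 - a k * (a k * x k) - a k * (x k * a k) - a k * a k := by
  simpa using rxaa k 1

theorem rxxa1 (t : Atilde k) : x k * (x k * (a k * t)) =
    - (x k * (a k * (x k * t))) - a k * (x k * (x k * t)) - x k * (a k * t) - a k * (x k * t) := by
  have h := congrArg (· * t) (rxxa k)
  simp only [pow_succ, pow_zero, one_mul, add_mul, sub_mul, zero_mul, mul_assoc, raa] at h
  rw [← sub_eq_zero, ← h]
  abel

theorem rxxa1' : x k * (x k * a k) =
    - (x k * (a k * x k)) - a k * (x k * x k) - x k * a k - a k * x k := by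
  simpa using rxxa1 k 1

theorem rbb1 : b k * b k = 1 := by
  rw [← pow_two, rbb, raaa]

theorem rbb2 (t : Atilde k) : b k * (b k * t) = t := by
  rw [← mul_assoc, rbb1, one_mul]

theorem rba2 (t : Atilde k) : b k * (a k * t) = a k * (b k * t) := by
  rw [← mul_assoc, rba, mul_assoc]

theorem rbx2 (t : Atilde k) : b k * (x k * t) = x k * (b k * t) := by
  rw [← mul_assoc, rbx, mul_assoc]

theorem ryb2 (t : Atilde k) : b k * (y k * t) = - (y k * (b k * t)) := by
  rw [← mul_assoc, ryb, neg_mul, mul_assoc]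

theorem rya2 (t : Atilde k) : y k * (a k * t) = a k * (y k * t) := by
  rw [← mul_assoc, rya, mul_assoc]

theorem ryx2 (t : Atilde k) : y k * (x k * t) = x k * (y k * t) := by
  rw [← mul_assoc, ryx, mul_assoc]

theorem rxxx : x k * (x k * x k) = y k * y k - x k * x k := by
  have h := ryy k
  simp only [pow_succ, pow_zero, one_mul, mul_assoc] at h
  rw [h]
  abel

open MulOpposite in
theorem antipode_rels : Rels (op (a k * a k)) (op (b k)) (op (-(x k * (a k * a k))))
    (op (-(y k * b k))) := by
  constructor <;> apply unop_injective <;>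
    simp only [pow_succ, pow_zero, one_mul, mul_add, add_mul, mul_sub, sub_mul, mul_neg, neg_mul,
      neg_neg, neg_add, neg_sub, unop_mul, unop_op, unop_add, unop_sub, unop_neg, unop_one,
      unop_zero, mul_one,
      mul_assoc, raa, raa', rxaa, rxaa', rxxa1, rxxa1', rbb1, rbb2, rba, rba2, rbx, rbx2, ryb, ryb2,
      rya, rya2, ryx, ryx2, rxxx] <;> abel

/-- The antipode as an anti-homomorphism: `S(a) = a⁻¹ = a²`, `S(b) = b⁻¹ = b`, `S(x) = - x a⁻¹`,
`S(y) = - y b⁻¹`. -/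
def antipodeHom : Atilde k →ₐ[k] (Atilde k)ᵐᵒᵖ := lift (antipode_rels k)

/-- The antipode. -/
def antipodeLin : Atilde k →ₗ[k] Atilde k :=
  (MulOpposite.opLinearEquiv k).symm.toLinearMap ∘ₗ (antipodeHom k).toLinearMap

theorem antipodeLin_mul (p q : Atilde k) :
    antipodeLin k (p * q) = antipodeLin k q * antipodeLin k p := by
  simp [antipodeLin]
theorem antipodeLin_one : antipodeLin k 1 = 1 := by simp [antipodeLin]
theorem antipodeLin_algebraMap (r : k) : antipodeLin k (algebraMap k _ r) = algebraMap k _ r := by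
  simp [antipodeLin]
theorem antipodeLin_a : antipodeLin k (a k) = a k * a k := by simp [antipodeLin, antipodeHom, lift_a]
theorem antipodeLin_b : antipodeLin k (b k) = b k := by simp [antipodeLin, antipodeHom, lift_b]
theorem antipodeLin_x : antipodeLin k (x k) = -(x k * (a k * a k)) := by
  simp [antipodeLin, antipodeHom, lift_x]
theorem antipodeLin_y : antipodeLin k (y k) = -(y k * b k) := by
  simp [antipodeLin, antipodeHom, lift_y]

variable {k} in
theorem gen_induction {C : Atilde k → Prop} (halg : ∀ r, C (algebraMap k _ r)) (ha : C (a k))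
    (hb : C (b k)) (hx : C (x k)) (hy : C (y k)) (hadd : ∀ p q, C p → C q → C (p + q))
    (hmul : ∀ p q, C p → C q → C (p * q)) (z : Atilde k) : C z := by
  obtain ⟨w, rfl⟩ := RingQuot.mkAlgHom_surjective k (Rel k) z
  change C (mk k w)
  induction w using FreeAlgebra.induction with
  | grade0 r => rw [AlgHom.commutes]; exact halg r
  | grade1 g => cases g <;> assumption
  | mul p q hp hq => rw [map_mul]; exact hmul _ _ hp hq
  | add p q hp hq => rw [map_add]; exact hadd _ _ hp hq

theorem mulR (t : Atilde k ⊗[k] Atilde k) (s : Atilde k ⊗[k] Atilde k) (c : k)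
    (h : LinearMap.mul' k (Atilde k) ((antipodeLin k).rTensor (Atilde k) t) = algebraMap k _ c) :
    LinearMap.mul' k (Atilde k) ((antipodeLin k).rTensor (Atilde k) (t * s)) =
      algebraMap k _ c * LinearMap.mul' k (Atilde k) ((antipodeLin k).rTensor (Atilde k) s) := by
  induction s with
  | zero => simp
  | add s1 s2 h1 h2 => simp only [mul_add, map_add, h1, h2]
  | tmul p q =>
    have key : LinearMap.mul' k (Atilde k) ((antipodeLin k).rTensor (Atilde k) (t * p ⊗ₜ q)) =
        antipodeLin k p *
          LinearMap.mul' k (Atilde k) ((antipodeLin k).rTensor (Atilde k) t) * q := by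
      clear h
      induction t with
      | zero => simp
      | add s1 s2 h1 h2 => simp only [mul_add, add_mul, map_add, h1, h2]
      | tmul u v => simp [antipodeLin_mul, mul_assoc]
    rw [key, h, ← Algebra.commutes]
    simp [mul_assoc]

theorem mulL (t : Atilde k ⊗[k] Atilde k) (s : Atilde k ⊗[k] Atilde k) (c : k)
    (h : LinearMap.mul' k (Atilde k) ((antipodeLin k).lTensor (Atilde k) s) = algebraMap k _ c) :
    LinearMap.mul' k (Atilde k) ((antipodeLin k).lTensor (Atilde k) (t * s)) =
      LinearMap.mul' k (Atilde k) ((antipodeLin k).lTensor (Atilde k) t) * algebraMap k _ c := by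
  induction t with
  | zero => simp
  | add s1 s2 h1 h2 => simp only [add_mul, map_add, h1, h2]
  | tmul p q =>
    have key : LinearMap.mul' k (Atilde k) ((antipodeLin k).lTensor (Atilde k) (p ⊗ₜ q * s)) =
        p * LinearMap.mul' k (Atilde k) ((antipodeLin k).lTensor (Atilde k) s) *
          antipodeLin k q := by
      clear h
      induction s with
      | zero => simp
      | add s1 s2 h1 h2 => simp only [mul_add, add_mul, map_add, h1, h2]
      | tmul u v => simp [antipodeLin_mul, mul_assoc]
    rw [key, h, mul_assoc, Algebra.commutes]
    simp [mul_assoc]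

instance : HopfAlgebra k (Atilde k) where
  antipode := antipodeLin k
  mul_antipode_rTensor_comul := by
    ext z
    simp only [LinearMap.comp_apply, comul_eq, counit_eq, Algebra.linearMap_apply]
    induction z using gen_induction with
    | halg r =>
      rw [AlgHom.commutes, AlgHom.commutes, Algebra.TensorProduct.algebraMap_apply]
      simp [antipodeLin_algebraMap]
    | ha => simp [antipodeLin_a, mul_assoc, raa']
    | hb => simp [antipodeLin_b, rbb1]
    | hx => simp [antipodeLin_x, antipodeLin_one, mul_assoc, raa']
    | hy => simp [antipodeLin_y, antipodeLin_one, mul_assoc, rbb1]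
    | hadd p q hp hq => simp only [map_add, hp, hq]
    | hmul p q hp hq => rw [map_mul, mulR k _ _ _ hp, hq, map_mul, map_mul]
  mul_antipode_lTensor_comul := by
    ext z
    simp only [LinearMap.comp_apply, comul_eq, counit_eq, Algebra.linearMap_apply]
    induction z using gen_induction with
    | halg r =>
      rw [AlgHom.commutes, AlgHom.commutes, Algebra.TensorProduct.algebraMap_apply]
      simp [antipodeLin_one]
    | ha => simp [antipodeLin_a, raa']
    | hb => simp [antipodeLin_b, rbb1]
    | hx => simp [antipodeLin_x, antipodeLin_a]
    | hy => simp [antipodeLin_y, antipodeLin_b]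
    | hadd p q hp hq => simp only [map_add, hp, hq]
    | hmul p q hp hq => rw [map_mul, mulL k _ _ _ hq, hp, map_mul, map_mul]

/-- `a` as a group-like element. -/
def ga : GroupLike k (Atilde k) := ⟨a k, ⟨by simp [counit_eq], by simp [comul_eq]⟩⟩

/-- `b` as a group-like element. -/
def gb : GroupLike k (Atilde k) := ⟨b k, ⟨by simp [counit_eq], by simp [comul_eq]⟩⟩

open SkewPrim

theorem x_mem : x k ∈ P k (ga k) := by simp [mem_P, comul_eq, ga]

theorem axa_mem : a k * x k * a k ^ 2 ∈ P k (ga k) := by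
  have h : a k * a k ^ 2 = 1 := by rw [← pow_succ', raaa]
  simp [mem_P, comul_eq, ga, mul_add, add_mul, h, mul_assoc]

theorem y_mem : y k ∈ P k (gb k) := by simp [mem_P, comul_eq, gb]

theorem x2x3_mem : x k ^ 2 + x k ^ 3 ∈ P k (1 : GroupLike k (Atilde k)) := by
  rw [← ryy, mem_P, comul_eq, map_pow, comulHom_y, GroupLike.val_one]
  simp only [pow_two, mul_add, add_mul, Algebra.TensorProduct.tmul_mul_tmul, mul_one, one_mul, ryb,
    rbb1, TensorProduct.tmul_neg]
  abel

/-- `u = [x] ∈ V_a(Ã)`. -/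
def u : VG k (ga k) := cls (ga k) (x k) (x_mem k)

/-- `v = [a x a²] ∈ V_a(Ã)`. -/
def v : VG k (ga k) := cls (ga k) (a k * x k * a k ^ 2) (axa_mem k)

/-- `[y] ∈ V_b(Ã)`. -/
def clsY : VG k (gb k) := cls (gb k) (y k) (y_mem k)

/-- `[x² + x³] ∈ V_1(Ã)`. -/
def clsX : VG k (1 : GroupLike k (Atilde k)) := cls 1 (x k ^ 2 + x k ^ 3) (x2x3_mem k)

/-- The element `c` of `Ã`, a central primitive element that is defined over every field. -/
def c : Atilde k :=
  (x k * a k) ^ 3 + 2 * a k * (x k * a k) ^ 2 * x k + a k * (x k * a k) ^ 2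
    - 3 * a k ^ 2 * (x k * a k) * x k ^ 2 - 2 * a k ^ 2 * (x k * a k) * x k - (x k * a k) * x k
    + a k * x k ^ 2 + a k * x k - 2 * x k ^ 2 - 2 * x k

set_option maxHeartbeats 4000000 in
theorem c_mem : c k ∈ P k (1 : GroupLike k (Atilde k)) := by
  have h3 : (3 : Atilde k) = 1 + 1 + 1 := by norm_num
  have h2 : (2 : Atilde k) = 1 + 1 := by norm_num
  rw [mem_P, comul_eq, GroupLike.val_one]
  simp only [c, h2, h3, map_add, map_sub, map_mul, map_pow, map_one, comulHom_a, comulHom_x]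
  simp only [pow_succ, pow_zero, one_mul, mul_one, mul_add, add_mul, mul_sub, sub_mul,
    Algebra.TensorProduct.tmul_mul_tmul, TensorProduct.tmul_add, TensorProduct.add_tmul,
    TensorProduct.tmul_sub, TensorProduct.sub_tmul, TensorProduct.tmul_neg, TensorProduct.neg_tmul,
    mul_neg, neg_mul, mul_assoc, raa, raa', rxaa, rxaa', rxxa1, rxxa1']
  abel

/-- `[c] ∈ V_1(Ã)`. -/
def clsC : VG k (1 : GroupLike k (Atilde k)) := cls 1 (c k) (c_mem k)

end Atilde

open SkewPrim Nichols Atilde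

/-- The braided vector space of skew primitives of `Ã`, all group-like elements together. -/
abbrev VAll : Type u := V k (Atilde k)
/-- `V_1(Ã)` -/
abbrev V1 : Type u := VG k (1 : GroupLike k (Atilde k))
/-- `V_a(Ã)` -/
abbrev Va : Type u := VG k (ga k)
/-- `V_b(Ã)` -/
abbrev Vb : Type u := VG k (gb k)

/-- The Nichols algebra of `Ã`. -/
abbrev BAll : Type u := NicholsAlgebra (braiding k (Atilde k))
/-- The Nichols algebra of `V_1(Ã)`. -/
abbrev B1 : Type u := NicholsAlgebra (braidingVG (1 : GroupLike k (Atilde k)))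
/-- The Nichols algebra of `V_a(Ã)`. -/
abbrev Ba : Type u := NicholsAlgebra (braidingVG (ga k))
/-- The Nichols algebra of `V_b(Ã)`. -/
abbrev Bb : Type u := NicholsAlgebra (braidingVG (gb k))

/-- The canonical map `V(Ã) → B(V(Ã))`. -/
abbrev jAll : VAll k →ₗ[k] BAll k := ι (braiding k (Atilde k))
/-- The canonical map `V_1(Ã) → B(V_1(Ã))`. -/
abbrev j1 : V1 k →ₗ[k] B1 k := ι (braidingVG (1 : GroupLike k (Atilde k)))
/-- The canonical map `V_a(Ã) → B(V_a(Ã))`. -/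
abbrev ja : Va k →ₗ[k] Ba k := ι (braidingVG (ga k))
/-- The canonical map `V_b(Ã) → B(V_b(Ã))`. -/
abbrev jb : Vb k →ₗ[k] Bb k := ι (braidingVG (gb k))

/-- The first free generator in the presentation of `B(V_a(Ã))`. -/
abbrev U : FreeAlgebra k (Fin 2) := FreeAlgebra.ι k 0
/-- The second free generator in the presentation of `B(V_a(Ã))`. -/
abbrev W : FreeAlgebra k (Fin 2) := FreeAlgebra.ι k 1

/-- The relations `u³ = v³ = 0`, `u² v + u v u + v u² = 0`, `u² + u v + v² = 0`. -/
inductive RelA : FreeAlgebra k (Fin 2) → FreeAlgebra k (Fin 2) → Prop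
  | uuu : RelA (U k ^ 3) 0
  | vvv : RelA (W k ^ 3) 0
  | uuv : RelA (U k ^ 2 * W k + U k * W k * U k + W k * U k ^ 2) 0
  | uv : RelA (U k ^ 2 + U k * W k + W k ^ 2) 0

end
end NodalCubic
end

/-! The analysis of `Ã` rests on one explicit basis. The elements z = x² + x³ = y² and c are
central, and x, y, c generate a commutative subalgebra S = k[x, y, c]/(y² - x² - x³). As a right
S-module, `Ã` is free on the 18 elements aⁱ(xa)ʲbⁿ. Spanning is a normal form computation.
Independence comes from operators on the free S-module of rank 18 that satisfy the relations of `Ã`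
(`op_rels`, `toA_coef`, `coef_E`).

Group-like and skew primitive elements are found by applying φ ⊗ id or id ⊗ φ to Δ. The result is a
multiple of g for a group-like g, and φ(1)h + φ(h)g or φ(h)1 + φ(g)h for a skew primitive h. If φ is
the constant coefficient at a basis element, φ ⊗ id is right S-linear. Comparing coordinates then
forces group-likes into aⁱbⁿS, and skew primitives into S up to multiples of g - 1 and, for g = a,
of a²xa. On S, which has the basis xˡyᵉ (l < 3, e < 2) over k[z, c], the maps id ⊗ φ are k[z,
c]-linear and finish the classification (`groupLike_eq_gE`, `skew_one`, `skew_a`, `skew_b`,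
`skew_other`). For g = 1 the answer is a subspace of k[z, c]. In characteristic zero id ⊗ φ also
realises ∂/∂z and ∂/∂c there, so primitive elements are linear in z and c (`primitive_eq`).

For Nichols algebras, the recursion of the quantum symmetriser is encoded by operators m
(concatenation) and L (quantum shuffle) on a space with a vacuum vector, subject to one commutation
rule (`IsFock`). For any such pair, the m-word of a symmetrised tensor and the L-word of the tensor
agree on the vacuum, so kernels of symmetrisers act by zero through L. Applied to the tensor product
of two Fock spaces this gives B(V₁ ⊕ V₂) = B(V₁) ⊗ B(V₂) when the summands are exchanged by the flip
(`IsFlipSum.exists_algEquiv`).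

For V_a, a 9-dimensional space with left multiplications by u, v and two skew derivations identifies
the kernels of the symmetrisers exactly (`Reg.quantumSymmetriser_eq_zero_iff`). The same space is
the regular representation of the presented algebra, whence `exists_presentation`. On V_b all
products of two vectors vanish. On V_1 the symmetriser becomes multiplication by a factorial in any
commutative algebra. -/

noncomputable section

namespace NodalCubic

open Atilde

/-! ### The model: operators of a, b, x, y on a free module of rank 18. -/

namespace Model

universe u
variable {C : Type u} [CommRing C] (X Y c : C)

/-- The operator of `a` on the free module with basis `aⁱ (x a)ʲ`. -/
def opA0 : (Fin 3 → Fin 3 → C) →ₗ[C] (Fin 3 → Fin 3 → C) where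
  toFun f := ![f 2, f 0, f 1]
  map_add' f g := by ext i j; fin_cases i <;> rfl
  map_smul' r f := by ext i j; fin_cases i <;> rfl

/-- The operator of `x` on the free module with basis `aⁱ (x a)ʲ`. -/
def opX0 : (Fin 3 → Fin 3 → C) →ₗ[C] (Fin 3 → Fin 3 → C) where
  toFun f := ![![X * f 0 0 + f 2 0 + (X ^ 2 + X) * f 2 1 + (X ^ 2 + X) * f 0 2
        + (c + 2 * X ^ 2 + 2 * X) * f 1 2,
      f 1 0 - (X + 1) * f 0 1 + f 2 1 + X * f 1 2 - (2 * X ^ 2 + X) * f 2 2,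
      f 1 1 + X * f 0 2 + f 2 2],
    ![-(X ^ 2 + X) * f 0 1 - (X ^ 2 + X) * f 1 2 - (c - 2 * X ^ 3 - X ^ 2 + X) * f 2 2,
      -f 2 0 - (X ^ 2 + X) * f 0 2 - X * f 2 2,
      -f 2 1 - (2 * X + 1) * f 1 2],
    ![-(X + 1) * f 2 0 - (2 * X ^ 3 + 3 * X ^ 2 + X) * f 0 2,
      X * f 2 1 + (3 * X ^ 2 + 2 * X) * f 1 2,
      X * f 2 2]]
  map_add' f g := by ext i j; fin_cases i <;> fin_cases j <;> simp <;> ring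
  map_smul' r f := by ext i j; fin_cases i <;> fin_cases j <;> simp <;> ring

theorem opA0_cube : (opA0 (C := C)) ^ 3 = 1 := by
  refine LinearMap.ext fun f => ?_
  funext i j; fin_cases i <;> simp [pow_succ, opA0]

theorem opX0_aax : opA0 ^ 2 * opX0 X c + opA0 * opX0 X c * opA0 + opX0 X c * opA0 ^ 2 + opA0 ^ 2
    - opA0 ^ 3 = 0 := by
  refine LinearMap.ext fun f => ?_
  funext i j
  fin_cases i <;> fin_cases j <;>
    simp [pow_succ, opA0, opX0, Matrix.vecHead, Matrix.vecTail] <;> ring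

theorem opX0_xxa : opX0 X c ^ 2 * opA0 + opX0 X c * opA0 * opX0 X c + opA0 * opX0 X c ^ 2
    + opX0 X c * opA0 + opA0 * opX0 X c = 0 := by
  refine LinearMap.ext fun f => ?_
  funext i j; fin_cases i <;> fin_cases j <;> simp [pow_succ, opA0, opX0] <;> ring

/-- The operator of x is not scalar, but this combination must be, since x² + x³ is central in `Ã`.
-/
theorem opX0_cube : opX0 X c ^ 2 + opX0 X c ^ 3 = (X ^ 2 + X ^ 3) • 1 := by
  refine LinearMap.ext fun f => ?_
  funext i j; fin_cases i <;> fin_cases j <;> simp [pow_succ, opX0] <;> ring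

/-- The free module with basis `aⁱ (x a)ʲ bⁿ`. -/
abbrev M (C : Type u) : Type u := Fin 2 → Fin 3 → Fin 3 → C

/-- The action of an operator on both components of `M C`. -/
def both : Module.End C (Fin 3 → Fin 3 → C) →+* Module.End C (M C) where
  toFun T := T.compLeft (Fin 2)
  map_one' := rfl
  map_mul' _ _ := rfl
  map_zero' := rfl
  map_add' _ _ := rfl

@[simp] theorem both_apply (T : Module.End C (Fin 3 → Fin 3 → C)) (f : M C)
    (n : Fin 2) : both T f n = T (f n) := rfl

/-- The operator of `b`. -/
def opB : Module.End C (M C) where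
  toFun f := ![f 1, f 0]
  map_add' f g := by ext n; fin_cases n <;> rfl
  map_smul' r f := by ext n; fin_cases n <;> rfl

/-- The operator of `y`. -/
def opY : Module.End C (M C) where
  toFun f := ![Y • f 0, -(Y • f 1)]
  map_add' f g := by
    ext n i j
    fin_cases n
    · simp
    · simp [add_comm]
  map_smul' r f := by ext n i j; fin_cases n <;> simp [mul_left_comm]

-- The relations between a and x hold on each of the two components. The operator of b interchanges
-- the components and that of y is Y on one and -Y on the other, which gives by = -yb. By
-- `opX0_cube`, y² = x² + x³ reduces to the equation of the curve.
variable {X Y} in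
theorem op_rels (h : Y ^ 2 = X ^ 2 + X ^ 3) :
    Rels (both opA0) opB (both (opX0 X c)) (opY Y) where
  ba := by
    refine LinearMap.ext fun f => ?_
    funext n; fin_cases n <;> simp [opB]
  ya := by
    refine LinearMap.ext fun f => ?_
    funext n; fin_cases n <;> simp [opY]
  bx := by
    refine LinearMap.ext fun f => ?_
    funext n; fin_cases n <;> simp [opB]
  yx := by
    refine LinearMap.ext fun f => ?_
    funext n; fin_cases n <;> simp [opY]
  yb := by
    refine LinearMap.ext fun f => ?_
    funext n; fin_cases n <;> simp [opY, opB]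
  aax := by simpa only [map_add, map_sub, map_mul, map_pow, map_zero] using
    congrArg both (opX0_aax X c)
  xxa := by simpa only [map_add, map_sub, map_mul, map_pow, map_zero] using
    congrArg both (opX0_xxa X c)
  yy := by
    refine LinearMap.ext fun f => ?_
    rw [← map_pow, ← map_pow, ← map_add, opX0_cube, ← h]
    funext n
    fin_cases n <;> simp [opY, pow_succ, mul_smul]
  bb := by
    rw [← map_pow, opA0_cube, map_one]
    refine LinearMap.ext fun f => ?_
    funext n
    fin_cases n <;> simp [opB, pow_succ]
  aaa := by rw [← map_pow, opA0_cube, map_one]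

variable {X Y} in
/-- The representation of `Ã` on `M C`. -/
def rep (k : Type*) [Field k] [Algebra k C] (h : Y ^ 2 = X ^ 2 + X ^ 3) :
    Atilde k →ₐ[k] Module.End C (M C) :=
  lift (op_rels c h)

/-- The basis vector of the model that corresponds to `1`. -/
def e0 (C : Type u) [CommRing C] : M C := ![![![1, 0, 0], 0, 0], 0]

/-- The vector of 1 is a common eigenvector of x, y and c, with eigenvalues X, Y and c. This is what
makes the coordinates of `Ã` linear over the coordinate ring in `coef_mul_ev`. -/
theorem both_opX0_e0 : both (opX0 X c) (e0 C) = X • e0 C := by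
  funext n i j
  fin_cases n <;> fin_cases i <;> fin_cases j <;> simp [opX0, e0]

theorem opY_e0 : opY Y (e0 C) = Y • e0 C := by
  funext n i j
  fin_cases n <;> fin_cases i <;> fin_cases j <;> simp [opY, e0]

theorem M_smul_smul (s t : C) (f : M C) : (s * t) • f = s • t • f := by
  funext n i j; simp [mul_assoc]

theorem both_single (T : Module.End C (Fin 3 → Fin 3 → C)) (n : Fin 2)
    (v : Fin 3 → Fin 3 → C) : both T (Pi.single n v) = Pi.single n (T v) := by
  funext m
  rcases eq_or_ne m n with rfl | h
  · simp
  · simp [h]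

variable (C) in
/-- The basis vectors of the free module of rank nine. -/
abbrev vec (i j : Fin 3) : Fin 3 → Fin 3 → C := Pi.single i (Pi.single j 1)

theorem opA0_single (i j : Fin 3) :
    opA0 (Pi.single i (Pi.single j (1 : C))) = Pi.single (i + 1) (Pi.single j 1) := by
  funext i' j'
  fin_cases i <;> fin_cases i' <;> simp [opA0]

/-- Since x·a = xa and x·a(xa) = (xa)² are themselves basis elements, no rewriting occurs here. -/
theorem opX0_single :
    opX0 X c (Pi.single 1 (Pi.single 0 1)) = Pi.single 0 (Pi.single 1 1) ∧
    opX0 X c (Pi.single 1 (Pi.single 1 1)) = Pi.single 0 (Pi.single 2 1) := by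
  constructor <;>
  · funext i j
    fin_cases i <;> fin_cases j <;> simp [opX0]

section
variable (k : Type*) [Field k] [Algebra k C] {X Y} (h : Y ^ 2 = X ^ 2 + X ^ 3)

theorem rep_a : rep c k h (a k) = both opA0 := lift_a _
theorem rep_b : rep c k h (b k) = opB := lift_b _
theorem rep_x : rep c k h (x k) = both (opX0 X c) := lift_x _
theorem rep_y : rep c k h (y k) = opY Y := lift_y _

theorem rep_pow_b_e0 (n : Fin 2) :
    rep c k h (b k ^ (n : ℕ)) (e0 C) = Pi.single n (Pi.single 0 (Pi.single 0 1)) := by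
  rw [map_pow, rep_b]
  funext n' i j
  fin_cases n <;> fin_cases n' <;> fin_cases i <;> fin_cases j <;> simp [opB, e0]

theorem rep_pow_xa (n : Fin 2) (j : Fin 3) :
    rep c k h ((x k * a k) ^ (j : ℕ)) (Pi.single n (Pi.single 0 (Pi.single 0 1))) =
      Pi.single n (Pi.single 0 (Pi.single j 1)) := by
  rw [map_pow, map_mul, rep_a, rep_x]
  fin_cases j <;> simp [pow_succ, both_single, opA0_single, opX0_single]

theorem rep_pow_a (n : Fin 2) (i j : Fin 3) :
    rep c k h (a k ^ (i : ℕ)) (Pi.single n (Pi.single 0 (Pi.single j 1))) =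
      Pi.single n (Pi.single i (Pi.single j 1)) := by
  rw [map_pow, rep_a]
  fin_cases i <;> simp [pow_succ, both_single, opA0_single]

/-- The vector `v` of the model in the component `n = 0`. -/
theorem e0_eq : e0 C = Pi.single 0 (Pi.single 0 (Pi.single 0 1)) := by
  funext n i j
  fin_cases n <;> fin_cases i <;> fin_cases j <;> simp [e0]

/-- The parameter c enters the operator of x through x·a(xa)² = (xa)³, whose normal form has c in
its constant part. The remaining terms of `Atilde.c` cancel everything else. -/
theorem rep_c_e0 : rep c k h (Atilde.c k) (e0 C) = c • e0 C := by
  have h3 : (3 : Atilde k) = 1 + 1 + 1 := by norm_num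
  have h2 : (2 : Atilde k) = 1 + 1 := by norm_num
  have hx1 : opX0 X c (vec C 0 2) =
      X • vec C 0 2 + (X ^ 2 + X) • vec C 0 0
        - (X ^ 2 + X) • vec C 1 1
        - (2 * X ^ 3 + 3 * X ^ 2 + X) • vec C 2 0 := by
    funext i j
    fin_cases i <;> fin_cases j <;> simp [opX0, vec]
  have hx2 : opX0 X c (vec C 1 2) =
      (c + 2 * X ^ 2 + 2 * X) • vec C 0 0
        - (2 * X + 1) • vec C 1 2
        + (3 * X ^ 2 + 2 * X) • vec C 2 1 + X • vec C 0 1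
        - (X ^ 2 + X) • vec C 1 0 := by
    funext i j
    fin_cases i <;> fin_cases j <;> simp [opX0, vec]
  have hx0 : opX0 X c (vec C 0 0) = X • vec C 0 0 := by
    funext i j
    fin_cases i <;> fin_cases j <;> simp [opX0, vec]
  rw [e0_eq]
  simp only [Atilde.c, map_add, map_sub, map_mul, map_pow, rep_a, rep_x, h2, h3, map_one, pow_succ,
    pow_zero, one_mul, LinearMap.add_apply, LinearMap.sub_apply, Module.End.mul_apply,
    Module.End.one_apply, both_single, opA0_single, hx0, opX0_single, map_smul]
  funext n i j
  fin_cases n <;> fin_cases i <;> fin_cases j <;>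
    simp [both_single, opA0_single, opX0_single, hx1, hx2] <;> ring
end

end Model
end NodalCubic

namespace NodalCubic

open Atilde

namespace Model

universe u
variable (k : Type u) [Field k]

/-! ### The central element `c` -/

set_option maxHeartbeats 1000000 in
set_option linter.unusedSimpArgs false in
theorem x_c : x k * c k = c k * x k := by
  have h3 : (3 : Atilde k) = 1 + 1 + 1 := by norm_num
  have h2 : (2 : Atilde k) = 1 + 1 := by norm_num
  simp only [c, h2, h3, pow_succ, pow_zero, one_mul, mul_one, mul_add, add_mul, mul_sub, sub_mul,
    mul_neg, neg_mul, mul_assoc, raa, raa', rxaa, rxaa', rxxa1, rxxa1']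
  abel

set_option maxHeartbeats 1000000 in
set_option linter.unusedSimpArgs false in
theorem a_c : a k * c k = c k * a k := by
  have h3 : (3 : Atilde k) = 1 + 1 + 1 := by norm_num
  have h2 : (2 : Atilde k) = 1 + 1 := by norm_num
  simp only [c, h2, h3, pow_succ, pow_zero, one_mul, mul_one, mul_add, add_mul, mul_sub, sub_mul,
    mul_neg, neg_mul, mul_assoc, raa, raa', rxaa, rxaa', rxxa1, rxxa1']
  abel

/-- c is a polynomial in a and x, so it lies in every centraliser that contains both. This settles
commutation with b and y without expanding c. -/
theorem mem_centralizer_c {g : Atilde k} (ha : a k * g = g * a k) (hx : x k * g = g * x k) :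
    c k * g = g * c k := by
  have h1 : a k ∈ Subalgebra.centralizer k {g} := by
    rw [Subalgebra.mem_centralizer_iff]; simpa using ha.symm
  have h2 : x k ∈ Subalgebra.centralizer k {g} := by
    rw [Subalgebra.mem_centralizer_iff]; simpa using hx.symm
  have h3 : c k ∈ Subalgebra.centralizer k {g} := by
    unfold c
    repeat' first
      | exact h1
      | exact h2
      | exact ofNat_mem _ _
      | apply sub_mem
      | apply add_mem
      | apply mul_mem
      | apply pow_mem
  simpa using ((Subalgebra.mem_centralizer_iff k).1 h3 g rfl).symm

theorem b_c : b k * c k = c k * b k := (mem_centralizer_c k (rba k).symm (rbx k).symm).symm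
theorem y_c : y k * c k = c k * y k := (mem_centralizer_c k (rya k).symm (ryx k).symm).symm

theorem c_comm (h : Atilde k) : c k * h = h * c k := by
  induction h using gen_induction with
  | halg r => exact (Algebra.commutes r _).symm
  | ha => exact (a_c k).symm
  | hb => exact (b_c k).symm
  | hx => exact (x_c k).symm
  | hy => exact (y_c k).symm
  | hadd p q hp hq => rw [mul_add, add_mul, hp, hq]
  | hmul p q hp hq => rw [← mul_assoc, hp, mul_assoc, hq, mul_assoc]

/-- The central element `z = x² + x³ = y²`. -/
abbrev z : Atilde k := x k ^ 2 + x k ^ 3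

/-- The form y² visibly commutes with a, with y, and with b, where two signs cancel. The form x² +
x³ visibly commutes with x. -/
theorem z_comm (h : Atilde k) : z k * h = h * z k := by
  induction h using gen_induction with
  | halg r => exact (Algebra.commutes r _).symm
  | ha => rw [z, ← ryy, pow_two, mul_assoc, rya, ← mul_assoc, rya, mul_assoc]
  | hb => rw [z, ← ryy, pow_two, mul_assoc, ← neg_neg (y k * b k), ← ryb, mul_neg, ← mul_assoc,
      ← neg_mul, ← ryb, mul_assoc]
  | hx => simp only [z]; noncomm_ring
  | hy => rw [z, ← ryy]; noncomm_ring
  | hadd p q hp hq => rw [mul_add _ p, add_mul p, hp, hq]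
  | hmul p q hp hq => rw [← mul_assoc, hp, mul_assoc, hq, mul_assoc]

/-! ### The coordinate ring `k[x, y, c]` -/

/-- The polynomial ring in `x` (outer variable) and `c` (inner variable). -/
abbrev R : Type u := Polynomial (Polynomial k)

/-- The polynomial `x² + x³`. -/
abbrev zR : R k := Polynomial.X ^ 2 + Polynomial.X ^ 3

/-- The ring `k[x, y, c] / (y² - x² - x³)`. -/
def S : Type u := QuadraticAlgebra (R k) (zR k) 0

instance : CommRing (S k) := inferInstanceAs (CommRing (QuadraticAlgebra (R k) (zR k) 0))
instance : Algebra k (S k) := inferInstanceAs (Algebra k (QuadraticAlgebra (R k) (zR k) 0))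

variable {k} in
/-- The component `p` of `p + q y`. -/
def re (s : S k) : R k := QuadraticAlgebra.re s
variable {k} in
/-- The component `q` of `p + q y`. -/
def im (s : S k) : R k := QuadraticAlgebra.im s

variable {k} in
theorem S_ext {s t : S k} (h : re s = re t) (h' : im s = im t) : s = t := QuadraticAlgebra.ext h h'

/-- The element `p + q y` of the coordinate ring. -/
def sMk (p q : R k) : S k := (⟨p, q⟩ : QuadraticAlgebra (R k) (zR k) 0)

section
variable (s t : S k) (r : k) (p q : R k)
@[simp] theorem re_mk : re (sMk k p q) = p := rfl
@[simp] theorem im_mk : im (sMk k p q) = q := rfl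
@[simp] theorem re_add : re (s + t) = re s + re t := rfl
@[simp] theorem im_add : im (s + t) = im s + im t := rfl
@[simp] theorem re_smul : re (r • s) = r • re s := rfl
@[simp] theorem im_smul : im (r • s) = r • im s := rfl
@[simp] theorem re_one : re (1 : S k) = 1 := rfl
@[simp] theorem im_one : im (1 : S k) = 0 := rfl
@[simp] theorem re_mul : re (s * t) = re s * re t + zR k * im s * im t :=
  QuadraticAlgebra.re_mul (R := R k) ..
@[simp] theorem im_mul : im (s * t) = re s * im t + im s * re t := by
  have := QuadraticAlgebra.im_mul (R := R k) (a := zR k) (b := 0) s t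
  rw [zero_mul, zero_mul, add_zero] at this
  exact this
end

/-- `x` as an element of the coordinate ring. -/
def sX : S k := sMk k Polynomial.X 0
/-- `y` as an element of the coordinate ring. -/
def sY : S k := sMk k 0 1
/-- `c` as an element of the coordinate ring. -/
def sC : S k := sMk k (Polynomial.C Polynomial.X) 0

theorem sYY : sY k ^ 2 = sX k ^ 2 + sX k ^ 3 := by
  apply S_ext <;> simp [sY, sX, pow_succ, zR]

/-- The evaluation `k[x, c] → Ã`. -/
def evR : R k →ₐ[k] Atilde k where
  __ := Polynomial.eval₂RingHom' (Polynomial.aeval (R := k) (c k)).toRingHom (x k) (fun p => by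
    induction p using Polynomial.induction_on' with
    | add p q hp hq => rw [map_add]; exact hp.add_left hq
    | monomial n r =>
      simp only [AlgHom.toRingHom_eq_coe, RingHom.coe_coe, Polynomial.aeval_monomial]
      exact Commute.mul_left (Algebra.commutes r (x k)) (Commute.pow_left (c_comm k (x k)) n))
  commutes' r := by
    simp [Polynomial.eval₂RingHom', Polynomial.algebraMap_apply]

@[simp] theorem evR_X : evR k Polynomial.X = x k := by
  simp [evR, Polynomial.eval₂RingHom']
@[simp] theorem evR_c : evR k (Polynomial.C Polynomial.X) = c k := by
  simp [evR, Polynomial.eval₂RingHom']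

/-- The linear map `k[x, y, c] / (y² - x² - x³) → Ã`. -/
def ev : S k →ₗ[k] Atilde k where
  toFun s := evR k (re s) + evR k (im s) * y k
  map_add' s t := by simp [add_mul]; abel
  map_smul' r s := by simp

theorem R_induction {P : R k → Prop} (h0 : P 1) (hadd : ∀ p q, P p → P q → P (p + q))
    (hsmul : ∀ (r : k) p, P p → P (r • p))
    (hX : ∀ p, P p → P (Polynomial.X * p)) (hc : ∀ p, P p → P (Polynomial.C Polynomial.X * p))
    (p : R k) : P p := by
  have h1 : ∀ p : Polynomial k, P (Polynomial.C p) := by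
    intro p
    induction p using Polynomial.induction_on' with
    | add p q hp hq => rw [map_add]; exact hadd _ _ hp hq
    | monomial n r =>
      rw [← Polynomial.C_mul_X_pow_eq_monomial, map_mul]
      have e : ∀ p : R k, Polynomial.C (Polynomial.C r) * p = r • p := fun p => by
        ext; simp
      rw [e]
      apply hsmul
      induction n with
      | zero => simpa using h0
      | succ n ih => rw [pow_succ', map_mul]; exact hc _ ih
  induction p using Polynomial.induction_on' with
  | add p q hp hq => exact hadd _ _ hp hq
  | monomial n r =>
    rw [← Polynomial.C_mul_X_pow_eq_monomial, mul_comm]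
    induction n with
    | zero => simpa using h1 r
    | succ n ih => rw [pow_succ', mul_assoc]; exact hX _ ih

/-- Induction along multiplication by the generators x, y, c. Statements about `ev`, whose target is
noncommutative, then need checking for one letter at a time only. -/
theorem S_induction {P : S k → Prop} (h0 : P 1) (hadd : ∀ p q, P p → P q → P (p + q))
    (hsmul : ∀ (r : k) p, P p → P (r • p)) (hX : ∀ p, P p → P (sX k * p))
    (hY : ∀ p, P p → P (sY k * p)) (hc : ∀ p, P p → P (sC k * p)) (s : S k) : P s := by
  have h1 : ∀ p : R k, P (sMk k p 0) := by
    intro p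
    induction p using R_induction with
    | h0 => exact h0
    | hadd p q hp hq =>
      rw [show sMk k (p + q) 0 = sMk k p 0 + sMk k q 0 by apply S_ext <;> simp]
      exact hadd _ _ hp hq
    | hsmul r p hp =>
      rw [show sMk k (r • p) 0 = r • sMk k p 0 by apply S_ext <;> simp]; exact hsmul _ _ hp
    | hX p hp =>
      rw [show sMk k (Polynomial.X * p) 0 = sX k * sMk k p 0 by apply S_ext <;> simp [sX]]
      exact hX _ hp
    | hc p hp =>
      rw [show sMk k (Polynomial.C Polynomial.X * p) 0 = sC k * sMk k p 0 by
        apply S_ext <;> simp [sC]]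
      exact hc _ hp
  have e : s = sMk k (re s) 0 + sY k * sMk k (im s) 0 := by
    apply S_ext <;> simp [sY]
  rw [e]
  exact hadd _ _ (h1 _) (hY _ (h1 _))

theorem evR_y (p : R k) : evR k p * y k = y k * evR k p := by
  induction p using R_induction with
  | h0 => simp
  | hadd p q hp hq => rw [map_add, add_mul, mul_add, hp, hq]
  | hsmul r p hp => rw [map_smul, smul_mul_assoc, mul_smul_comm, hp]
  | hX p hp => rw [map_mul, evR_X, mul_assoc, hp, ← mul_assoc, ← mul_assoc, ryx]
  | hc p hp => rw [map_mul, evR_c, mul_assoc, hp, ← mul_assoc, ← mul_assoc, c_comm]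

@[simp] theorem ev_one : ev k 1 = 1 := by simp [ev]
@[simp] theorem ev_X_mul (s : S k) : ev k (sX k * s) = x k * ev k s := by
  simp [ev, sX, mul_add, mul_assoc]
@[simp] theorem ev_c_mul (s : S k) : ev k (sC k * s) = c k * ev k s := by
  simp [ev, sC, mul_add, mul_assoc]
@[simp] theorem ev_Y_mul (s : S k) : ev k (sY k * s) = y k * ev k s := by
  -- The curve equation enters here: multiplication by y turns the y-part q of s into zq.
  have h : y k * y k = evR k (zR k) := by
    rw [← pow_two, ryy]; simp
  simp only [ev, sY, LinearMap.coe_mk, AddHom.coe_mk, re_mul, im_mul, re_mk, im_mk, mul_add,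
    ← evR_y, map_add, map_mul]
  rw [← mul_assoc, ← evR_y, mul_assoc (evR k (im s)), h, ← map_mul, ← map_mul (evR k) (im s),
    mul_comm (im s)]
  simp
  abel

@[simp] theorem ev_mul (s t : S k) : ev k (s * t) = ev k s * ev k t := by
  induction s using S_induction with
  | h0 => simp
  | hadd p q hp hq => rw [add_mul, map_add, map_add, add_mul, hp, hq]
  | hsmul r p hp => rw [smul_mul_assoc, map_smul, map_smul, smul_mul_assoc, hp]
  | hX p hp => rw [mul_assoc, ev_X_mul, ev_X_mul, mul_assoc, hp]
  | hY p hp => rw [mul_assoc, ev_Y_mul, ev_Y_mul, mul_assoc, hp]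
  | hc p hp => rw [mul_assoc, ev_c_mul, ev_c_mul, mul_assoc, hp]

end Model
end NodalCubic

namespace NodalCubic

open Atilde

namespace Model

universe u
variable (k : Type u) [Field k]

/-! ### The basis `aⁱ (x a)ʲ bⁿ` of `Ã` over `k[x, y, c]` -/

/-- The element `aⁱ (x a)ʲ bⁿ`. -/
def E (n : Fin 2) (i j : Fin 3) : Atilde k :=
  a k ^ (i : ℕ) * (x k * a k) ^ (j : ℕ) * b k ^ (n : ℕ)

/-- The combination `∑ aⁱ (x a)ʲ tᵢⱼ`. -/
def comb (t : Fin 3 → Fin 3 → Atilde k) : Atilde k :=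
  ∑ i : Fin 3, ∑ j : Fin 3, a k ^ (i : ℕ) * (x k * a k) ^ (j : ℕ) * t i j

theorem comb_a (t : Fin 3 → Fin 3 → Atilde k) : a k * comb k t = comb k ![t 2, t 0, t 1] := by
  simp only [comb, Fin.sum_univ_three, pow_succ, pow_zero, one_mul, mul_add, mul_assoc, raa,
    Fin.val_zero, Fin.val_one, Fin.val_two, Matrix.cons_val]
  abel

/-- The formula for the operator of `x`, for coefficients on which the ring elements `x`, `c` act by
left multiplication. -/
def opXLeft {A : Type*} [Ring A] (x c : A) (t : Fin 3 → Fin 3 → A) : Fin 3 → Fin 3 → A :=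
  ![![x * t 0 0 + t 2 0 + (x ^ 2 + x) * t 2 1 + (x ^ 2 + x) * t 0 2
        + (c + 2 * x ^ 2 + 2 * x) * t 1 2,
      t 1 0 - (x + 1) * t 0 1 + t 2 1 + x * t 1 2 - (2 * x ^ 2 + x) * t 2 2,
      t 1 1 + x * t 0 2 + t 2 2],
    ![-(x ^ 2 + x) * t 0 1 - (x ^ 2 + x) * t 1 2
        - (c - 2 * x ^ 3 - x ^ 2 + x) * t 2 2,
      -t 2 0 - (x ^ 2 + x) * t 0 2 - x * t 2 2,
      -t 2 1 - (2 * x + 1) * t 1 2],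
    ![-(x + 1) * t 2 0 - (2 * x ^ 3 + 3 * x ^ 2 + x) * t 0 2,
      x * t 2 1 + (3 * x ^ 2 + 2 * x) * t 1 2,
      x * t 2 2]]

-- The entries of `opXLeft` are the normal forms of x·aⁱ(xa)ʲ, obtained by rewriting xa² and x²a.
-- This is the computational content of spanning.
set_option maxHeartbeats 1000000 in
theorem comb_x (t : Fin 3 → Fin 3 → Atilde k) :
    x k * comb k t = comb k (opXLeft (x k) (c k) t) := by
  have h3 : (3 : Atilde k) = 1 + 1 + 1 := by norm_num
  have h2 : (2 : Atilde k) = 1 + 1 := by norm_num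
  simp only [comb, opXLeft, Fin.sum_univ_three, Fin.val_zero, Fin.val_one, Fin.val_two,
    Matrix.cons_val, c, h2, h3, pow_succ, pow_zero, one_mul, mul_one, mul_add, add_mul, mul_sub, sub_mul,
    mul_neg, neg_mul, neg_add, neg_sub, mul_assoc, raa, raa', rxaa, rxaa', rxxa1, rxxa1']
  abel

/-- The map from the model to `Ã`. -/
def toA : M (S k) →ₗ[k] Atilde k where
  toFun f := ∑ n : Fin 2, comb k fun i j => b k ^ (n : ℕ) * ev k (f n i j)
  map_add' f g := by simp [comb, mul_add, Finset.sum_add_distrib]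
  map_smul' r f := by simp [comb, Finset.smul_sum]

theorem toA_def (f : M (S k)) :
    toA k f = ∑ n : Fin 2, comb k fun i j => b k ^ (n : ℕ) * ev k (f n i j) := rfl

theorem toA_apply (f : M (S k)) :
    toA k f = ∑ n : Fin 2, ∑ i : Fin 3, ∑ j : Fin 3, E k n i j * ev k (f n i j) := by
  simp [toA, comb, E, mul_assoc]

/-- The representation of `Ã` on the model. -/
abbrev ρ : Atilde k →ₐ[k] Module.End (S k) (M (S k)) := rep (sC k) k (sYY k)

theorem ρ_a : ρ k (a k) = both opA0 := rep_a ..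
theorem ρ_b : ρ k (b k) = opB := rep_b ..
theorem ρ_x : ρ k (x k) = both (opX0 (sX k) (sC k)) := rep_x ..
theorem ρ_y : ρ k (y k) = opY (sY k) := rep_y ..

theorem toA_ρ_a (f : M (S k)) : toA k (ρ k (a k) f) = a k * toA k f := by
  simp only [toA_def, Finset.mul_sum, comb_a, ρ_a, both_apply]
  refine Finset.sum_congr rfl fun n _ => congrArg _ ?_
  funext i j; fin_cases i <;> rfl

theorem bpow_x (n : ℕ) (t : Atilde k) : b k ^ n * (x k * t) = x k * (b k ^ n * t) := by
  rw [← mul_assoc, ← mul_assoc, (Commute.pow_left (rbx k) n).eq]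

theorem bpow_c (n : ℕ) (t : Atilde k) : b k ^ n * (c k * t) = c k * (b k ^ n * t) := by
  rw [← mul_assoc, ← mul_assoc, c_comm]

/-- The same formula occurs with commutative scalars in the model and with left multiplication in
`Ã`. An additive map that intertwines the two actions of x and c carries one to the other. -/
theorem opX0_map {A C : Type*} [Ring A] [CommRing C] (φ : C →+ A) {x c : A} {X Z : C}
    (hX : ∀ s, φ (X * s) = x * φ s) (hc : ∀ s, φ (Z * s) = c * φ s) (f : Fin 3 → Fin 3 → C)
    (i j : Fin 3) : φ (opX0 X Z f i j) = opXLeft x c (fun i j => φ (f i j)) i j := by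
  have h3 : (3 : A) = 1 + 1 + 1 := by norm_num
  have h2 : (2 : A) = 1 + 1 := by norm_num
  have h3' : (3 : C) = 1 + 1 + 1 := by norm_num
  have h2' : (2 : C) = 1 + 1 := by norm_num
  fin_cases i <;> fin_cases j <;>
    simp [opX0, opXLeft, pow_succ, mul_add, add_mul, sub_mul, mul_assoc, hX, hc, h2, h3, h2', h3']

/-- The map `s ↦ bⁿ s` on the coordinate ring. -/
def bev (n : ℕ) : S k →+ Atilde k := (AddMonoidHom.mulLeft (b k ^ n)).comp (ev k).toAddMonoidHom

theorem toA_ρ_x (f : M (S k)) : toA k (ρ k (x k) f) = x k * toA k f := by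
  simp only [toA_def, Finset.mul_sum, comb_x, ρ_x, both_apply]
  refine Finset.sum_congr rfl fun n _ => congrArg _ ?_
  funext i j
  refine opX0_map (bev k n) (fun s => ?_) (fun s => ?_) (f n) i j
  · simp [bev, -ev_mul, bpow_x]
  · simp [bev, -ev_mul, bpow_c]

theorem toA_ρ_b (f : M (S k)) : toA k (ρ k (b k) f) = b k * toA k f := by
  have e (i j : ℕ) (t : Atilde k) : b k * (a k ^ i * (x k * a k) ^ j * t) =
      a k ^ i * (x k * a k) ^ j * (b k * t) := by
    have h1 : Commute (b k) (a k) := rba k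
    have h2 : Commute (b k) (x k) := rbx k
    rw [← mul_assoc, ((h1.pow_right i).mul_right ((h2.mul_right h1).pow_right j)).eq, mul_assoc]
  simp [toA_def, ρ_b, comb, opB, e, Fin.sum_univ_two, Finset.mul_sum, mul_add, rbb2, add_comm]

theorem toA_ρ_y (f : M (S k)) : toA k (ρ k (y k) f) = y k * toA k f := by
  have e (i j : ℕ) (t : Atilde k) : y k * (a k ^ i * (x k * a k) ^ j * t) =
      a k ^ i * (x k * a k) ^ j * (y k * t) := by
    have h1 : Commute (y k) (a k) := rya k
    have h2 : Commute (y k) (x k) := ryx k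
    rw [← mul_assoc, ((h1.pow_right i).mul_right ((h2.mul_right h1).pow_right j)).eq, mul_assoc]
  have e2 (t : Atilde k) : y k * (b k * t) = - (b k * (y k * t)) := by rw [ryb2, neg_neg]
  simp [toA_def, ρ_y, comb, opY, e, e2, -ev_mul, ev_Y_mul, Fin.sum_univ_two, Finset.mul_sum, mul_add]

/-- Evaluated at the vector of 1, this shows that every element of `Ã` is recovered from its
coefficients. -/
theorem toA_ρ (h : Atilde k) (f : M (S k)) : toA k (ρ k h f) = h * toA k f := by
  induction h using gen_induction generalizing f with
  | halg r =>
    rw [AlgHom.commutes, ← Algebra.smul_def, Module.algebraMap_end_apply, map_smul]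
  | ha => exact toA_ρ_a k f
  | hb => exact toA_ρ_b k f
  | hx => exact toA_ρ_x k f
  | hy => exact toA_ρ_y k f
  | hadd p q hp hq => rw [map_add, LinearMap.add_apply, map_add, hp, hq, add_mul]
  | hmul p q hp hq => rw [map_mul, Module.End.mul_apply, hp, hq, mul_assoc]

/-- The coefficients of an element of `Ã` with respect to the basis `aⁱ (x a)ʲ bⁿ`. -/
def coef : Atilde k →ₗ[k] M (S k) where
  toFun h := ρ k h (e0 (S k))
  map_add' g h := by simp
  map_smul' r h := by simp

theorem coef_apply (h : Atilde k) : coef k h = ρ k h (e0 (S k)) := rfl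

theorem toA_coef (h : Atilde k) : toA k (coef k h) = h := by
  rw [coef_apply, toA_ρ]
  have : toA k (e0 (S k)) = 1 := by
    simp [toA_def, comb, e0, Fin.sum_univ_two, Fin.sum_univ_three]
  rw [this, mul_one]

/-- ρ(h) is linear over the coordinate ring, so it suffices that s acts on the vector of 1 as the
scalar s. -/
theorem coef_mul_ev (h : Atilde k) (s : S k) : coef k (h * ev k s) = s • coef k h := by
  rw [coef_apply, map_mul, Module.End.mul_apply, coef_apply, ← map_smul]
  congr 1
  clear h
  induction s using S_induction with
  | h0 => simp
  | hadd p q hp hq => rw [map_add, map_add, LinearMap.add_apply, hp, hq, add_smul]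
  | hsmul r p hp => rw [map_smul, map_smul, LinearMap.smul_apply, hp, smul_assoc]
  | hX p hp =>
    rw [ev_X_mul, map_mul, Module.End.mul_apply, hp, map_smul, mul_comm, M_smul_smul, ρ_x,
      both_opX0_e0]
  | hY p hp =>
    rw [ev_Y_mul, map_mul, Module.End.mul_apply, hp, map_smul, mul_comm, M_smul_smul, ρ_y, opY_e0]
  | hc p hp =>
    rw [ev_c_mul, map_mul, Module.End.mul_apply, hp, map_smul, mul_comm, M_smul_smul, rep_c_e0]

theorem coef_E (n : Fin 2) (i j : Fin 3) :
    coef k (E k n i j) = Pi.single n (Pi.single i (Pi.single j 1)) := by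
  rw [coef_apply, E, map_mul, Module.End.mul_apply, rep_pow_b_e0, map_mul, Module.End.mul_apply,
    rep_pow_xa, rep_pow_a]

end Model
end NodalCubic

/-! ### Coordinates in `Ã` and the functionals that read them. -/

namespace NodalCubic

open Atilde

namespace Model

universe u
variable (k : Type u) [Field k]

theorem ev_sX : ev k (sX k) = x k := by simpa using ev_X_mul k 1
theorem ev_sY : ev k (sY k) = y k := by simpa using ev_Y_mul k 1
theorem ev_sC : ev k (sC k) = c k := by simpa using ev_c_mul k 1

theorem coef_E_ev (n : Fin 2) (i j : Fin 3) (s : S k) :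
    coef k (E k n i j * ev k s) = Pi.single n (Pi.single i (Pi.single j s)) := by
  rw [coef_mul_ev, coef_E]
  funext n' i' j'
  rcases eq_or_ne n' n with rfl | h
  · rcases eq_or_ne i' i with rfl | h
    · rcases eq_or_ne j' j with rfl | h
      · simp
      · simp [h]
    · simp [h]
  · simp [h]

theorem E_zero : E k 0 0 0 = 1 := by simp [E]

theorem coef_ev (s : S k) : coef k (ev k s) =
    Pi.single (0 : Fin 2) (Pi.single (0 : Fin 3) (Pi.single (0 : Fin 3) s)) := by
  rw [← coef_E_ev, E_zero, one_mul]

theorem ev_injective : Function.Injective (ev k) := by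
  intro s t h
  have := congrFun (congrFun (congrFun (congrArg (coef k) h) 0) 0) 0
  simpa [coef_ev] using this

theorem eq_sum_E (h : Atilde k) :
    h = ∑ n : Fin 2, ∑ i : Fin 3, ∑ j : Fin 3, E k n i j * ev k (coef k h n i j) := by
  rw [← toA_apply, toA_coef]

/-! ### Functionals -/

/-- The value at the origin of an element of the coordinate ring. -/
def eps : S k →ₗ[k] k where
  toFun s := ((re s).coeff 0).coeff 0
  map_add' s t := by simp
  map_smul' r s := by simp

/-- The derivative with respect to `x` at the origin of an element of the coordinate ring. -/
def dx : S k →ₗ[k] k where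
  toFun s := ((re s).coeff 1).coeff 0
  map_add' s t := by simp
  map_smul' r s := by simp

/-- The derivative with respect to `y` at the origin of an element of the coordinate ring. -/
def dy : S k →ₗ[k] k where
  toFun s := ((im s).coeff 0).coeff 0
  map_add' s t := by simp
  map_smul' r s := by simp

@[simp] theorem eps_one : eps k 1 = 1 := by simp [eps]
@[simp] theorem eps_X (s : S k) : eps k (sX k * s) = 0 := by simp [eps, sX]
@[simp] theorem eps_Y (s : S k) : eps k (sY k * s) = 0 := by simp [eps, sY, zR, Polynomial.mul_coeff_zero]
@[simp] theorem eps_C (s : S k) : eps k (sC k * s) = 0 := by simp [eps, sC]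

/-- The central element `z` in the coordinate ring. -/
def sZ : S k := sX k ^ 2 + sX k ^ 3

theorem sZ_eq : sZ k = sMk k (zR k) 0 := by
  apply S_ext <;> simp [sZ, sX, pow_succ, zR]

theorem ev_sZ : ev k (sZ k) = z k := by
  simp [sZ, pow_succ, ev_sX, z]

theorem zR_mul_coeff (p : R k) : (zR k * p).coeff 0 = 0 ∧ (zR k * p).coeff 1 = 0 ∧
    (zR k * p).coeff 2 = p.coeff 0 := by
  have e : zR k * p = Polynomial.X * (Polynomial.X * (p + Polynomial.X * p)) := by ring
  rw [e]
  simp [Polynomial.coeff_X_mul, show (2 : ℕ) = 1 + 1 from rfl, -Nat.reduceAdd, mul_add]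

theorem eps_Z (s : S k) : eps k (sZ k * s) = 0 := by
  simp [eps, sZ_eq, (zR_mul_coeff k _).1]
theorem dx_Z (s : S k) : dx k (sZ k * s) = 0 := by
  simp [dx, sZ_eq, (zR_mul_coeff k _).2.1]
theorem dy_Z (s : S k) : dy k (sZ k * s) = 0 := by
  simp [dy, sZ_eq, (zR_mul_coeff k _).1]
theorem dx_C (s : S k) : dx k (sC k * s) = 0 := by
  simp [dx, sC]
theorem dy_C (s : S k) : dy k (sC k * s) = 0 := by
  simp [dy, sC]

variable {k} in
/-- The functional on `Ã` that applies `φ` to a coefficient. -/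
def fn (φ : S k →ₗ[k] k) (n : Fin 2) (i j : Fin 3) : Atilde k →ₗ[k] k where
  toFun h := φ (coef k h n i j)
  map_add' s t := by simp
  map_smul' r s := by simp

/-- The constant coefficient at `aⁱ (x a)ʲ bⁿ`. -/
def pr (n : Fin 2) (i j : Fin 3) : Atilde k →ₗ[k] k := fn (eps k) n i j

theorem fn_mul_ev (φ : S k →ₗ[k] k) (n : Fin 2) (i j : Fin 3) (h : Atilde k) (s : S k) :
    fn φ n i j (h * ev k s) = φ (s * coef k h n i j) := by
  simp [fn, coef_mul_ev]

/-- Right multiplication by x multiplies all coefficients by x, and their constant terms disappear.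
This vanishing and its analogues for y, c, z make the coactions `lam` and `mu` linear over the
coordinate ring and over k[z, c]. -/
theorem pr_mul_x (n : Fin 2) (i j : Fin 3) (h : Atilde k) : pr k n i j (h * x k) = 0 := by
  rw [← ev_sX, pr, fn_mul_ev, eps_X]
theorem pr_mul_y (n : Fin 2) (i j : Fin 3) (h : Atilde k) : pr k n i j (h * y k) = 0 := by
  rw [← ev_sY, pr, fn_mul_ev, eps_Y]
theorem pr_mul_c (n : Fin 2) (i j : Fin 3) (h : Atilde k) : pr k n i j (h * c k) = 0 := by
  rw [← ev_sC, pr, fn_mul_ev, eps_C]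
theorem pr_mul_z (n : Fin 2) (i j : Fin 3) (h : Atilde k) : pr k n i j (h * z k) = 0 := by
  rw [← ev_sZ, pr, fn_mul_ev, eps_Z]

theorem pr_E (n n' : Fin 2) (i j i' j' : Fin 3) :
    pr k n i j (E k n' i' j') = if n = n' ∧ i = i' ∧ j = j' then 1 else 0 := by
  simp only [pr, fn, LinearMap.coe_mk, AddHom.coe_mk, coef_E]
  rcases eq_or_ne n n' with rfl | h
  · rcases eq_or_ne i i' with rfl | h
    · rcases eq_or_ne j j' with rfl | h
      · simp
      · simp [h]
    · simp [h]
  · simp [h]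

/-! ### The two coactions -/

variable {k}

/-- `(φ ⊗ id) Δ` -/
def lam (φ : Atilde k →ₗ[k] k) : Atilde k →ₗ[k] Atilde k :=
  (TensorProduct.lid k (Atilde k)).toLinearMap ∘ₗ φ.rTensor (Atilde k) ∘ₗ (comulHom k).toLinearMap

/-- `(id ⊗ φ) Δ` -/
def mu (φ : Atilde k →ₗ[k] k) : Atilde k →ₗ[k] Atilde k :=
  (TensorProduct.rid k (Atilde k)).toLinearMap ∘ₗ φ.lTensor (Atilde k) ∘ₗ (comulHom k).toLinearMap

/-- In Δ(h)(1 ⊗ q + q ⊗ r) the second summand has a first leg ending in q, which φ kills. -/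
theorem lam_mul_of {φ : Atilde k →ₗ[k] k} {p q r : Atilde k} (hΔ : comulHom k q = 1 ⊗ₜ q + q ⊗ₜ r)
    (hq : ∀ h, φ (h * q) = 0) (h : Atilde k) : lam φ (h * q) = lam φ h * q := by
  simp only [lam, LinearMap.comp_apply, AlgHom.toLinearMap_apply, map_mul, hΔ]
  induction comulHom k h with
  | zero => simp
  | add s t hs ht => simp only [add_mul, map_add, hs, ht]
  | tmul s t => simp [mul_add, hq]

theorem mu_mul_of {φ : Atilde k →ₗ[k] k} {q : Atilde k} (hΔ : comulHom k q = 1 ⊗ₜ q + q ⊗ₜ 1)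
    (hq : ∀ h, φ (q * h) = 0) (h : Atilde k) : mu φ (q * h) = q * mu φ h := by
  simp only [mu, LinearMap.comp_apply, AlgHom.toLinearMap_apply, map_mul, hΔ]
  induction comulHom k h with
  | zero => simp
  | add s t hs ht => simp only [mul_add, map_add, hs, ht]
  | tmul s t => simp [add_mul, hq]

theorem comul_c : comulHom k (c k) = 1 ⊗ₜ c k + c k ⊗ₜ 1 := c_mem k

theorem comul_z : comulHom k (z k) = 1 ⊗ₜ z k + z k ⊗ₜ 1 := x2x3_mem k

theorem lam_mul_ev {φ : Atilde k →ₗ[k] k} (hx : ∀ h, φ (h * x k) = 0) (hy : ∀ h, φ (h * y k) = 0)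
    (hc : ∀ h, φ (h * c k) = 0) (h : Atilde k) (s : S k) :
    lam φ (h * ev k s) = lam φ h * ev k s := by
  induction s using S_induction generalizing h with
  | h0 => simp
  | hadd p q hp hq => rw [map_add, mul_add, map_add, hp, hq, mul_add]
  | hsmul r p hp => rw [map_smul, mul_smul_comm, map_smul, hp, mul_smul_comm]
  | hX p hp =>
    rw [ev_X_mul, ← mul_assoc, hp, lam_mul_of (p := 1) (comulHom_x k) hx, mul_assoc]
  | hY p hp =>
    rw [ev_Y_mul, ← mul_assoc, hp, lam_mul_of (p := 1) (comulHom_y k) hy, mul_assoc]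
  | hc p hp =>
    rw [ev_c_mul, ← mul_assoc, hp, lam_mul_of (p := 1) comul_c hc, mul_assoc]

theorem lam_pr_mul_ev (n : Fin 2) (i j : Fin 3) (h : Atilde k) (s : S k) :
    lam (pr k n i j) (h * ev k s) = lam (pr k n i j) h * ev k s :=
  lam_mul_ev (pr_mul_x k n i j) (pr_mul_y k n i j) (pr_mul_c k n i j) h s

theorem comul_E_zero (n : Fin 2) (i : Fin 3) :
    comulHom k (E k n i 0) = E k n i 0 ⊗ₜ E k n i 0 := by
  simp [E]

/-- `aⁱ t bⁿ` -/
theorem comul_E (n : Fin 2) (i j : Fin 3) : comulHom k (E k n i j) =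
    ((a k ^ (i : ℕ)) ⊗ₜ[k] (a k ^ (i : ℕ))) * comulHom k ((x k * a k) ^ (j : ℕ)) *
      ((b k ^ (n : ℕ)) ⊗ₜ[k] (b k ^ (n : ℕ))) := by
  simp [E]

theorem pow_a_mul (i : Fin 3) (j : ℕ) (h : j < 3) : a k ^ (i : ℕ) * a k ^ j =
    a k ^ ((i + ⟨j, h⟩ : Fin 3) : ℕ) := by
  interval_cases j <;> fin_cases i <;> simp [pow_succ, mul_assoc, raa, raa']

theorem lam_E_zero (φ : Atilde k →ₗ[k] k) (n : Fin 2) (i : Fin 3) :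
    lam φ (E k n i 0) = φ (E k n i 0) • E k n i 0 := by
  simp [lam, comul_E_zero]

theorem lam_E_one (φ : Atilde k →ₗ[k] k) (n : Fin 2) (i : Fin 3) : lam φ (E k n i 1) =
    φ (E k n (i + 1) 0) • E k n i 1 + φ (E k n i 1) • E k n (i + 2) 0 := by
  have e1 : a k ^ (i : ℕ) * a k = a k ^ ((i + 1 : Fin 3) : ℕ) := by
    simpa using pow_a_mul (k := k) i 1 (by norm_num)
  have e2 : a k ^ (i : ℕ) * (a k * a k) = a k ^ ((i + 2 : Fin 3) : ℕ) := by
    simpa [pow_succ] using pow_a_mul (k := k) i 2 (by norm_num)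
  simp only [lam, LinearMap.comp_apply, AlgHom.toLinearMap_apply, comul_E]
  simp [E, add_mul, mul_add, e1, e2]

/-- Square Δ(xa) = a ⊗ xa + xa ⊗ a². One first leg is aⁱxa²bⁿ, not a basis element. Substituting xa²
= 1 - a²x - axa - a² produces the three values of φ in the coefficient, and the term ending in x
drops out by `hx`. -/
theorem lam_E_two {φ : Atilde k →ₗ[k] k} (hx : ∀ h, φ (h * x k) = 0) (n : Fin 2) (i : Fin 3) :
    lam φ (E k n i 2) = φ (E k n (i + 2) 0) • E k n i 2 +
      φ (E k n (i + 1) 1) • (E k n i 0 * x k) +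
      (φ (E k n i 0) - φ (E k n (i + 1) 1) - φ (E k n (i + 2) 0)) • E k n (i + 2) 1 +
      φ (E k n i 2) • E k n (i + 1) 0 := by
  have e1 : a k ^ (i : ℕ) * a k = a k ^ ((i + 1 : Fin 3) : ℕ) := by
    simpa using pow_a_mul (k := k) i 1 (by norm_num)
  have e2 : a k ^ (i : ℕ) * (a k * a k) = a k ^ ((i + 2 : Fin 3) : ℕ) := by
    simpa [pow_succ] using pow_a_mul (k := k) i 2 (by norm_num)
  have eb : x k * b k ^ (n : ℕ) = b k ^ (n : ℕ) * x k := (Commute.pow_left (rbx k) n).eq.symm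
  have e3 : φ (a k ^ (i : ℕ) * (x k * (a k * a k)) * b k ^ (n : ℕ)) =
      φ (E k n i 0) - φ (E k n (i + 1) 1) - φ (E k n (i + 2) 0) := by
    have : a k ^ (i : ℕ) * (x k * (a k * a k)) * b k ^ (n : ℕ) =
      E k n i 0 - E k n (i + 2) 0 * x k - E k n (i + 1) 1 - E k n (i + 2) 0 := by
      simp only [rxaa', E, ← e1, ← e2, mul_sub, sub_mul, mul_assoc, eb]
      simp [mul_assoc]
    rw [this]
    simp only [map_sub, hx, sub_zero]
  simp only [lam, LinearMap.comp_apply, AlgHom.toLinearMap_apply, comul_E]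
  have e4 : comulHom k ((x k * a k) ^ ((2 : Fin 3) : ℕ)) = (a k * a k) ⊗ₜ[k] ((x k * a k) ^ 2) +
      (a k * (x k * a k)) ⊗ₜ[k] x k + (x k * (a k * a k)) ⊗ₜ[k] (a k * a k * (x k * a k)) +
      ((x k * a k) ^ 2) ⊗ₜ[k] a k := by
    simp [pow_succ, mul_add, add_mul, mul_assoc, raa, raa']
    abel
  rw [e4]
  simp only [mul_add, add_mul, Algebra.TensorProduct.tmul_mul_tmul, map_add, LinearMap.rTensor_tmul,
    e3, LinearEquiv.coe_coe, TensorProduct.lid_tmul, e1, e2, ← mul_assoc]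
  simp only [mul_assoc _ (a k) (a k), e1, e2]
  simp only [mul_assoc (a k ^ (i : ℕ)) (x k), eb]
  simp only [E, Fin.val_zero, Fin.val_one, pow_one, pow_zero, one_mul, mul_one, mul_assoc] at e3
  simp [E, mul_assoc, eb, e3]

end Model
end NodalCubic

/-! ### Comparing coordinates under the left coaction; group-likes up to a factor in the coordinate
ring. -/

namespace NodalCubic

open Atilde

namespace Model

universe u
variable {k : Type u} [Field k]

-- By right linearity only the basis elements matter, and (xa)² can be detected in the first leg of
-- Δ only by aⁱ(xa)²bⁿ itself. Its second leg is then the group-like element aⁱ⁺¹bⁿ.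
set_option maxHeartbeats 1000000 in
theorem lam_pr_two (n : Fin 2) (i : Fin 3) (h : Atilde k) :
    lam (pr k n i 2) h = E k n (i + 1) 0 * ev k (coef k h n i 2) := by
  conv_lhs => rw [eq_sum_E k h]
  simp only [Fin.sum_univ_two, Fin.sum_univ_three, map_add, lam_pr_mul_ev, lam_E_zero, lam_E_one,
    lam_E_two (pr_mul_x k n i 2), pr_E]
  fin_cases n <;> fin_cases i <;> simp

-- The second summand is the contribution of aⁱ⁺²(xa)²bⁿ, whose coproduct contains aⁱ(xa)bⁿ in the
-- first leg.
set_option maxHeartbeats 1000000 in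
theorem lam_pr_one (n : Fin 2) (i : Fin 3) (h : Atilde k) :
    lam (pr k n i 1) h = E k n (i + 2) 0 * ev k (coef k h n i 1) +
      (E k n (i + 2) 0 * x k - E k n (i + 1) 1) * ev k (coef k h n (i + 2) 2) := by
  conv_lhs => rw [eq_sum_E k h]
  simp only [Fin.sum_univ_two, Fin.sum_univ_three, map_add, lam_pr_mul_ev, lam_E_zero, lam_E_one,
    lam_E_two (pr_mul_x k n i 1), pr_E]
  fin_cases n <;> fin_cases i <;> simp [sub_eq_add_neg, add_comm]

set_option maxHeartbeats 1000000 in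
theorem lam_pr_zero (n : Fin 2) (i : Fin 3) (h : Atilde k) (h2 : ∀ n i, coef k h n i 2 = 0) :
    lam (pr k n i 0) h = E k n i 0 * ev k (coef k h n i 0) +
      E k n (i + 2) 1 * ev k (coef k h n (i + 2) 1) := by
  conv_lhs => rw [eq_sum_E k h]
  simp only [Fin.sum_univ_two, Fin.sum_univ_three, map_add, lam_pr_mul_ev, lam_E_zero, lam_E_one, h2, map_zero,
    mul_zero, add_zero, pr_E]
  fin_cases n <;> fin_cases i <;> simp <;> abel

theorem lam_groupLike (φ : Atilde k →ₗ[k] k) (g : GroupLike k (Atilde k)) :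
    lam φ (g : Atilde k) = φ g • (g : Atilde k) := by
  have := g.2.comul_eq_tmul_self
  rw [comul_eq] at this
  simp [lam, this]

theorem mu_groupLike (φ : Atilde k →ₗ[k] k) (g : GroupLike k (Atilde k)) :
    mu φ (g : Atilde k) = φ g • (g : Atilde k) := by
  have := g.2.comul_eq_tmul_self
  rw [comul_eq] at this
  simp [mu, this]

theorem lam_skew (φ : Atilde k →ₗ[k] k) {g : GroupLike k (Atilde k)} {h : Atilde k}
    (hh : h ∈ SkewPrim.P k g) : lam φ h = φ 1 • h + φ h • (g : Atilde k) := by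
  rw [SkewPrim.mem_P, comul_eq] at hh
  simp [lam, hh]

theorem mu_skew (φ : Atilde k →ₗ[k] k) {g : GroupLike k (Atilde k)} {h : Atilde k}
    (hh : h ∈ SkewPrim.P k g) : mu φ h = φ h • (1 : Atilde k) + φ g • h := by
  rw [SkewPrim.mem_P, comul_eq] at hh
  simp [mu, hh]

theorem pr_apply (n : Fin 2) (i j : Fin 3) (h : Atilde k) :
    pr k n i j h = eps k (coef k h n i j) := rfl

theorem E_ev_eq_zero {n : Fin 2} {i j : Fin 3} {s : S k} (h : E k n i j * ev k s = 0) : s = 0 := by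
  have := congrFun (congrFun (congrFun (congrArg (coef k) h) n) i) j
  simpa [coef_E_ev] using this

/-- Auxiliary step: a coefficient vanishes if the corresponding coaction is concentrated
elsewhere. -/
theorem coef_eq_zero_of_smul {g : Atilde k} {n : Fin 2} {i j i' j' : Fin 3} {s : S k}
    (hs : s = coef k g n i j) (hne : (i', j') ≠ (i, j))
    (h : pr k n i j g • g = E k n i' j' * ev k s) : s = 0 := by
  by_contra hs0
  have h1 := congrFun (congrFun (congrFun (congrArg (coef k) h) n) i) j
  have h2 : (Pi.single i' (Pi.single j' s) : Fin 3 → Fin 3 → S k) i j = 0 := by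
    rcases eq_or_ne i i' with rfl | hi
    · rcases eq_or_ne j j' with rfl | hj
      · exact absurd rfl hne
      · simp [hj]
    · simp [hi]
  rw [coef_E_ev, map_smul, Pi.single_eq_same, h2, Pi.smul_apply, Pi.smul_apply, Pi.smul_apply,
    smul_eq_zero, ← hs] at h1
  rcases h1 with h1 | h1
  · rw [h1, zero_smul] at h
    exact hs0 (E_ev_eq_zero h.symm)
  · exact hs0 h1

/-- Every φ ⊗ id maps g to a multiple of g. For j = 2 and then j = 1 the image is supported at
another basis element than the coefficient it was read from, so these coefficients vanish. For j = 0
a nonzero coefficient shows that g is proportional to a single term. -/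
theorem groupLike_eq_E_mul (g : GroupLike k (Atilde k)) :
    ∃ (n : Fin 2) (i : Fin 3) (s : S k), (g : Atilde k) = E k n i 0 * ev k s := by
  have h2 (n i) : coef k (g : Atilde k) n i 2 = 0 := by
    refine coef_eq_zero_of_smul rfl (i' := i + 1) (j' := 0) (by simp) ?_
    rw [← lam_pr_two, lam_groupLike]
  have h1 (n i) : coef k (g : Atilde k) n i 1 = 0 := by
    refine coef_eq_zero_of_smul rfl (i' := i + 2) (j' := 0) (by simp) ?_
    rw [← lam_groupLike, lam_pr_one]
    simp [h2]
  have h0 (n i) : pr k n i 0 (g : Atilde k) • (g : Atilde k) =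
      E k n i 0 * ev k (coef k (g : Atilde k) n i 0) := by
    rw [← lam_groupLike, lam_pr_zero _ _ _ h2]
    simp [h1]
  by_cases hz : ∀ n i, coef k (g : Atilde k) n i 0 = 0
  · exfalso
    have e := eq_sum_E k (g : Atilde k)
    simp [Fin.sum_univ_three, h1, h2, hz] at e
    have := g.2.counit_eq_one
    rw [e] at this
    simp at this
  · push Not at hz
    obtain ⟨n, i, hni⟩ := hz
    have hp : pr k n i 0 (g : Atilde k) ≠ 0 := by
      intro hp
      have := h0 n i
      rw [hp, zero_smul] at this
      exact hni (E_ev_eq_zero this.symm)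
    refine ⟨n, i, (pr k n i 0 (g : Atilde k))⁻¹ • coef k (g : Atilde k) n i 0, ?_⟩
    rw [map_smul, mul_smul_comm, ← h0, smul_smul, inv_mul_cancel₀ hp, one_smul]

/-! ### The centre part of `k[x, y, c]` -/

variable (k) in
/-- The subalgebra of the coordinate ring that is generated by `z` and `c`. -/
def Z : Subalgebra k (S k) := Algebra.adjoin k {sZ k, sC k}

theorem sZ_mem : sZ k ∈ Z k := Algebra.subset_adjoin (by simp)
theorem sC_mem : sC k ∈ Z k := Algebra.subset_adjoin (by simp)

theorem ev_Z_comm {s : S k} (hs : s ∈ Z k) (h : Atilde k) : ev k s * h = h * ev k s := by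
  induction hs using Algebra.adjoin_induction with
  | mem s hs =>
    rcases hs with rfl | rfl
    · rw [ev_sZ, z_comm]
    · rw [ev_sC, c_comm]
  | algebraMap r =>
    rw [Algebra.algebraMap_eq_smul_one, map_smul, ev_one, smul_mul_assoc, mul_smul_comm, one_mul,
      mul_one]
  | add p q _ _ hp hq => rw [map_add, add_mul, mul_add, hp, hq]
  | mul p q _ _ hp hq => rw [ev_mul, mul_assoc, hq, ← mul_assoc, hp, mul_assoc]

/-- The decomposition of an element of the coordinate ring over `k[z, c]`. -/
theorem exists_Z_decomp (s : S k) : ∃ p : Fin 3 → Fin 2 → S k, (∀ l e, p l e ∈ Z k) ∧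
    s = ∑ l : Fin 3, ∑ e : Fin 2, p l e * (sX k ^ (l : ℕ) * sY k ^ (e : ℕ)) := by
  induction s using S_induction with
  | h0 =>
    refine ⟨![![1, 0], ![0, 0], ![0, 0]], fun l e => ?_, by simp [Fin.sum_univ_three]⟩
    fin_cases l <;> fin_cases e <;> simp [one_mem, zero_mem]
  | hadd s t hs ht =>
    obtain ⟨p, hp, rfl⟩ := hs
    obtain ⟨q, hq, rfl⟩ := ht
    exact ⟨p + q, fun l e => add_mem (hp l e) (hq l e), by
      simp only [Pi.add_apply, add_mul, Finset.sum_add_distrib]⟩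
  | hsmul r s hs =>
    obtain ⟨p, hp, rfl⟩ := hs
    exact ⟨r • p, fun l e => Subalgebra.smul_mem _ (hp l e) r, by
      simp only [Pi.smul_apply, smul_mul_assoc, Finset.smul_sum]⟩
  | hX s hs =>
    obtain ⟨p, hp, rfl⟩ := hs
    -- Reduce x·x² = z - x².
    refine ⟨![fun e => sZ k * p 2 e, p 0, fun e => p 1 e - p 2 e], fun l e => ?_, ?_⟩
    · fin_cases l
      · exact mul_mem sZ_mem (hp _ _)
      · exact hp _ _
      · exact sub_mem (hp _ _) (hp _ _)
    · simp [Fin.sum_univ_three, sZ]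
      ring
  | hY s hs =>
    obtain ⟨p, hp, rfl⟩ := hs
    -- Reduce y·y = z.
    refine ⟨fun l => ![sZ k * p l 1, p l 0], fun l e => ?_, ?_⟩
    · fin_cases e
      · exact mul_mem sZ_mem (hp _ _)
      · exact hp _ _
    · have h : sY k * sY k = sZ k := by rw [← pow_two, sYY, sZ]
      simp [Fin.sum_univ_three, ← h]
      ring
  | hc s hs =>
    obtain ⟨p, hp, rfl⟩ := hs
    refine ⟨fun l e => sC k * p l e, fun l e => mul_mem sC_mem (hp _ _), ?_⟩
    simp [Finset.mul_sum, mul_add, mul_assoc]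

/-- z and c are central and primitive, so of 1 ⊗ z + z ⊗ 1 only the second summand survives when φ
is applied to the second leg. The generators x and y lack this, which is why k[z, c] replaces the
coordinate ring on this side. -/
theorem mu_Z_mul {φ : Atilde k →ₗ[k] k} (hz : ∀ h, φ (h * z k) = 0) (hc : ∀ h, φ (h * c k) = 0)
    {s : S k} (hs : s ∈ Z k) (h : Atilde k) : mu φ (ev k s * h) = ev k s * mu φ h := by
  induction hs using Algebra.adjoin_induction generalizing h with
  | mem s hs =>
    rcases hs with rfl | rfl
    · rw [ev_sZ, mu_mul_of comul_z (fun h => by rw [z_comm, hz])]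
    · rw [ev_sC, mu_mul_of comul_c (fun h => by rw [c_comm, hc])]
  | algebraMap r =>
    rw [Algebra.algebraMap_eq_smul_one, map_smul, ev_one, smul_mul_assoc, one_mul, map_smul,
      smul_mul_assoc, one_mul]
  | add p q _ _ hp hq => rw [map_add, add_mul, map_add, hp, hq, add_mul]
  | mul p q _ _ hp hq => rw [ev_mul, mul_assoc, hp, hq, mul_assoc]

/-- The coaction on the monomials `xˡ yᵉ`. -/
theorem mu_monomial {φ : Atilde k →ₗ[k] k} (hx : ∀ h, φ (h * x k) = 0) (hy : ∀ h, φ (h * y k) = 0)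
    (l : Fin 3) (e : Fin 2) : mu φ (x k ^ (l : ℕ) * y k ^ (e : ℕ)) =
      φ (E k e l 0) • (x k ^ (l : ℕ) * y k ^ (e : ℕ)) +
      if l = 2 then φ (E k e 0 1) • (x k * y k ^ (e : ℕ)) else 0 := by
  have hx0 : φ (x k) = 0 := by simpa using hx 1
  have hy0 : φ (y k) = 0 := by simpa using hy 1
  have hb (h : Atilde k) : φ (h * x k * b k) = 0 := by rw [mul_assoc, ← rbx, ← mul_assoc, hx]
  have hb0 : φ (x k * b k) = 0 := by simpa using hb 1
  -- The extra term for l = 2 comes from x ⊗ (xa + ax) in Δ(x)², where φ removes the part ending in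
  -- x.
  fin_cases l <;> fin_cases e <;>
    simp [mu, E, pow_succ, mul_add, add_mul, ← mul_assoc, hx, hy, hx0, hy0, hb, hb0,
      Algebra.TensorProduct.one_def, add_comm]

end Model
end NodalCubic

/-! ### The right coaction on the coordinate ring, all group-likes, and skew primitives modulo the
coordinate ring. -/

namespace NodalCubic

open Atilde

namespace Model

universe u
variable {k : Type u} [Field k]

/-- Neither x nor y is a zero divisor: in components, y(p + qy) = zq + py, and k[x, c] is a domain
with z ≠ 0. -/
theorem mul_sX_sY_eq_zero {p : S k} (e : ℕ) (h : p * (sX k * sY k ^ e) = 0) : p = 0 := by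
  have hX (p : S k) (h : sX k * p = 0) : p = 0 := by
    have h1 := congrArg re h
    have h2 := congrArg im h
    simp only [re_mul, im_mul, sX, re_mk, im_mk, mul_zero, zero_mul, add_zero] at h1 h2
    exact S_ext ((mul_eq_zero.1 h1).resolve_left Polynomial.X_ne_zero)
      ((mul_eq_zero.1 h2).resolve_left Polynomial.X_ne_zero)
  have hz : zR k ≠ 0 := fun h => by
    have := congrArg (fun p => Polynomial.coeff p 2) h
    simp [zR, Polynomial.coeff_X_pow] at this
  have hY (p : S k) (h : sY k * p = 0) : p = 0 := by
    have h1 := congrArg re h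
    have h2 := congrArg im h
    simp only [re_mul, im_mul, sY, re_mk, im_mk, mul_zero, zero_mul, add_zero, zero_add, one_mul,
      mul_one] at h1 h2
    exact S_ext h2 ((mul_eq_zero.1 h1).resolve_left hz)
  induction e with
  | zero =>
    rw [pow_zero, mul_one, mul_comm] at h
    exact hX p h
  | succ e ih =>
    rw [pow_succ, ← mul_assoc, ← mul_assoc, mul_comm, mul_assoc] at h
    exact ih (hY _ h)

theorem ev_decomp (p : Fin 3 → Fin 2 → S k) :
    ev k (∑ l : Fin 3, ∑ e : Fin 2, p l e * (sX k ^ (l : ℕ) * sY k ^ (e : ℕ))) =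
      ∑ l : Fin 3, ∑ e : Fin 2, ev k (p l e) * (x k ^ (l : ℕ) * y k ^ (e : ℕ)) := by
  simp [Fin.sum_univ_three, pow_succ, ev_sX, ev_sY]

/-- The coaction on an element of `k[x, y, c]`. -/
theorem mu_decomp (p : Fin 3 → Fin 2 → S k) (hp : ∀ l e, p l e ∈ Z k) (n : Fin 2) (i j : Fin 3) :
    mu (pr k n i j)
      (ev k (∑ l : Fin 3, ∑ e : Fin 2, p l e * (sX k ^ (l : ℕ) * sY k ^ (e : ℕ)))) =
      (if j = 0 then ev k (p i n * (sX k ^ (i : ℕ) * sY k ^ (n : ℕ))) else 0) +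
      (if j = 1 ∧ i = 0 then ev k (p 2 n * (sX k * sY k ^ (n : ℕ))) else 0) := by
  rw [ev_decomp]
  simp only [map_sum, mu_Z_mul (pr_mul_z k n i j) (pr_mul_c k n i j) (hp _ _),
    mu_monomial (pr_mul_x k n i j) (pr_mul_y k n i j), pr_E]
  fin_cases n <;> fin_cases i <;> fin_cases j <;>
    simp [Fin.sum_univ_three, pow_succ, ev_sX, ev_sY]

theorem pr_ev (n : Fin 2) (i j : Fin 3) (s : S k) :
    pr k n i j (ev k s) = if n = 0 ∧ i = 0 ∧ j = 0 then eps k s else 0 := by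
  rw [pr_apply, coef_ev]
  fin_cases n <;> fin_cases i <;> fin_cases j <;> simp

theorem coef_E_mul_ev_ne {n n' : Fin 2} {i i' j j' : Fin 3} (h : (n, i, j) ≠ (n', i', j'))
    (s : S k) : coef k (E k n' i' j' * ev k s) n i j = 0 := by
  rw [coef_E_ev]
  rcases eq_or_ne n n' with rfl | hn
  · rcases eq_or_ne i i' with rfl | hi
    · rcases eq_or_ne j j' with rfl | hj
      · exact absurd rfl h
      · simp [hj]
    · simp [hi]
  · simp [hn]

theorem coef_E_mul_ev_eq (n : Fin 2) (i j : Fin 3) (s : S k) :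
    coef k (E k n i j * ev k s) n i j = s := by
  simp [coef_E_ev]

/-! ### Group-like elements -/

theorem im_Z {s : S k} (hs : s ∈ Z k) : im s = 0 := by
  induction hs using Algebra.adjoin_induction with
  | mem s hs =>
    rcases hs with rfl | rfl
    · simp [sZ_eq]
    · simp [sC]
  | algebraMap r => rw [Algebra.algebraMap_eq_smul_one]; simp
  | add p q _ _ hp hq => simp [hp, hq]
  | mul p q _ _ hp hq => simp [hp, hq]

/-- The group-like element `aⁱ bⁿ`. -/
def gE (n : Fin 2) (i : Fin 3) : GroupLike k (Atilde k) := ga k ^ (i : ℕ) * gb k ^ (n : ℕ)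

theorem val_gE (n : Fin 2) (i : Fin 3) :
    ((gE n i : GroupLike k (Atilde k)) : Atilde k) = E k n i 0 := by
  simp [gE, E, GroupLike.val_mul, GroupLike.val_pow, ga, gb]

/-- The functionals at basis elements other than 1 vanish on the coordinate ring, so id ⊗ φ
annihilates g. By `mu_decomp` this removes every monomial except 1, leaving g in k[z, c]. There g is
a unit of a polynomial ring, hence a constant, and the counit makes it 1. -/
theorem groupLike_ev_eq_one (g : GroupLike k (Atilde k)) (s : S k) (h : (g : Atilde k) = ev k s) :
    g = 1 := by
  obtain ⟨p, hp, rfl⟩ := exists_Z_decomp s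
  have key (n : Fin 2) (i j : Fin 3) := mu_decomp p hp n i j
  have h2 (n : Fin 2) : p 2 n = 0 := by
    have := key n 0 1
    rw [← h, mu_groupLike, h, pr_ev] at this
    simp only [Fin.isValue, one_ne_zero, and_false, ↓reduceIte, zero_smul, zero_add, and_self]
      at this
    exact mul_sX_sY_eq_zero n (ev_injective k (by rw [← this, map_zero]))
  have h1 (n : Fin 2) (i : Fin 3) (hni : ¬(n = 0 ∧ i = 0)) :
      p i n * (sX k ^ (i : ℕ) * sY k ^ (n : ℕ)) = 0 := by
    have := key n i 0
    rw [← h, mu_groupLike, h, pr_ev, if_neg (by tauto)] at this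
    simp only [Fin.isValue, zero_ne_one, false_and, ↓reduceIte, zero_smul, add_zero] at this
    exact ev_injective k (by rw [← this, map_zero])
  have e : (g : Atilde k) = ev k (p 0 0) := by
    rw [h]
    have h01 := h1 1 0 (by decide)
    have h10 := h1 0 1 (by decide)
    have h11 := h1 1 1 (by decide)
    simp only [Fin.sum_univ_three, Fin.sum_univ_two, h01, h10, h11, h2]
    simp
  -- the unit `p 0 0` is constant
  have hu : p 0 0 * coef k ((g⁻¹ : GroupLike k (Atilde k)) : Atilde k) 0 0 0 = 1 := by
    have h3 : ((g⁻¹ : GroupLike k (Atilde k)) : Atilde k) * ev k (p 0 0) = 1 := by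
      rw [← e, ← GroupLike.val_mul, inv_mul_cancel, GroupLike.val_one]
    have h4 := congrFun (congrFun (congrFun (congrArg (coef k) h3) 0) 0) 0
    rw [coef_mul_ev, ← ev_one, coef_ev] at h4
    simpa using h4
  have hr : IsUnit (re (p 0 0)) := by
    have := congrArg re hu
    rw [re_mul, im_Z (hp 0 0)] at this
    simp only [mul_zero, zero_mul, add_zero, re_one] at this
    exact IsUnit.of_mul_eq_one _ this
  obtain ⟨r, hr, hr'⟩ := Polynomial.isUnit_iff.1 hr
  obtain ⟨t, ht, rfl⟩ := Polynomial.isUnit_iff.1 hr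
  have e' : (g : Atilde k) = t • 1 := by
    rw [e, ← ev_one, ← map_smul]
    congr 1
    apply S_ext
    · rw [← hr', re_smul, re_one]; simp [Algebra.smul_def, Polynomial.algebraMap_apply]
    · rw [im_Z (hp 0 0)]; simp
  have ht1 : t = 1 := by
    have := g.2.counit_eq_one
    rw [e', map_smul, counit_eq, map_one] at this
    simpa using this
  apply GroupLike.val_injective
  rw [e', ht1, one_smul, GroupLike.val_one]

theorem groupLike_eq_gE (g : GroupLike k (Atilde k)) : ∃ n i, g = gE n i := by
  obtain ⟨n, i, s, h⟩ := groupLike_eq_E_mul g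
  refine ⟨n, i, ?_⟩
  have : (gE n i)⁻¹ * g = 1 := by
    refine groupLike_ev_eq_one _ s ?_
    rw [GroupLike.val_mul, h, ← val_gE, ← mul_assoc, ← GroupLike.val_mul, inv_mul_cancel,
      GroupLike.val_one, one_mul]
  exact (inv_mul_eq_one.1 this).symm

/-! ### Skew primitive elements -/

/-- Away from the functional at 1, φ ⊗ id maps h into the line of g = aᵐbʳ. Hence coefficients at j
= 2 vanish, and the others are constants at prescribed places, except the coefficient at 1, which is
unrestricted. The functional at 1 is not used, so the coefficient at a²xa can survive, and it does
so only for g = a. -/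
theorem skew_eq_ev_add {r : Fin 2} {m : Fin 3} {h : Atilde k} (hh : h ∈ SkewPrim.P k (gE r m)) :
    ∃ (s : S k) (t d : k), h = ev k s + t • (E k r m 0 - 1) + d • E k 0 2 1 ∧
      (¬ (r = 0 ∧ m = 1) → d = 0) := by
  set β := coef k h with hβ
  have key (n : Fin 2) (i j : Fin 3) : lam (pr k n i j) h =
      (if n = 0 ∧ i = 0 ∧ j = 0 then h else 0) + E k r m 0 * ev k (pr k n i j h • 1) := by
    rw [lam_skew _ hh, val_gE, ← E_zero, pr_E, map_smul, ev_one, mul_smul_comm, mul_one]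
    split_ifs <;> simp
  have h2 (n : Fin 2) (i : Fin 3) : β n i 2 = 0 := by
    by_cases hni : n = r ∧ i + 1 = m
    · obtain ⟨rfl, rfl⟩ := hni
      -- Here aⁱ⁺¹bⁿ is g itself, so `lam_pr_two` gives only constancy. The term -aⁱ⁺²(xa)bⁿ in
      -- `lam_pr_one` cannot lie in the line of g and shows that the coefficient vanishes.
      have := key n (i + 1) 1
      rw [lam_pr_one, sub_mul, mul_assoc, ← ev_sX, ← ev_mul, if_neg (by simp), zero_add] at this
      have := congrFun (congrFun (congrFun (congrArg (coef k) this) n) (i + 1 + 1)) 1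
      rw [map_add, map_sub, Pi.add_apply, Pi.add_apply, Pi.add_apply, Pi.sub_apply, Pi.sub_apply,
        Pi.sub_apply, coef_E_mul_ev_ne (by simp), coef_E_mul_ev_ne (by simp), coef_E_mul_ev_eq,
        coef_E_mul_ev_ne (by simp)] at this
      have e : i + 1 + 2 = i := by fin_cases i <;> rfl
      rw [e] at this
      simpa using this
    · have := key n i 2
      rw [lam_pr_two, if_neg (by simp), zero_add] at this
      have := congrFun (congrFun (congrFun (congrArg (coef k) this) n) (i + 1)) 0
      rw [coef_E_mul_ev_eq, coef_E_mul_ev_ne] at this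
      · exact this
      · simpa using hni
  have h1 (n : Fin 2) (i : Fin 3) : β n i 1 = if n = r ∧ i + 2 = m then pr k n i 1 h • 1 else 0 := by
    have := key n i 1
    rw [lam_pr_one, ← hβ, h2, map_zero, mul_zero, add_zero, if_neg (by simp), zero_add] at this
    have := congrFun (congrFun (congrFun (congrArg (coef k) this) n) (i + 2)) 0
    rw [coef_E_mul_ev_eq] at this
    rw [this]
    split_ifs with hni
    · obtain ⟨rfl, rfl⟩ := hni
      rw [coef_E_mul_ev_eq]
    · exact coef_E_mul_ev_ne (by simpa using hni) _
  have h0 (n : Fin 2) (i : Fin 3) (hni : ¬(n = 0 ∧ i = 0)) : β n (i + 2) 1 = 0 ∧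
      β n i 0 = if n = r ∧ i = m then pr k n i 0 h • 1 else 0 := by
    have := key n i 0
    rw [lam_pr_zero _ _ _ h2, if_neg (by tauto), zero_add] at this
    have := congrArg (coef k) this
    constructor
    · have := congrFun (congrFun (congrFun this n) (i + 2)) 1
      rwa [map_add, Pi.add_apply, Pi.add_apply, Pi.add_apply, coef_E_mul_ev_eq,
        coef_E_mul_ev_ne (by simp), coef_E_mul_ev_ne (by simp), zero_add] at this
    · have := congrFun (congrFun (congrFun this n) i) 0
      rw [map_add, Pi.add_apply, Pi.add_apply, Pi.add_apply, coef_E_mul_ev_eq,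
        coef_E_mul_ev_ne (by simp), add_zero] at this
      rw [hβ, this]
      split_ifs with hni
      · obtain ⟨rfl, rfl⟩ := hni
        rw [coef_E_mul_ev_eq]
      · exact coef_E_mul_ev_ne (by simpa using hni) _
  have hd : β 0 2 1 = (if r = 0 ∧ m = 1 then pr k 0 2 1 h else 0) • 1 := by
    rw [h1, ite_smul, zero_smul]
    congr 1
    simp [eq_comm]
  have hsum := eq_sum_E k h
  rw [← hβ] at hsum
  simp only [Fin.sum_univ_two, Fin.sum_univ_three, h2, map_zero, mul_zero, add_zero] at hsum
  have e1 := (h0 0 1 (by decide)).1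
  have e2 := (h0 0 2 (by decide)).1
  have e3 := (h0 1 0 (by decide)).1
  have e4 := (h0 1 1 (by decide)).1
  have e5 := (h0 1 2 (by decide)).1
  have f1 := (h0 0 1 (by decide)).2
  have f2 := (h0 0 2 (by decide)).2
  have f3 := (h0 1 0 (by decide)).2
  have f4 := (h0 1 1 (by decide)).2
  have f5 := (h0 1 2 (by decide)).2
  simp only [Fin.isValue, Fin.reduceAdd, zero_add] at e1 e2 e3 e4 e5
  rw [e1, e2, e3, e4, e5, f1, f2, f3, f4, f5, hd] at hsum
  by_cases hrm : r = 0 ∧ m = 0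
  · obtain ⟨rfl, rfl⟩ := hrm
    refine ⟨β 0 0 0, 0, 0, ?_, fun _ => rfl⟩
    rw [hsum]
    simp [E_zero]
  · refine ⟨β 0 0 0 + pr k r m 0 h • 1, pr k r m 0 h, if r = 0 ∧ m = 1 then pr k 0 2 1 h else 0,
      ?_, fun h => if_neg h⟩
    conv_lhs => rw [hsum]
    rw [map_add, map_smul, ev_one, E_zero, smul_sub]
    clear hsum h0 h1 h2 key e1 e2 e3 e4 e5 f1 f2 f3 f4 f5 hd hβ hh
    fin_cases r <;> fin_cases m <;> simp at hrm ⊢ <;> abel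

end Model
end NodalCubic

/-! ### The skew primitive elements for each group-like element. -/

namespace NodalCubic

open Atilde SkewPrim

namespace Model

universe u
variable {k : Type u} [Field k]

@[simp] theorem re_zero : re (0 : S k) = 0 := rfl
@[simp] theorem im_zero : im (0 : S k) = 0 := rfl

theorem sub_one_mem (g : GroupLike k (Atilde k)) : (g : Atilde k) - 1 ∈ P k g := by
  rw [mem_P, comul_eq, map_sub, map_one, ← comul_eq, g.2.comul_eq_tmul_self,
    TensorProduct.tmul_sub, TensorProduct.sub_tmul, Algebra.TensorProduct.one_def]
  abel

theorem E021_mem : E k 0 2 1 ∈ P k (ga k) := by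
  have e : E k 0 2 1 = (ga k : Atilde k) - 1 - x k - a k * x k * a k ^ 2 := by
    simp only [E, ga, pow_succ, pow_zero, one_mul, mul_one, mul_assoc, rxaa', mul_sub, raa, raa',
      Fin.val_zero, Fin.val_one, Fin.val_two]
    abel
  rw [e]
  exact sub_mem (sub_mem (sub_one_mem _) (x_mem k)) (axa_mem k)

theorem gE_zero_one : gE 0 1 = ga k := by simp [gE]
theorem gE_one_zero : gE 1 0 = gb k := by simp [gE]
theorem gE_zero_zero : gE 0 0 = (1 : GroupLike k (Atilde k)) := by simp [gE]

theorem counit_ev (s : S k) : counitHom k (ev k s) = eps k s := by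
  induction s using S_induction with
  | h0 => simp
  | hadd p q hp hq => rw [map_add, map_add, map_add, hp, hq]
  | hsmul r p hp => rw [map_smul, map_smul, map_smul, hp]
  | hX p hp => simp [-ev_mul]
  | hY p hp => simp [-ev_mul]
  | hc p hp =>
    have : counitHom k (c k) = 0 := by simp [c]
    simp [-ev_mul, this]

theorem counit_skew {g : GroupLike k (Atilde k)} {h : Atilde k} (hh : h ∈ P k g) :
    counitHom k h = 0 := by
  have h1 := Coalgebra.rTensor_counit_comul (R := k) h
  rw [mem_P.1 hh] at h1
  have h2 := congrArg (fun t => counitHom k (TensorProduct.lid k (Atilde k) t)) h1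
  have hg : counitHom k (g : Atilde k) = 1 := g.2.counit_eq_one
  simpa [counit_eq, hg] using h2

/-- A skew primitive element of the coordinate ring. -/
theorem ev_skew {r : Fin 2} {m : Fin 3} {s : S k} (hs : ev k s ∈ P k (gE r m)) :
    ∃ p ∈ Z k, (r = 0 ∧ m = 0 ∨ m ≠ 2 ∨ p = 0) ∧ s = p * (sX k ^ (m : ℕ) * sY k ^ (r : ℕ)) := by
  obtain ⟨p, hp, rfl⟩ := exists_Z_decomp s
  set s := ∑ l : Fin 3, ∑ e : Fin 2, p l e * (sX k ^ (l : ℕ) * sY k ^ (e : ℕ)) with hs_def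
  have key (n : Fin 2) (i j : Fin 3) := mu_decomp p hp n i j
  -- The functional at (xa)bⁿ vanishes on the coordinate ring and on g, yet it sees x² through xa;
  -- this excludes x².
  have h2 (n : Fin 2) : p 2 n = 0 := by
    have := key n 0 1
    rw [← hs_def, mu_skew _ hs, pr_ev, val_gE, pr_E] at this
    simp only [Fin.isValue, one_ne_zero, and_false, ↓reduceIte, zero_smul, zero_add, and_self]
      at this
    exact mul_sX_sY_eq_zero _ (ev_injective k (by rw [← this, map_zero]))
  have h1 (n : Fin 2) (i : Fin 3) : p i n * (sX k ^ (i : ℕ) * sY k ^ (n : ℕ)) =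
      (if n = 0 ∧ i = 0 then eps k s else 0) • 1 + (if n = r ∧ i = m then (1 : k) else 0) • s := by
    have := key n i 0
    rw [← hs_def, mu_skew _ hs, pr_ev, val_gE, pr_E] at this
    simp only [Fin.isValue, zero_ne_one, false_and, ↓reduceIte, add_zero, and_true] at this
    apply ev_injective k
    rw [← this, map_add, map_smul, map_smul, ev_one]
  refine ⟨p m r, hp m r, ?_, ?_⟩
  · by_cases hm : m = 2
    · exact Or.inr (Or.inr (by rw [hm]; exact h2 r))
    · exact Or.inr (Or.inl hm)
  · have h3 : eps k s = 0 := by rw [← counit_ev, counit_skew hs]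
    rw [h1, h3]
    simp

/-- The values of the derivatives at the origin determine the constant factor. -/
theorem Z_const_of_mu {φ : S k →ₗ[k] k} (hz : ∀ s, φ (sZ k * s) = 0) (hc : ∀ s, φ (sC k * s) = 0)
    {p : S k} (hp : p ∈ Z k) {q : Atilde k} (hq : mu (fn φ 0 0 0) q = 1) {g : GroupLike k (Atilde k)}
    (hg : fn φ 0 0 0 g = 0) (h : ev k p * q ∈ P k g) : ∃ t : k, ev k p = t • 1 := by
  -- The coaction of pq is computed twice: it is p by k[z, c]-linearity, and a scalar by skew
  -- primitivity, as φ vanishes on g.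
  have h1 := mu_skew (fn φ 0 0 0) h
  rw [mu_Z_mul (fun h => by rw [← ev_sZ, fn_mul_ev, hz]) (fun h => by rw [← ev_sC, fn_mul_ev, hc])
    hp, hq, hg, mul_one, zero_smul, add_zero] at h1
  exact ⟨_, h1⟩

theorem exists_skew_ev {r : Fin 2} {m : Fin 3} {h : Atilde k} (hh : h ∈ P k (gE r m)) :
    ∃ p ∈ Z k, ∃ t d : k, (r = 0 ∧ m = 0 ∨ m ≠ 2 ∨ p = 0) ∧ (¬ (r = 0 ∧ m = 1) → d = 0) ∧
      ev k p * (x k ^ (m : ℕ) * y k ^ (r : ℕ)) ∈ P k (gE r m) ∧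
      h = ev k p * (x k ^ (m : ℕ) * y k ^ (r : ℕ)) + t • ((gE r m : GroupLike k (Atilde k)) - 1) +
        d • E k 0 2 1 := by
  obtain ⟨s, t, d, rfl, hd⟩ := skew_eq_ev_add hh
  have hE : d • E k 0 2 1 ∈ P k (gE r m) := by
    by_cases hrm : r = 0 ∧ m = 1
    · obtain ⟨rfl, rfl⟩ := hrm
      rw [gE_zero_one]
      exact Submodule.smul_mem _ _ E021_mem
    · rw [hd hrm, zero_smul]
      exact zero_mem _
  rw [← val_gE] at hh ⊢
  have hs : ev k s ∈ P k (gE r m) := by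
    have := sub_mem (sub_mem hh hE) (Submodule.smul_mem _ t (sub_one_mem (gE r m)))
    rwa [add_sub_cancel_right, add_sub_cancel_right] at this
  obtain ⟨p, hp, hm, rfl⟩ := ev_skew hs
  have e : ev k (p * (sX k ^ (m : ℕ) * sY k ^ (r : ℕ))) =
      ev k p * (x k ^ (m : ℕ) * y k ^ (r : ℕ)) := by
    fin_cases m <;> fin_cases r <;> simp [pow_succ, ev_sX, ev_sY]
  rw [e] at hs
  exact ⟨p, hp, t, d, hm, hd, hs, by rw [e]⟩

/-- This holds in every characteristic and already makes primitive elements central, which is all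
the braiding needs. In characteristic p, p-th powers of z and c are primitive as well, so a sharper
answer waits for characteristic zero. -/
theorem skew_one {h : Atilde k} (hh : h ∈ P k (1 : GroupLike k (Atilde k))) :
    ∃ p ∈ Z k, h = ev k p := by
  rw [← gE_zero_zero] at hh
  obtain ⟨p, hp, t, d, _, hd, _, rfl⟩ := exists_skew_ev hh
  refine ⟨p, hp, ?_⟩
  rw [hd (by decide), gE_zero_zero, GroupLike.val_one]
  simp

theorem coef_x : coef k (x k) = Pi.single (0 : Fin 2) (Pi.single (0 : Fin 3)
    (Pi.single (0 : Fin 3) (sX k))) := by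
  rw [← ev_sX, coef_ev]

theorem skew_a {h : Atilde k} (hh : h ∈ P k (ga k)) :
    ∃ q t d : k, h = q • x k + t • (a k - 1) + d • E k 0 2 1 := by
  rw [← gE_zero_one] at hh
  obtain ⟨p, hp, t, d, _, _, hs, rfl⟩ := exists_skew_ev hh
  simp only [Fin.val_one, pow_one, Fin.val_zero, pow_zero, mul_one] at hs
  have e1 : coef k (1 : Atilde k) 0 0 0 = 1 := by rw [← ev_one, coef_ev]; simp
  have e2 : coef k (a k) 0 0 0 = 0 := by
    have := coef_E k 0 1 0
    rw [show E k 0 1 0 = a k by simp [E]] at this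
    rw [this]; simp
  obtain ⟨q, hq⟩ := Z_const_of_mu (φ := dx k) (dx_Z k) (dx_C k) hp (q := x k)
    (by
      simp [mu, fn, e2, coef_x, dx, sX]) (by rw [gE_zero_one]; simp [fn, ga, e2]) hs
  refine ⟨q, t, d, ?_⟩
  rw [hq, gE_zero_one]
  simp [ga]

theorem skew_b {h : Atilde k} (hh : h ∈ P k (gb k)) :
    ∃ q t : k, h = q • y k + t • (b k - 1) := by
  rw [← gE_one_zero] at hh
  obtain ⟨p, hp, t, d, _, hd, hs, rfl⟩ := exists_skew_ev hh
  simp only [Fin.val_one, pow_one, Fin.val_zero, pow_zero, one_mul] at hs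
  have e2 : coef k (b k) 0 0 0 = 0 := by
    have := coef_E k 1 0 0
    rw [show E k 1 0 0 = b k by simp [E]] at this
    rw [this]; simp
  have e3 : coef k (y k) 0 0 0 = sY k := by
    rw [← ev_sY, coef_ev]; simp
  obtain ⟨q, hq⟩ := Z_const_of_mu (φ := dy k) (dy_Z k) (dy_C k) hp (q := y k)
    (by simp [mu, fn, e2, e3, dy, sY]) (by rw [gE_one_zero]; simp [fn, gb, e2]) hs
  refine ⟨q, t, ?_⟩
  rw [hq, hd (by decide), gE_one_zero]
  simp [gb]

theorem skew_other {g : GroupLike k (Atilde k)} (h1 : g ≠ 1) (ha : g ≠ ga k) (hb : g ≠ gb k)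
    {h : Atilde k} (hh : h ∈ P k g) : ∃ t : k, h = t • ((g : Atilde k) - 1) := by
  obtain ⟨r, m, rfl⟩ := groupLike_eq_gE g
  have d1 : ¬ (r = 0 ∧ m = 0) := by rintro ⟨rfl, rfl⟩; exact h1 gE_zero_zero
  have d2 : ¬ (r = 0 ∧ m = 1) := by rintro ⟨rfl, rfl⟩; exact ha gE_zero_one
  have d3 : ¬ (r = 1 ∧ m = 0) := by rintro ⟨rfl, rfl⟩; exact hb gE_one_zero
  obtain ⟨p, hp, t, d, hm, hd, hs, rfl⟩ := exists_skew_ev hh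
  refine ⟨t, ?_⟩
  rw [hd d2, zero_smul, add_zero]
  suffices p = 0 by rw [this, map_zero, zero_mul, zero_add]
  rcases hm with hm | hm | hm
  · exact absurd hm d1
  -- Only g = ab is left, with candidates p·xy. Reading the x-derivative at b in the second leg of
  -- Δ(xy) picks out y ⊗ xb, so the coaction of p·xy is py, while skew primitivity makes it zero.
  · have hrm : r = 1 ∧ m = 1 := by
      fin_cases r <;> fin_cases m <;> simp at d1 d2 d3 hm ⊢
    obtain ⟨rfl, rfl⟩ := hrm
    simp only [Fin.val_one, pow_one] at hs
    have h3 := mu_skew (fn (dx k) 1 0 0) hs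
    have h4 : coef k (x k * b k) 1 0 0 = sX k := by
      have := coef_E_ev k 1 0 0 (sX k)
      rw [show E k 1 0 0 = b k by simp [E], ev_sX, rbx] at this
      rw [this]; simp
    have h5 : coef k (x k * y k) 1 0 0 = 0 := by
      rw [← ev_sX, ← ev_sY, ← ev_mul, coef_ev]; simp
    have h6 : coef k (a k * y k) 1 0 0 = 0 := by
      have := coef_E_ev k 0 1 0 (sY k)
      rw [show E k 0 1 0 = a k by simp [E], ev_sY] at this
      rw [this]; simp
    have h7 : coef k (E k 1 1 0) 1 0 0 = 0 := by rw [coef_E]; simp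
    have h8 : E k 1 1 0 = a k * b k := by simp [E]
    have h9 : coef k (ev k p * (x k * y k)) 1 0 0 = 0 := by
      rw [← ev_sX, ← ev_sY, ← ev_mul, ← ev_mul, coef_ev]; simp
    rw [mu_Z_mul (fun h => by rw [← ev_sZ, fn_mul_ev, dx_Z])
      (fun h => by rw [← ev_sC, fn_mul_ev, dx_C]) hp, val_gE] at h3
    have h10 : mu (fn (dx k) 1 0 0) (x k * y k) = y k := by
      simp [mu, fn, mul_add, add_mul, h4, h5, h6, ← h8, h7]
      simp [dx, sX]
    rw [h10, ← ev_sY, ← ev_mul] at h3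
    simp only [fn, LinearMap.coe_mk, AddHom.coe_mk, h7, ev_sY, h9, map_zero, zero_smul,
      add_zero] at h3
    refine mul_sX_sY_eq_zero 1 (ev_injective k ?_)
    rw [pow_one, mul_left_comm, ev_mul, h3, mul_zero, map_zero]
  · exact hm

end Model
end NodalCubic

/-! ### The Yetter-Drinfel'd braiding for a general Hopf algebra. -/

namespace SkewPrim

universe u v

variable {k : Type u} [Field k] {H : Type v} [Ring H] [HopfAlgebra k H]

theorem cls_eq_iff {g : GroupLike k H} {p q : H} {hp : p ∈ P k g} {hq : q ∈ P k g} :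
    cls g p hp = cls g q hq ↔ ∃ r : k, r • ((g : H) - 1) = p - q := by
  refine (Submodule.Quotient.eq _).trans ?_
  simp only [Submodule.submoduleOf, Submodule.mem_comap, Submodule.subtype_apply,
    Submodule.mem_span_singleton]
  rfl

theorem exists_cls {g : GroupLike k H} (w : VG k g) : ∃ p hp, w = cls g p hp := by
  obtain ⟨⟨p, hp⟩, rfl⟩ := Submodule.Quotient.mk_surjective _ w
  exact ⟨p, hp, rfl⟩

theorem conjV_cls {g g' : GroupLike k H} (h : GroupLike k H) (e : g' = h * g * h⁻¹) {p : H}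
    (hp : p ∈ P k g) :
    conjV h e (cls g p hp) = cls g' (h * p * ((h⁻¹ : GroupLike k H) : H)) (conj_mem e hp) :=
  cls_eq_iff.2 ⟨0, by simp [mul_assoc]⟩

theorem braidingVG_tmul (g : GroupLike k H) (p q : VG k g) :
    braidingVG g (p ⊗ₜ[k] q) = conjV g (by simp) q ⊗ₜ[k] p := rfl

theorem V_induction {C : V k H → Prop} (w : V k H) (h0 : C 0) (hi : ∀ g p, C (incl g p))
    (ha : ∀ p q, C p → C q → C (p + q)) : C w := by
  classical
  refine DirectSum.induction_on w h0 (fun g p => ?_) ha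
  exact hi g p

theorem act_incl (h g : GroupLike k H) (p : VG k g) :
    act h (incl g p) = incl (h * g * h⁻¹) (conjV h rfl p) := by
  classical
  unfold act incl
  exact DirectSum.toModule_lof k _ _

theorem braiding_incl (g : GroupLike k H) (p : VG k g) (w : V k H) :
    braiding k H (incl g p ⊗ₜ[k] w) = act g w ⊗ₜ[k] incl g p := by
  classical
  exact LinearMap.congr_fun (DirectSum.toModule_lof k (φ := fun g : GroupLike k H =>
    ((TensorProduct.mk k (V k H) (V k H)).flip.comp (incl g)).compl₂ (act g)) g p) w

/-- Comparing inside the direct sum avoids transport between the types V_g and V_g' for equal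
group-likes. -/
theorem incl_congr {g g' : GroupLike k H} (e : g = g') {p q : H} (hp : p ∈ P k g)
    (hq : q ∈ P k g') (h : p = q) : incl g (cls g p hp) = incl g' (cls g' q hq) := by
  subst e h
  rfl

theorem act_incl_cls (h g : GroupLike k H) {p : H} (hp : p ∈ P k g) {g' : GroupLike k H}
    (e : g' = h * g * h⁻¹) {q : H} (hq : q ∈ P k g')
    (hpq : h * p * ((h⁻¹ : GroupLike k H) : H) = q) :
    act h (incl g (cls g p hp)) = incl g' (cls g' q hq) := by
  rw [act_incl, conjV_cls]
  exact incl_congr e.symm _ _ hpq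

theorem act_one (w : V k H) : act 1 w = w := by
  induction w using V_induction with
  | h0 => simp
  | hi g p =>
    obtain ⟨p, hp, rfl⟩ := exists_cls p
    exact act_incl_cls _ _ _ (by simp) _ (by simp)
  | ha p q hp hq => rw [map_add, hp, hq]

theorem act_mul (g h : GroupLike k H) (w : V k H) : act (g * h) w = act g (act h w) := by
  induction w using V_induction with
  | h0 => simp
  | hi l p =>
    obtain ⟨p, hp, rfl⟩ := exists_cls p
    rw [act_incl_cls h l hp rfl (conj_mem rfl hp) rfl,
      act_incl_cls g _ (conj_mem rfl hp) rfl (conj_mem rfl (conj_mem rfl hp)) rfl]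
    refine act_incl_cls _ _ _ (by group) _ ?_
    rw [mul_inv_rev, GroupLike.val_mul, GroupLike.val_mul]
    simp only [mul_assoc]
  | ha p q hp hq => rw [map_add, map_add, map_add, hp, hq]

open Classical in
/-- The inverse of the Yetter-Drinfel'd braiding. -/
def braidingInv : V k H ⊗[k] V k H →ₗ[k] V k H ⊗[k] V k H :=
  TensorProduct.lift (DirectSum.toModule k (GroupLike k H) (V k H →ₗ[k] V k H ⊗[k] V k H)
    (fun g => ((TensorProduct.mk k (V k H) (V k H)).comp (incl g)).compl₂ (act g⁻¹))).flip

theorem braidingInv_incl (g : GroupLike k H) (p : VG k g) (w : V k H) :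
    braidingInv (w ⊗ₜ[k] incl g p) = incl g p ⊗ₜ[k] act g⁻¹ w := by
  classical
  exact LinearMap.congr_fun (DirectSum.toModule_lof k (φ := fun g : GroupLike k H =>
    ((TensorProduct.mk k (V k H) (V k H)).comp (incl g)).compl₂ (act g⁻¹)) g p) w

theorem braiding_bijective : Function.Bijective (braiding k H) := by
  refine Function.bijective_iff_has_inverse.2 ⟨braidingInv, fun t => ?_, fun t => ?_⟩
  · induction t with
    | zero => simp
    | add s t hs ht => rw [map_add, map_add, hs, ht]
    | tmul p w =>
      induction p using V_induction with
      | h0 => simp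
      | hi g p => rw [braiding_incl, braidingInv_incl, ← act_mul, inv_mul_cancel, act_one]
      | ha p q hp hq => rw [TensorProduct.add_tmul, map_add, map_add, hp, hq]
  · induction t with
    | zero => simp
    | add s t hs ht => rw [map_add, map_add, hs, ht]
    | tmul w p =>
      induction p using V_induction with
      | h0 => simp
      | hi g p => rw [braidingInv_incl, braiding_incl, ← act_mul, mul_inv_cancel, act_one]
      | ha p q hp hq => rw [TensorProduct.tmul_add, map_add, map_add, hp, hq]

/-- On p ⊗ q ⊗ r with p, q of degrees g, h the braid equation reduces to (ghg⁻¹)·(g·r) = g·(h·r). -/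
theorem isBraiding_braiding : Nichols.IsBraiding (braiding k H) := by
  refine ⟨braiding_bijective, ?_⟩
  have h1 (W : Type v) [AddCommGroup W] [Module k W] (g : GroupLike k H) (p : VG k g) (q : V k H)
      (r : W) : Nichols.braidFirst (braiding k H) W (incl g p ⊗ₜ[k] (q ⊗ₜ[k] r)) =
        act g q ⊗ₜ[k] (incl g p ⊗ₜ[k] r) := by
    simp [Nichols.braidFirst, braiding_incl]
  apply TensorProduct.ext'
  intro p t
  induction p using V_induction with
  | h0 => simp
  | ha p q hp hq => rw [TensorProduct.add_tmul, map_add, map_add, hp, hq]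
  | hi g p =>
    induction t with
    | zero => simp
    | add s t hs ht => rw [TensorProduct.tmul_add, map_add, map_add, hs, ht]
    | tmul q r =>
      induction q using V_induction with
      | h0 => simp
      | ha p q hp hq =>
        rw [TensorProduct.add_tmul, TensorProduct.tmul_add, map_add, map_add, hp, hq]
      | hi h q =>
        simp only [LinearMap.comp_apply, h1, LinearMap.lTensor_tmul, braiding_incl, act_incl,
          ← act_mul]
        rw [inv_mul_cancel_right]

theorem braiding_incl_incl (g : GroupLike k H) (p q : VG k g) :
    braiding k H (incl g p ⊗ₜ[k] incl g q) =
      TensorProduct.map (incl g) (incl g) (braidingVG g (p ⊗ₜ[k] q)) := by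
  rw [braiding_incl, braidingVG_tmul, TensorProduct.map_tmul]
  obtain ⟨q, hq, rfl⟩ := exists_cls q
  have e : g = g * g * g⁻¹ := by simp
  rw [conjV_cls, act_incl_cls g g hq e (conj_mem e hq) rfl]

/-- A skew primitive element that commutes with the group-like element is fixed by the action. -/
theorem act_incl_of_commute {h g : GroupLike k H} {p : H} (hp : p ∈ P k g)
    (hg : h * g = g * h) (hc : (h : H) * p = p * h) :
    act h (incl g (cls g p hp)) = incl g (cls g p hp) := by
  refine act_incl_cls _ _ _ ?_ _ ?_
  · rw [hg, mul_inv_cancel_right]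
  · rw [hc, mul_assoc, val_mul_inv, mul_one]

end SkewPrim

/-! ### The braided vector spaces V_1, V_a and V_b. -/

namespace NodalCubic

open Atilde SkewPrim

namespace Model

universe u
variable {k : Type u} [Field k]

instance : Nontrivial (S k) := ⟨⟨0, 1, fun h => by simpa using congrArg re h⟩⟩

theorem coef_one : coef k (1 : Atilde k) = Pi.single (0 : Fin 2) (Pi.single (0 : Fin 3)
    (Pi.single (0 : Fin 3) 1)) := by rw [← E_zero, coef_E]

theorem coef_a : coef k (a k) = Pi.single (0 : Fin 2) (Pi.single (1 : Fin 3)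
    (Pi.single (0 : Fin 3) 1)) := by
  rw [← coef_E]; simp [E]

theorem coef_b : coef k (b k) = Pi.single (1 : Fin 2) (Pi.single (0 : Fin 3)
    (Pi.single (0 : Fin 3) 1)) := by
  rw [← coef_E]; simp [E]

theorem coef_y : coef k (y k) = Pi.single (0 : Fin 2) (Pi.single (0 : Fin 3)
    (Pi.single (0 : Fin 3) (sY k))) := by
  rw [← ev_sY, coef_ev]

theorem ga_ne_one : ga k ≠ 1 := by
  intro h
  have h1 := congrArg (fun g : GroupLike k (Atilde k) => coef k (g : Atilde k) 0 0 0) h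
  simp [ga, coef_a, coef_one] at h1

theorem gb_ne_one : gb k ≠ 1 := by
  intro h
  have h1 := congrArg (fun g : GroupLike k (Atilde k) => coef k (g : Atilde k) 0 0 0) h
  simp [gb, coef_b, coef_one] at h1

theorem ga_ne_gb : ga k ≠ gb k := by
  intro h
  have h1 := congrArg (fun g : GroupLike k (Atilde k) => coef k (g : Atilde k) 0 1 0) h
  simp [ga, gb, coef_b, coef_a] at h1

theorem subsingleton_VG {g : GroupLike k (Atilde k)} (h1 : g ≠ 1) (ha : g ≠ ga k) (hb : g ≠ gb k) :
    Subsingleton (VG k g) := by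
  refine ⟨fun p q => ?_⟩
  obtain ⟨p, hp, rfl⟩ := exists_cls p
  obtain ⟨q, hq, rfl⟩ := exists_cls q
  obtain ⟨t, rfl⟩ := skew_other h1 ha hb hp
  obtain ⟨s, rfl⟩ := skew_other h1 ha hb hq
  exact cls_eq_iff.2 ⟨t - s, by rw [sub_smul]⟩

theorem one_mul_comm {p : Atilde k} (hp : p ∈ P k (1 : GroupLike k (Atilde k))) (h : Atilde k) :
    p * h = h * p := by
  obtain ⟨q, hq, rfl⟩ := skew_one hp
  exact ev_Z_comm hq h

theorem groupLike_comm (g h : GroupLike k (Atilde k)) : g * h = h * g := by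
  obtain ⟨n, i, rfl⟩ := groupLike_eq_gE g
  obtain ⟨n', i', rfl⟩ := groupLike_eq_gE h
  have hab : gb k * ga k = ga k * gb k := by
    apply GroupLike.val_injective (R := k)
    simpa [GroupLike.val_mul, ga, gb] using rba k
  have hc : Commute (ga k) (gb k) := hab.symm
  unfold gE
  exact ((((Commute.refl _).pow_pow _ _).mul_right (hc.pow_pow _ _)).mul_left
    ((hc.symm.pow_pow _ _).mul_right ((Commute.refl _).pow_pow _ _)))

theorem commute_a_inv_b : (b k) * (a k * x k * a k ^ 2) = (a k * x k * a k ^ 2) * b k := by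
  have h : Commute (b k) (a k) := rba k
  exact (h.mul_right (rbx k)).mul_right (h.pow_right 2)

theorem E021_eq : E k 0 2 1 = (a k - 1) - x k - a k * x k * a k ^ 2 := by
  simp only [E, pow_succ, pow_zero, one_mul, mul_one, mul_assoc, rxaa', mul_sub, raa, raa',
    Fin.val_zero, Fin.val_one, Fin.val_two]
  abel

theorem act_incl_one (g : GroupLike k (Atilde k)) (p : VG k (1 : GroupLike k (Atilde k))) :
    act g (incl 1 p) = incl 1 p := by
  obtain ⟨p, hp, rfl⟩ := exists_cls p
  exact act_incl_of_commute hp (by simp) (one_mul_comm hp _).symm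

theorem act_a_incl_b (p : VG k (gb k)) : act (ga k) (incl (gb k) p) = incl (gb k) p := by
  obtain ⟨p, hp, rfl⟩ := exists_cls p
  refine act_incl_of_commute hp (groupLike_comm _ _) ?_
  obtain ⟨q, t, rfl⟩ := skew_b hp
  simp only [ga, mul_add, add_mul, mul_smul_comm, smul_mul_assoc, rya, rba, mul_sub, sub_mul,
    mul_one, one_mul]

theorem act_b_incl_a (p : VG k (ga k)) : act (gb k) (incl (ga k) p) = incl (ga k) p := by
  obtain ⟨p, hp, rfl⟩ := exists_cls p
  refine act_incl_of_commute hp (groupLike_comm _ _) ?_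
  obtain ⟨q, t, d, rfl⟩ := skew_a hp
  simp only [E021_eq, gb, mul_add, add_mul, mul_smul_comm, smul_mul_assoc, rbx, rba, mul_sub,
    sub_mul, mul_one, one_mul, commute_a_inv_b]

/-- Between different degrees the action is trivial: primitive elements are central, a commutes with
b and y, b commutes with a and x, and all other V_g vanish. -/
theorem braiding_of_ne {g h : GroupLike k (Atilde k)} (hgh : g ≠ h) (p : VG k g) (q : VG k h) :
    braiding k (Atilde k) (incl g p ⊗ₜ[k] incl h q) = incl h q ⊗ₜ[k] incl g p := by
  rw [braiding_incl]
  by_cases h1 : h = 1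
  · subst h1
    rw [act_incl_one]
  by_cases g1 : g = 1
  · subst g1
    rw [act_one]
  by_cases ha : g = ga k
  · by_cases hb : h = gb k
    · subst ha hb
      rw [act_a_incl_b]
    · have := subsingleton_VG h1 (ha ▸ hgh.symm) hb
      rw [Subsingleton.elim q 0]
      simp
  by_cases hb : g = gb k
  · by_cases ha : h = ga k
    · subst ha hb
      rw [act_b_incl_a]
    · have := subsingleton_VG h1 ha (hb ▸ hgh.symm)
      rw [Subsingleton.elim q 0]
      simp
  have := subsingleton_VG g1 ha hb
  rw [Subsingleton.elim p 0]
  simp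

theorem braidingVG_one (p q : V1 k) : braidingVG 1 (p ⊗ₜ[k] q) = q ⊗ₜ[k] p := by
  rw [braidingVG_tmul]
  obtain ⟨q, hq, rfl⟩ := exists_cls q
  rw [conjV_cls]
  congr 1
  exact cls_eq_iff.2 ⟨0, by simp⟩

theorem span_clsY (p : Vb k) : ∃ r : k, p = r • clsY k := by
  obtain ⟨p, hp, rfl⟩ := exists_cls p
  obtain ⟨q, t, rfl⟩ := skew_b hp
  exact ⟨q, cls_eq_iff.2 ⟨t, by simp [gb]⟩⟩

theorem inv_gb : (((gb k)⁻¹ : GroupLike k (Atilde k)) : Atilde k) = b k := by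
  have : (gb k)⁻¹ = gb k := by
    rw [inv_eq_iff_mul_eq_one]
    apply GroupLike.val_injective (R := k)
    simpa [GroupLike.val_mul, gb] using rbb1 k
  rw [this]; rfl

theorem inv_ga : (((ga k)⁻¹ : GroupLike k (Atilde k)) : Atilde k) = a k ^ 2 := by
  have : (ga k)⁻¹ = ga k ^ 2 := by
    rw [inv_eq_iff_mul_eq_one]
    apply GroupLike.val_injective (R := k)
    rw [GroupLike.val_mul, GroupLike.val_pow, ← pow_succ']
    exact raaa k
  rw [this, GroupLike.val_pow]; rfl

theorem conjV_clsY : conjV (gb k) (by simp) (clsY k) = - clsY k := by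
  rw [clsY, conjV_cls]
  refine (cls_eq_iff (hq := neg_mem (y_mem k))).2 ⟨0, ?_⟩
  rw [inv_gb]
  simp [gb, ryb, mul_assoc, rbb1]

theorem braidingVG_b (p q : Vb k) : braidingVG (gb k) (p ⊗ₜ[k] q) = -(q ⊗ₜ[k] p) := by
  rw [braidingVG_tmul]
  obtain ⟨r, rfl⟩ := span_clsY q
  rw [map_smul, conjV_clsY, smul_neg, TensorProduct.neg_tmul]

theorem clsY_ne_zero : clsY k ≠ 0 := by
  intro h
  obtain ⟨r, hr⟩ := cls_eq_iff.1 (h.trans (rfl : 0 = cls (gb k) 0 (zero_mem _)))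
  have h1 := congrArg (fn (dy k) 0 0 0) hr
  rw [map_smul, map_sub, map_sub] at h1
  simp [fn, gb, coef_y, coef_b, coef_one, dy, sY] at h1

theorem exists_basis_b : ∃ e : Module.Basis (Fin 1) k (Vb k), e 0 = clsY k := by
  refine ⟨Module.Basis.mk (v := fun _ => clsY k) (LinearIndependent.of_subsingleton 0 clsY_ne_zero)
    fun p _ => ?_, by simp⟩
  obtain ⟨r, rfl⟩ := span_clsY p
  exact Submodule.smul_mem _ _ (Submodule.subset_span ⟨0, rfl⟩)

theorem span_uv (p : Va k) : ∃ r s : k, p = r • u k + s • v k := by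
  obtain ⟨p, hp, rfl⟩ := exists_cls p
  obtain ⟨q, t, d, rfl⟩ := skew_a hp
  -- Modulo a - 1, the element a²xa equals -x - axa² by `E021_eq`.
  refine ⟨q - d, -d, (cls_eq_iff (hq := add_mem (Submodule.smul_mem _ _ (x_mem k))
    (Submodule.smul_mem _ _ (axa_mem k)))).2 ⟨t + d, ?_⟩⟩
  simp only [E021_eq, ga]
  module

/-- The coefficient at a²xa detects v, and then the x-derivative of the coefficient at 1 detects u.
Both vanish on a - 1. -/
theorem linearIndependent_uv {r s : k} (h : r • u k + s • v k = 0) : r = 0 ∧ s = 0 := by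
  obtain ⟨t, ht⟩ := (cls_eq_iff (hp := add_mem (Submodule.smul_mem _ _ (x_mem k))
    (Submodule.smul_mem _ _ (axa_mem k))) (hq := zero_mem _)).1 h
  have e : a k * x k * a k ^ 2 = (a k - 1) - x k - E k 0 2 1 := by rw [E021_eq]; abel
  rw [e] at ht
  have hs := congrArg (fn (eps k) 0 2 1) ht
  simp only [map_smul, map_sub, map_add] at hs
  simp [fn, ga, coef_a, coef_one, coef_x, coef_E, eps] at hs
  have hr := congrArg (fn (dx k) 0 0 0) ht
  simp only [map_smul, map_sub, map_add] at hr
  simp [fn, ga, coef_a, coef_one, coef_x, coef_E, dx, sX, Polynomial.coeff_one, hs] at hr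
  exact ⟨hr.symm, hs⟩

theorem exists_basis_a : ∃ e : Module.Basis (Fin 2) k (Va k), e 0 = u k ∧ e 1 = v k := by
  refine ⟨Module.Basis.mk (v := ![u k, v k]) (LinearIndependent.pair_iff.2 fun r s h =>
    linearIndependent_uv h) fun p _ => ?_, by simp, by simp⟩
  obtain ⟨r, s, rfl⟩ := span_uv p
  exact add_mem (Submodule.smul_mem _ _ (Submodule.subset_span ⟨0, rfl⟩))
    (Submodule.smul_mem _ _ (Submodule.subset_span ⟨1, rfl⟩))

theorem conjV_u : conjV (ga k) (by simp) (u k) = v k := by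
  rw [u, conjV_cls]
  refine cls_eq_iff.2 ⟨0, ?_⟩
  rw [inv_ga]
  simp [ga]

theorem conjV_v : conjV (ga k) (by simp) (v k) = - u k - v k := by
  rw [v, conjV_cls]
  refine (cls_eq_iff (hq := sub_mem (neg_mem (x_mem k)) (axa_mem k))).2 ⟨1, ?_⟩
  rw [inv_ga]
  have e : a k * (a k * x k * a k ^ 2) * a k ^ 2 = E k 0 2 1 := by
    have h4 : a k ^ 4 = a k := by rw [pow_succ, raaa, one_mul]
    simp only [E, Fin.val_two, Fin.val_one, Fin.val_zero, pow_one, pow_zero, mul_one, mul_assoc,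
      ← pow_add]
    norm_num
    rw [h4, ← mul_assoc, ← pow_two]
  simp only [ga, e, E021_eq]
  module

/-- A diagonal braiding would make the basis consist of eigenvectors of conjugation T by a. Since T²
+ T + 1 = 0, an eigenvalue is a primitive third root of unity or 1. With no such root T would be the
identity, against Tu = v. -/
theorem not_isDiagonalType (hk : ∀ r : k, ¬ IsPrimitiveRoot r 3) :
    ¬ Nichols.IsDiagonalType (braidingVG (ga k)) := by
  rintro ⟨I, e, q, h⟩
  set T : Va k →ₗ[k] Va k := conjV (ga k) (by simp) with hT
  have h1 (i j : I) : T (e j) = q i j • e j := by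
    have := h i j
    rw [braidingVG_tmul] at this
    simpa using congrArg (fun t => TensorProduct.rid k _ ((e.coord i).lTensor _ t)) this
  have h2 (w : Va k) : T (T w) =
      - w - T w := by
    obtain ⟨r, s, rfl⟩ := span_uv w
    simp only [map_add, map_smul, hT, conjV_u, conjV_v, map_sub, map_neg]
    module
  have h3 (j : I) : T (e j) = e j := by
    have h4 := h2 (e j)
    rw [h1 j j, map_smul, h1 j j, smul_smul, ← sub_eq_zero] at h4
    have h5 : (q j j * q j j + 1 + q j j) • e j = 0 := by rw [← h4]; module
    have h6 := (smul_eq_zero.1 h5).resolve_right (e.ne_zero j)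
    -- The eigenvalue 1 can satisfy the quadratic equation only in characteristic 3, but no
    -- contradiction is needed at this point.
    by_cases h7 : q j j = 1
    · rw [h1 j j, h7, one_smul]
    · refine absurd (IsPrimitiveRoot.mk_of_lt (q j j) (by norm_num) ?_ ?_) (hk (q j j))
      · linear_combination (q j j - 1) * h6
      · intro l hl hl3 h8
        interval_cases l
        · exact h7 (by simpa using h8)
        · have : q j j = 1 := by linear_combination (q j j - 1) * h6 - q j j * h8
          exact h7 this
  have h4 : T = LinearMap.id := e.ext h3
  have h5 := conjV_u (k := k)
  rw [← hT, h4, LinearMap.id_apply, ← sub_eq_zero] at h5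
  have := (linearIndependent_uv (k := k) (r := 1) (s := -1) (by rw [← h5]; module)).1
  exact one_ne_zero this

end Model
end NodalCubic

/-! ### Quantum symmetrisers via Fock representations. -/

namespace Nichols

universe u v w

variable {k : Type u} [Field k] {V : Type v} [AddCommGroup V] [Module k V]

/-- The identification of `V ⊗ V^{⊗(n+1)}` with `V^{⊗(n+2)}`. -/
def glue (n : ℕ) : V ⊗[k] TPow k V n ≃ₗ[k] TPow k V (n + 1) := LinearEquiv.refl k _

/-- The identification of `V` with `V^{⊗1}`. -/
def single : V ≃ₗ[k] TPow k V 0 := LinearEquiv.refl k _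

/-- The identification of `V ⊗ V` with `V^{⊗2}`. -/
def glue₀ : V ⊗[k] V ≃ₗ[k] TPow k V 1 := LinearEquiv.refl k _

@[elab_as_elim]
theorem TPow_induction {n : ℕ} {C : TPow k V (n + 1) → Prop} (t : TPow k V (n + 1)) (h0 : C 0)
    (hi : ∀ (p : V) (s : TPow k V n), C (glue n (p ⊗ₜ[k] s))) (ha : ∀ s t, C s → C t → C (s + t)) :
    C t :=
  TensorProduct.induction_on (motive := C) t h0 hi ha

theorem toTensorAlgebra_single (p : V) :
    toTensorAlgebra k V 0 (single (k := k) p) = TensorAlgebra.ι k p := rfl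

theorem exists_single (t : TPow k V 0) : ∃ p : V, t = single (k := k) p := ⟨t, rfl⟩

theorem toTensorAlgebra_glue (n : ℕ) (p : V) (s : TPow k V n) :
    toTensorAlgebra k V (n + 1) (glue n (p ⊗ₜ[k] s)) =
      TensorAlgebra.ι k p * toTensorAlgebra k V n s := rfl

variable (χ : V ⊗[k] V →ₗ[k] V ⊗[k] V)

theorem quantumSymmetriser_zero (t : TPow k V 0) : quantumSymmetriser χ 0 t = t := rfl

theorem quantumSymmetriser_glue (n : ℕ) (p : V) (s : TPow k V n) :
    quantumSymmetriser χ (n + 1) (glue n (p ⊗ₜ[k] s)) =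
      glue n (insertion χ n (p ⊗ₜ[k] quantumSymmetriser χ n s)) := rfl

theorem glue_zero_tmul (p q : V) :
    glue 0 (p ⊗ₜ[k] single (k := k) q) = glue₀ (p ⊗ₜ[k] q) := rfl

theorem glue_insertion_zero (p q : V) :
    glue 0 (insertion χ 0 (p ⊗ₜ[k] single (k := k) q)) = glue₀ (p ⊗ₜ[k] q + χ (p ⊗ₜ[k] q)) := rfl

theorem toTensorAlgebra_glue₀ (p q : V) :
    toTensorAlgebra k V 1 (glue₀ (p ⊗ₜ[k] q)) = TensorAlgebra.ι k p * TensorAlgebra.ι k q := rfl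

theorem quantumSymmetriser_one (T : V ⊗[k] V) :
    quantumSymmetriser χ 1 (glue₀ T) = glue₀ (T + χ T) := by
  induction T with
  | zero => simp
  | tmul p q => rfl
  | add s t hs ht => simp only [map_add, hs, ht]; abel

theorem insertion_glue (n : ℕ) (p q : V) (s : TPow k V n) :
    insertion χ (n + 1) (p ⊗ₜ[k] glue n (q ⊗ₜ[k] s)) =
      p ⊗ₜ[k] glue n (q ⊗ₜ[k] s) +
        ((glue n).toLinearMap ∘ₗ insertion χ n).lTensor V
          (TensorProduct.assoc k V V (TPow k V n) (χ (p ⊗ₜ[k] q) ⊗ₜ[k] s)) := by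
  rfl

/-- Operators `m`, `L` of `V` on a vector space `X`, with a vacuum vector, that behave like
concatenation and quantum shuffle multiplication. -/
structure IsFock {X : Type w} [AddCommGroup X] [Module k X] (m L : V →ₗ[k] Module.End k X)
    (vac : X) : Prop where
  vac : ∀ p, L p vac = m p vac
  comm : ∀ p q, L p * m q = m p * m q +
    TensorProduct.lift ((LinearMap.mul k (Module.End k X)).compl₁₂ m L) (χ (p ⊗ₜ[k] q))

namespace IsFock

variable {χ} {X : Type w} [AddCommGroup X] [Module k X] {m L : V →ₗ[k] Module.End k X} {vac : X}

/-- The commutation rule for L p * m q is the recursion of `insertion`: the letter p either stays in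
front of q or is braided past it and inserted further right. -/
theorem lift_insertion (h : IsFock χ m L vac) (n : ℕ) (p : V) (t : TPow k V n) :
    L p (TensorAlgebra.lift k m (toTensorAlgebra k V n t) vac) =
      TensorAlgebra.lift k m (toTensorAlgebra k V (n + 1) (glue n (insertion χ n (p ⊗ₜ[k] t))))
        vac := by
  induction n generalizing p with
  | zero =>
    obtain ⟨q, hq⟩ := exists_single t
    rw [hq]
    have h1 := LinearMap.congr_fun (h.comm p q) vac
    have key (τ : V ⊗[k] V) :
        TensorProduct.lift ((LinearMap.mul k (Module.End k X)).compl₁₂ m L) τ vac =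
          TensorAlgebra.lift k m (toTensorAlgebra k V 1 (glue₀ τ)) vac := by
      induction τ with
      | zero => simp
      | add s t hs ht => simp only [map_add, LinearMap.add_apply, hs, ht]
      | tmul q r =>
        rw [toTensorAlgebra_glue₀]
        simp [h.vac]
    rw [LinearMap.add_apply, key] at h1
    rw [glue_insertion_zero, map_add, map_add, map_add, LinearMap.add_apply,
      toTensorAlgebra_glue₀]
    refine Eq.trans ?_ (h1.trans ?_)
    · rw [toTensorAlgebra_single, TensorAlgebra.lift_ι_apply, Module.End.mul_apply]
    · rw [map_mul, TensorAlgebra.lift_ι_apply, TensorAlgebra.lift_ι_apply]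
  | succ n ih =>
    induction t using TPow_induction with
    | h0 => simp
    | ha s t hs ht => simp only [map_add, TensorProduct.tmul_add, LinearMap.add_apply, hs, ht]
    | hi q s =>
      have key (τ : V ⊗[k] V) :
          TensorProduct.lift ((LinearMap.mul k (Module.End k X)).compl₁₂ m L) τ
              (TensorAlgebra.lift k m (toTensorAlgebra k V n s) vac) =
            TensorAlgebra.lift k m (toTensorAlgebra k V (n + 2) (glue (n + 1)
              (((glue n).toLinearMap ∘ₗ insertion χ n).lTensor V
                (TensorProduct.assoc k V V (TPow k V n) (τ ⊗ₜ[k] s))))) vac := by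
        induction τ with
        | zero => simp
        | add s t hs ht => simp only [map_add, TensorProduct.add_tmul, LinearMap.add_apply, hs, ht]
        | tmul q r =>
          rw [TensorProduct.assoc_tmul, LinearMap.lTensor_tmul, toTensorAlgebra_glue]
          simp [ih]
      rw [insertion_glue, map_add, map_add, map_add, LinearMap.add_apply, ← key,
        toTensorAlgebra_glue, toTensorAlgebra_glue, toTensorAlgebra_glue]
      simp only [map_mul, TensorAlgebra.lift_ι_apply, Module.End.mul_apply]
      rw [← Module.End.mul_apply, h.comm]
      simp

/-- Consequently, a tensor in the kernel of the symmetriser kills the vacuum when its letters act by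
L. This converts Fock representations into maps out of the Nichols algebra. -/
theorem lift_quantumSymmetriser (h : IsFock χ m L vac) (n : ℕ) (t : TPow k V n) :
    TensorAlgebra.lift k m (toTensorAlgebra k V n (quantumSymmetriser χ n t)) vac =
      TensorAlgebra.lift k L (toTensorAlgebra k V n t) vac := by
  induction n with
  | zero =>
    obtain ⟨q, hq⟩ := exists_single t
    rw [quantumSymmetriser_zero, hq, toTensorAlgebra_single]
    simp [h.vac]
  | succ n ih =>
    induction t using TPow_induction with
    | h0 => simp
    | ha s t hs ht => simp only [map_add, LinearMap.add_apply, hs, ht]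
    | hi q s =>
      rw [quantumSymmetriser_glue, ← h.lift_insertion, ih, toTensorAlgebra_glue]
      simp

end IsFock

variable (k V) in
/-- The direct sum of all tensor powers of `V`. -/
abbrev Sh : Type (max u v) := k × DirectSum ℕ (fun n => TPow k V n)

namespace Sh

variable (k V) in
/-- The unit in degree zero. -/
def vac : Sh k V := (1, 0)

variable (V) in
/-- The inclusion of `V^{⊗(n+1)}`. -/
def inj (n : ℕ) : TPow k V n →ₗ[k] Sh k V :=
  LinearMap.inr k k _ ∘ₗ DirectSum.lof k ℕ (fun n => TPow k V n) n

theorem hom_ext {X : Type w} [AddCommGroup X] [Module k X] {f g : Sh k V →ₗ[k] X}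
    (h : f (vac k V) = g (vac k V)) (h' : ∀ n t, f (inj V n t) = g (inj V n t)) : f = g := by
  refine LinearMap.prod_ext (LinearMap.ext_ring h) ?_
  refine DirectSum.linearMap_ext _ fun n => ?_
  ext t
  exact h' n t

/-- Linear maps on `Sh k V` from their values on the homogeneous components. -/
def elim {X : Type w} [AddCommGroup X] [Module k X] (x : X) (f : ∀ n, TPow k V n →ₗ[k] X) :
    Sh k V →ₗ[k] X :=
  LinearMap.coprod (LinearMap.toSpanSingleton k X x) (DirectSum.toModule k ℕ X f)

section
variable {X : Type w} [AddCommGroup X] [Module k X] (x : X) (f : ∀ n, TPow k V n →ₗ[k] X)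

@[simp] theorem elim_vac : elim x f (vac k V) = x := by simp [elim, vac]

@[simp] theorem elim_inj (n : ℕ) (t : TPow k V n) : elim x f (inj V n t) = f n t := by
  simp [elim, inj]
end

/-- Concatenation with an element of `V`. -/
def m : V →ₗ[k] Module.End k (Sh k V) where
  toFun p := elim (inj V 0 (single p)) fun n => inj V (n + 1) ∘ₗ (glue n).toLinearMap ∘ₗ
    TensorProduct.mk k V (TPow k V n) p
  map_add' p q := by
    refine hom_ext ?_ fun n t => ?_
    · rw [LinearMap.add_apply, elim_vac, elim_vac, elim_vac]; simp
    · simp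
  map_smul' r p := by
    refine hom_ext ?_ fun n t => ?_
    · rw [LinearMap.smul_apply, elim_vac, elim_vac]; simp
    · simp

/-- Quantum shuffle multiplication with an element of `V`. -/
def L : V →ₗ[k] Module.End k (Sh k V) where
  toFun p := elim (inj V 0 (single p)) fun n => inj V (n + 1) ∘ₗ (glue n).toLinearMap ∘ₗ
    insertion χ n ∘ₗ TensorProduct.mk k V (TPow k V n) p
  map_add' p q := by
    refine hom_ext ?_ fun n t => ?_
    · rw [LinearMap.add_apply, elim_vac, elim_vac, elim_vac]; simp
    · simp
  map_smul' r p := by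
    refine hom_ext ?_ fun n t => ?_
    · rw [LinearMap.smul_apply, elim_vac, elim_vac]; simp
    · simp

theorem m_vac (p : V) : m p (vac k V) = inj V 0 (single p) := elim_vac _ _
theorem L_vac (p : V) : L χ p (vac k V) = inj V 0 (single p) := elim_vac _ _
theorem m_inj (p : V) (n : ℕ) (t : TPow k V n) :
    m p (inj V n t) = inj V (n + 1) (glue n (p ⊗ₜ[k] t)) := elim_inj _ _ _ _
theorem L_inj (p : V) (n : ℕ) (t : TPow k V n) :
    L χ p (inj V n t) = inj V (n + 1) (glue n (insertion χ n (p ⊗ₜ[k] t))) := elim_inj _ _ _ _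

theorem isFock : IsFock χ m (L χ) (vac k V) where
  vac p := by rw [m_vac, L_vac]
  comm p q := by
    refine hom_ext ?_ fun n t => ?_
    · have key (τ : V ⊗[k] V) :
          TensorProduct.lift ((LinearMap.mul k (Module.End k (Sh k V))).compl₁₂ m (L χ)) τ
            (vac k V) = inj V 1 (glue₀ τ) := by
        induction τ with
        | zero => simp
        | add s t hs ht => simp only [map_add, LinearMap.add_apply, hs, ht]
        | tmul q r =>
          simp only [TensorProduct.lift.tmul, LinearMap.compl₁₂_apply, LinearMap.mul_apply',
            Module.End.mul_apply, L_vac, m_inj, glue_zero_tmul]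
      rw [LinearMap.add_apply, key, Module.End.mul_apply, Module.End.mul_apply, m_vac, L_inj, m_inj,
        glue_insertion_zero, glue_zero_tmul, map_add, map_add]
    · have key (τ : V ⊗[k] V) :
          TensorProduct.lift ((LinearMap.mul k (Module.End k (Sh k V))).compl₁₂ m (L χ)) τ
            (inj V n t) = inj V (n + 2) (glue (n + 1)
              (((glue n).toLinearMap ∘ₗ insertion χ n).lTensor V
                (TensorProduct.assoc k V V (TPow k V n) (τ ⊗ₜ[k] t)))) := by
        induction τ with
        | zero => simp
        | add s t hs ht => simp only [map_add, TensorProduct.add_tmul, LinearMap.add_apply, hs, ht]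
        | tmul q r =>
          simp [L_inj, m_inj]
      rw [LinearMap.add_apply, key, Module.End.mul_apply, Module.End.mul_apply, m_inj, L_inj,
        m_inj, insertion_glue, map_add, map_add]

theorem lift_m_vac (n : ℕ) (t : TPow k V n) :
    TensorAlgebra.lift k m (toTensorAlgebra k V n t) (vac k V) = inj V n t := by
  induction n with
  | zero =>
    obtain ⟨q, hq⟩ := exists_single t
    rw [hq, toTensorAlgebra_single, TensorAlgebra.lift_ι_apply, m_vac]
  | succ n ih =>
    induction t using TPow_induction with
    | h0 => simp
    | ha s t hs ht => simp only [map_add, LinearMap.add_apply, hs, ht]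
    | hi q s =>
      rw [toTensorAlgebra_glue, map_mul, Module.End.mul_apply, ih, TensorAlgebra.lift_ι_apply,
        m_inj]

theorem lift_L_vac (n : ℕ) (t : TPow k V n) :
    TensorAlgebra.lift k (L χ) (toTensorAlgebra k V n t) (vac k V) =
      inj V n (quantumSymmetriser χ n t) := by
  rw [← (isFock χ).lift_quantumSymmetriser, lift_m_vac]

/-- The canonical map to the tensor algebra. -/
def toTA : Sh k V →ₗ[k] TensorAlgebra k V := elim 1 (toTensorAlgebra k V)

theorem ι_mul_toTA (p : V) (w : Sh k V) : TensorAlgebra.ι k p * toTA w = toTA (m p w) := by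
  have : (LinearMap.mulLeft k (TensorAlgebra.ι k p)) ∘ₗ toTA = toTA ∘ₗ m p := by
    refine hom_ext ?_ fun n t => ?_
    · simp only [LinearMap.comp_apply, m_vac, toTA, elim_vac, elim_inj, toTensorAlgebra_single,
        LinearMap.mulLeft_apply, mul_one]
    · simp only [LinearMap.comp_apply, m_inj, toTA, elim_inj, toTensorAlgebra_glue,
        LinearMap.mulLeft_apply]
  exact LinearMap.congr_fun this w

theorem toTA_surjective : Function.Surjective (toTA (k := k) (V := V)) := by
  have key (t : TensorAlgebra k V) : ∀ w : Sh k V, ∃ w', t * toTA w = toTA w' := by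
    induction t using TensorAlgebra.induction with
    | algebraMap r => exact fun w => ⟨r • w, by rw [map_smul, Algebra.smul_def]⟩
    | ι p => exact fun w => ⟨_, ι_mul_toTA p w⟩
    | mul s t hs ht =>
      intro w
      obtain ⟨w', h⟩ := ht w
      obtain ⟨w'', h'⟩ := hs w'
      exact ⟨w'', by rw [mul_assoc, h, h']⟩
    | add s t hs ht =>
      intro w
      obtain ⟨w', h⟩ := ht w
      obtain ⟨w'', h'⟩ := hs w
      exact ⟨w'' + w', by rw [add_mul, h, h', map_add]⟩
  intro t
  obtain ⟨w, h⟩ := key t (vac k V)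
  exact ⟨w, by rw [← h, toTA, elim_vac, mul_one]⟩

end Sh

/-- The canonical map of the tensor algebra onto the Nichols algebra. -/
def mkB : TensorAlgebra k V →ₐ[k] NicholsAlgebra χ := RingQuot.mkAlgHom k (Rel χ)

theorem mkB_ι (p : V) : mkB χ (TensorAlgebra.ι k p) = ι χ p := rfl

theorem mkB_surjective : Function.Surjective (mkB χ) := RingQuot.mkAlgHom_surjective k (Rel χ)

theorem mkB_ker {n : ℕ} {t : TPow k V n} (ht : quantumSymmetriser χ n t = 0) :
    mkB χ (toTensorAlgebra k V n t) = 0 := by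
  rw [← map_zero (mkB χ)]
  exact RingQuot.mkAlgHom_rel k (.ker n t ht)

theorem ι_mul_ι {T : V ⊗[k] V} (hT : T + χ T = 0) :
    TensorProduct.lift ((LinearMap.mul k (NicholsAlgebra χ)).compl₁₂ (ι χ) (ι χ)) T = 0 := by
  have h : mkB χ (toTensorAlgebra k V 1 (glue₀ T)) = 0 := by
    apply mkB_ker
    rw [quantumSymmetriser_one, hT, map_zero]
  rw [← h]
  clear h hT
  induction T with
  | zero => simp
  | tmul p q => rw [toTensorAlgebra_glue₀, map_mul]; rfl
  | add s t hs ht => simp only [map_add, hs, ht]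

variable {χ} in
theorem exists_lift {S : Type w} [Ring S] [Algebra k S] (f : V →ₗ[k] S)
    (hf : ∀ n (t : TPow k V n), quantumSymmetriser χ n t = 0 →
      TensorAlgebra.lift k f (toTensorAlgebra k V n t) = 0) :
    ∃ F : NicholsAlgebra χ →ₐ[k] S, ∀ t, F (mkB χ t) = TensorAlgebra.lift k f t := by
  refine ⟨RingQuot.liftAlgHom k ⟨TensorAlgebra.lift k f, ?_⟩,
    fun t => RingQuot.liftAlgHom_mkAlgHom_apply k _ _ _⟩
  rintro _ _ ⟨n, t, ht⟩
  rw [hf n t ht, map_zero]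

theorem hom_ext {S : Type w} [Ring S] [Algebra k S] {f g : NicholsAlgebra χ →ₐ[k] S}
    (h : ∀ p, f (ι χ p) = g (ι χ p)) : f = g := by
  apply RingQuot.ringQuot_ext' (S := k)
  apply TensorAlgebra.hom_ext
  ext p
  exact h p

/-- The Nichols algebra as a quotient of the span of the vacuum vector under the quantum shuffle
operators. -/
theorem exists_sh_hom : ∃ f : Sh k V →ₗ[k] NicholsAlgebra χ,
    ∀ t, f (TensorAlgebra.lift k (Sh.L χ) t (Sh.vac k V)) = mkB χ t := by
  have h1 (n : ℕ) : ∃ f : TPow k V n →ₗ[k] NicholsAlgebra χ,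
      f ∘ₗ quantumSymmetriser χ n = (mkB χ).toLinearMap ∘ₗ toTensorAlgebra k V n := by
    -- The symmetriser embeds V^{⊗(n+1)} modulo its kernel into V^{⊗(n+1)}. Over a field this
    -- embedding has a linear left inverse, through which the projection to the Nichols algebra
    -- factors.
    obtain ⟨g, hg⟩ := LinearMap.exists_leftInverse_of_injective
      ((LinearMap.ker (quantumSymmetriser χ n)).liftQ (quantumSymmetriser χ n) le_rfl)
      (Submodule.ker_liftQ_eq_bot _ _ _ le_rfl)
    refine ⟨(LinearMap.ker (quantumSymmetriser χ n)).liftQ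
      ((mkB χ).toLinearMap ∘ₗ toTensorAlgebra k V n) (fun t ht => mkB_ker χ ht) ∘ₗ g, ?_⟩
    ext t
    have := LinearMap.congr_fun hg (Submodule.Quotient.mk t)
    simp only [LinearMap.comp_apply, Submodule.liftQ_apply, LinearMap.id_apply] at this ⊢
    rw [this]
    rfl
  choose f hf using h1
  refine ⟨Sh.elim 1 f, fun t => ?_⟩
  obtain ⟨w, rfl⟩ := Sh.toTA_surjective t
  let ev : TensorAlgebra k V →ₗ[k] Sh k V :=
    (LinearMap.applyₗ (Sh.vac k V)) ∘ₗ (TensorAlgebra.lift k (Sh.L χ)).toLinearMap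
  suffices Sh.elim 1 f ∘ₗ ev ∘ₗ Sh.toTA = (mkB χ).toLinearMap ∘ₗ Sh.toTA from
    LinearMap.congr_fun this w
  refine Sh.hom_ext ?_ fun n t => ?_
  · simp [ev, Sh.toTA]
  · simpa [ev, Sh.toTA, Sh.lift_L_vac] using LinearMap.congr_fun (hf n) t

end Nichols

/-! ### Functoriality, and Nichols algebras of sums exchanged by the flip. -/

namespace Nichols

universe u v w

variable {k : Type u} [Field k]

section
variable {V : Type v} [AddCommGroup V] [Module k V] {χ : V ⊗[k] V →ₗ[k] V ⊗[k] V}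

/-- A Fock space representation of `V` defines an algebra homomorphism on the Nichols algebra. -/
theorem IsFock.exists_algHom {X : Type w} [AddCommGroup X] [Module k X]
    {m L : V →ₗ[k] Module.End k X} {vac : X} (h : IsFock χ m L vac) {S : Type*} [Ring S]
    [Algebra k S] (φ : V →ₗ[k] S) (f : X →ₗ[k] S)
    (hf : ∀ t, f (TensorAlgebra.lift k L t vac) = TensorAlgebra.lift k φ t) :
    ∃ F : NicholsAlgebra χ →ₐ[k] S, ∀ p, F (ι χ p) = φ p := by
  obtain ⟨F, hF⟩ := exists_lift φ fun n t ht => by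
    rw [← hf, ← h.lift_quantumSymmetriser, ht, map_zero, map_zero, LinearMap.zero_apply, map_zero]
  exact ⟨F, fun p => by rw [← mkB_ι, hF, TensorAlgebra.lift_ι_apply]⟩

variable (χ) in
-- p ⊗ q - q ⊗ p lies in the kernel of the degree two symmetriser 1 + χ.
theorem ι_mul_ι_comm {p q : V} (h : χ (p ⊗ₜ[k] q) = q ⊗ₜ[k] p) (h' : χ (q ⊗ₜ[k] p) = p ⊗ₜ[k] q) :
    ι χ p * ι χ q = ι χ q * ι χ p := by
  have := ι_mul_ι χ (T := p ⊗ₜ[k] q - q ⊗ₜ[k] p) (by rw [map_sub, h, h']; abel)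
  simpa [sub_eq_zero] using this

/-- A homomorphism of braided vector spaces extends to the Nichols algebras. -/
theorem exists_map {W : Type v} [AddCommGroup W] [Module k W] {ψ : W ⊗[k] W →ₗ[k] W ⊗[k] W}
    (i : V →ₗ[k] W) (hi : ∀ p q, ψ (i p ⊗ₜ[k] i q) = TensorProduct.map i i (χ (p ⊗ₜ[k] q))) :
    ∃ F : NicholsAlgebra χ →ₐ[k] NicholsAlgebra ψ, ∀ p, F (ι χ p) = ι ψ (i p) := by
  -- The Fock space of the target becomes one of the source by restriction along i.
  have h : IsFock χ (Sh.m ∘ₗ i) (Sh.L ψ ∘ₗ i) (Sh.vac k W) := by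
    refine ⟨fun p => (Sh.isFock ψ).vac (i p), fun p q => ?_⟩
    refine ((Sh.isFock ψ).comm (i p) (i q)).trans ?_
    rw [hi]
    congr 1
    induction χ (p ⊗ₜ[k] q) with
    | zero => simp
    | add s t hs ht => rw [map_add, map_add, map_add, hs, ht]
    | tmul p q => simp
  obtain ⟨f, hf⟩ := exists_sh_hom ψ
  refine h.exists_algHom (ι ψ ∘ₗ i) f fun t => ?_
  have h1 : TensorAlgebra.lift k (Sh.L ψ ∘ₗ i) =
      (TensorAlgebra.lift k (Sh.L ψ)).comp (TensorAlgebra.lift k (TensorAlgebra.ι k ∘ₗ i)) := by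
    apply TensorAlgebra.hom_ext
    refine LinearMap.ext fun p => ?_
    simp
  have h2 : TensorAlgebra.lift k (ι ψ ∘ₗ i) =
      (mkB ψ).comp (TensorAlgebra.lift k (TensorAlgebra.ι k ∘ₗ i)) := by
    ext; simp [mkB_ι]
  rw [h1, h2, AlgHom.comp_apply, AlgHom.comp_apply, hf]
end

variable {V V₁ V₂ : Type v} [AddCommGroup V] [Module k V] [AddCommGroup V₁] [Module k V₁]
  [AddCommGroup V₂] [Module k V₂]

/-- The braided vector space `(V, χ)` is the direct sum of `(V₁, χ₁)` and `(V₂, χ₂)`, which are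
exchanged with each other by the flip. -/
structure IsFlipSum (χ : V ⊗[k] V →ₗ[k] V ⊗[k] V) (χ₁ : V₁ ⊗[k] V₁ →ₗ[k] V₁ ⊗[k] V₁)
    (χ₂ : V₂ ⊗[k] V₂ →ₗ[k] V₂ ⊗[k] V₂) (i₁ : V₁ →ₗ[k] V) (i₂ : V₂ →ₗ[k] V) (p₁ : V →ₗ[k] V₁)
    (p₂ : V →ₗ[k] V₂) : Prop where
  p₁_i₁ : ∀ p, p₁ (i₁ p) = p
  p₁_i₂ : ∀ p, p₁ (i₂ p) = 0
  p₂_i₁ : ∀ p, p₂ (i₁ p) = 0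
  p₂_i₂ : ∀ p, p₂ (i₂ p) = p
  eq_add : ∀ p, p = i₁ (p₁ p) + i₂ (p₂ p)
  χ₁₁ : ∀ p q, χ (i₁ p ⊗ₜ[k] i₁ q) = TensorProduct.map i₁ i₁ (χ₁ (p ⊗ₜ[k] q))
  χ₂₂ : ∀ p q, χ (i₂ p ⊗ₜ[k] i₂ q) = TensorProduct.map i₂ i₂ (χ₂ (p ⊗ₜ[k] q))
  χ₁₂ : ∀ p q, χ (i₁ p ⊗ₜ[k] i₂ q) = i₂ q ⊗ₜ[k] i₁ p
  χ₂₁ : ∀ p q, χ (i₂ p ⊗ₜ[k] i₁ q) = i₁ q ⊗ₜ[k] i₂ p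

namespace IsFlipSum

variable {χ : V ⊗[k] V →ₗ[k] V ⊗[k] V} {χ₁ : V₁ ⊗[k] V₁ →ₗ[k] V₁ ⊗[k] V₁}
    {χ₂ : V₂ ⊗[k] V₂ →ₗ[k] V₂ ⊗[k] V₂} {i₁ : V₁ →ₗ[k] V} {i₂ : V₂ →ₗ[k] V} {p₁ : V →ₗ[k] V₁}
    {p₂ : V →ₗ[k] V₂}

/-- The projection onto degree zero. -/
def proj₀ : Module.End k (Sh k V) := Sh.elim (Sh.vac k V) 0

theorem proj₀_vac : proj₀ (Sh.vac k V) = Sh.vac k V := Sh.elim_vac _ _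

theorem proj₀_inj (n : ℕ) (t : TPow k V n) : proj₀ (Sh.inj V n t) = 0 := by simp [proj₀]

theorem proj₀_mul_proj₀ : (proj₀ : Module.End k (Sh k V)) * proj₀ = proj₀ :=
  Sh.hom_ext (by simp [proj₀_vac]) fun n t => by simp [proj₀_inj]

theorem proj₀_mul_m (p : V) : proj₀ * Sh.m p = (0 : Module.End k (Sh k V)) :=
  Sh.hom_ext (by simp [Sh.m_vac, proj₀_inj]) fun n t => by simp [Sh.m_inj, proj₀_inj]

theorem proj₀_mul_L (p : V) : proj₀ * Sh.L χ p = (0 : Module.End k (Sh k V)) :=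
  Sh.hom_ext (by simp [Sh.L_vac, proj₀_inj]) fun n t => by simp [Sh.L_inj, proj₀_inj]

theorem L_mul_proj₀ (p : V) : Sh.L χ p * proj₀ = Sh.m p * proj₀ :=
  Sh.hom_ext (by simp [Sh.L_vac, Sh.m_vac, proj₀_vac]) fun n t => by simp [proj₀_inj]

/-- The tensor product of endomorphisms as a bilinear map. -/
def mapEnd : Module.End k (Sh k V₁) →ₗ[k] Module.End k (Sh k V₂) →ₗ[k]
    Module.End k (Sh k V₁ ⊗[k] Sh k V₂) :=
  TensorProduct.mapBilinear (RingHom.id k) (Sh k V₁) (Sh k V₂) (Sh k V₁) (Sh k V₂)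

/-- Concatenation on the tensor product of two Fock spaces. -/
def m (p₁ : V →ₗ[k] V₁) (p₂ : V →ₗ[k] V₂) : V →ₗ[k] Module.End k (Sh k V₁ ⊗[k] Sh k V₂) :=
  mapEnd.flip 1 ∘ₗ Sh.m ∘ₗ p₁ +
    mapEnd proj₀ ∘ₗ Sh.m ∘ₗ p₂

/-- Quantum shuffle multiplication on the tensor product of two Fock spaces. -/
def L (χ₁ : V₁ ⊗[k] V₁ →ₗ[k] V₁ ⊗[k] V₁) (χ₂ : V₂ ⊗[k] V₂ →ₗ[k] V₂ ⊗[k] V₂)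
    (p₁ : V →ₗ[k] V₁) (p₂ : V →ₗ[k] V₂) : V →ₗ[k] Module.End k (Sh k V₁ ⊗[k] Sh k V₂) :=
  mapEnd.flip 1 ∘ₗ Sh.L χ₁ ∘ₗ p₁ +
    mapEnd 1 ∘ₗ Sh.L χ₂ ∘ₗ p₂

theorem m_apply (p : V) : m p₁ p₂ p = TensorProduct.map (Sh.m (p₁ p)) 1 +
    TensorProduct.map proj₀ (Sh.m (p₂ p)) := rfl

theorem L_apply (p : V) : L χ₁ χ₂ p₁ p₂ p = TensorProduct.map (Sh.L χ₁ (p₁ p)) 1 +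
    TensorProduct.map 1 (Sh.L χ₂ (p₂ p)) := rfl

/-- Pure tensors stand for words with all letters of V₁ before those of V₂. Hence concatenation with
a letter of V₂ is set to zero unless the first factor has degree zero, while the shuffle operators
of the two summands act independently. The mixed rules then follow because projection to degree zero
kills the images of m and L. -/
theorem isFock (h : IsFlipSum χ χ₁ χ₂ i₁ i₂ p₁ p₂) :
    IsFock χ (m p₁ p₂) (L χ₁ χ₂ p₁ p₂) (Sh.vac k V₁ ⊗ₜ[k] Sh.vac k V₂) := by
  have hm₁ (p : V₁) : m p₁ p₂ (i₁ p) = TensorProduct.map (Sh.m p) 1 := by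
    rw [m_apply, h.p₁_i₁, h.p₂_i₁, map_zero, TensorProduct.map_zero_right, add_zero]
  have hm₂ (p : V₂) : m p₁ p₂ (i₂ p) = TensorProduct.map proj₀ (Sh.m p) := by
    rw [m_apply, h.p₁_i₂, h.p₂_i₂, map_zero, TensorProduct.map_zero_left, zero_add]
  have hL₁ (p : V₁) : L χ₁ χ₂ p₁ p₂ (i₁ p) = TensorProduct.map (Sh.L χ₁ p) 1 := by
    rw [L_apply, h.p₁_i₁, h.p₂_i₁, map_zero, TensorProduct.map_zero_right, add_zero]
  have hL₂ (p : V₂) : L χ₁ χ₂ p₁ p₂ (i₂ p) = TensorProduct.map 1 (Sh.L χ₂ p) := by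
    rw [L_apply, h.p₁_i₂, h.p₂_i₂, map_zero, TensorProduct.map_zero_left, zero_add]
  refine ⟨fun p => ?_, fun p q => ?_⟩
  · simp [m_apply, L_apply, Sh.m_vac, Sh.L_vac, proj₀_vac]
  · rw [h.eq_add p, h.eq_add q]
    generalize p₁ p = a, p₂ p = b, p₁ q = c, p₂ q = d
    have k₁₁ : L χ₁ χ₂ p₁ p₂ (i₁ a) * m p₁ p₂ (i₁ c) = m p₁ p₂ (i₁ a) * m p₁ p₂ (i₁ c) +
        TensorProduct.lift ((LinearMap.mul k (Module.End k (Sh k V₁ ⊗[k] Sh k V₂))).compl₁₂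
          (m p₁ p₂) (L χ₁ χ₂ p₁ p₂)) (χ (i₁ a ⊗ₜ[k] i₁ c)) := by
      have key (τ : V₁ ⊗[k] V₁) :
          TensorProduct.lift ((LinearMap.mul k (Module.End k (Sh k V₁ ⊗[k] Sh k V₂))).compl₁₂
            (m p₁ p₂) (L χ₁ χ₂ p₁ p₂)) (TensorProduct.map i₁ i₁ τ) =
          TensorProduct.map (TensorProduct.lift ((LinearMap.mul k (Module.End k (Sh k V₁))).compl₁₂
            Sh.m (Sh.L χ₁)) τ) (1 : Module.End k (Sh k V₂)) := by
        induction τ with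
        | zero => simp
        | add s t hs ht => simp only [map_add, hs, ht, TensorProduct.map_add_left]
        | tmul p q => simp [hm₁, hL₁, ← TensorProduct.map_mul]
      rw [h.χ₁₁, key, hm₁, hL₁, hm₁, ← TensorProduct.map_mul, ← TensorProduct.map_mul, mul_one,
        ← TensorProduct.map_add_left, (Sh.isFock χ₁).comm]
    have k₂₂ : L χ₁ χ₂ p₁ p₂ (i₂ b) * m p₁ p₂ (i₂ d) = m p₁ p₂ (i₂ b) * m p₁ p₂ (i₂ d) +
        TensorProduct.lift ((LinearMap.mul k (Module.End k (Sh k V₁ ⊗[k] Sh k V₂))).compl₁₂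
          (m p₁ p₂) (L χ₁ χ₂ p₁ p₂)) (χ (i₂ b ⊗ₜ[k] i₂ d)) := by
      have key (τ : V₂ ⊗[k] V₂) :
          TensorProduct.lift ((LinearMap.mul k (Module.End k (Sh k V₁ ⊗[k] Sh k V₂))).compl₁₂
            (m p₁ p₂) (L χ₁ χ₂ p₁ p₂)) (TensorProduct.map i₂ i₂ τ) =
          TensorProduct.map (proj₀ : Module.End k (Sh k V₁))
            (TensorProduct.lift ((LinearMap.mul k (Module.End k (Sh k V₂))).compl₁₂
            Sh.m (Sh.L χ₂)) τ) := by
        induction τ with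
        | zero => simp
        | add s t hs ht => simp only [map_add, hs, ht, TensorProduct.map_add_right]
        | tmul p q => simp [hm₂, hL₂, ← TensorProduct.map_mul]
      rw [h.χ₂₂, key, hm₂, hL₂, hm₂, ← TensorProduct.map_mul, ← TensorProduct.map_mul, one_mul,
        proj₀_mul_proj₀, ← TensorProduct.map_add_right, (Sh.isFock χ₂).comm]
    have k₁₂ : L χ₁ χ₂ p₁ p₂ (i₁ a) * m p₁ p₂ (i₂ d) = m p₁ p₂ (i₁ a) * m p₁ p₂ (i₂ d) +
        TensorProduct.lift ((LinearMap.mul k (Module.End k (Sh k V₁ ⊗[k] Sh k V₂))).compl₁₂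
          (m p₁ p₂) (L χ₁ χ₂ p₁ p₂)) (χ (i₁ a ⊗ₜ[k] i₂ d)) := by
      rw [h.χ₁₂, TensorProduct.lift.tmul, LinearMap.compl₁₂_apply, LinearMap.mul_apply', hm₁, hm₂,
        hL₁, ← TensorProduct.map_mul, ← TensorProduct.map_mul, ← TensorProduct.map_mul,
        proj₀_mul_L, L_mul_proj₀, TensorProduct.map_zero_left, add_zero]
    have k₂₁ : L χ₁ χ₂ p₁ p₂ (i₂ b) * m p₁ p₂ (i₁ c) = m p₁ p₂ (i₂ b) * m p₁ p₂ (i₁ c) +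
        TensorProduct.lift ((LinearMap.mul k (Module.End k (Sh k V₁ ⊗[k] Sh k V₂))).compl₁₂
          (m p₁ p₂) (L χ₁ χ₂ p₁ p₂)) (χ (i₂ b ⊗ₜ[k] i₁ c)) := by
      rw [h.χ₂₁, TensorProduct.lift.tmul, LinearMap.compl₁₂_apply, LinearMap.mul_apply', hm₁, hm₂,
        hL₂, ← TensorProduct.map_mul, ← TensorProduct.map_mul, ← TensorProduct.map_mul,
        proj₀_mul_m, TensorProduct.map_zero_left, zero_add, one_mul, mul_one, one_mul, mul_one]
    simp only [map_add, TensorProduct.add_tmul, TensorProduct.tmul_add, mul_add, add_mul, k₁₁, k₁₂,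
      k₂₁, k₂₂]
    abel

/-- The operators L on the product Fock space are L₁ ⊗ 1 + 1 ⊗ L₂, so the L-word of t on the vacuum
factors through T(V₁) ⊗ T(V₂). There `exists_sh_hom` applies to each factor. -/
theorem exists_toTensor (h : IsFlipSum χ χ₁ χ₂ i₁ i₂ p₁ p₂) :
    ∃ F : NicholsAlgebra χ →ₐ[k] NicholsAlgebra χ₁ ⊗[k] NicholsAlgebra χ₂,
      ∀ p, F (ι χ p) = ι χ₁ (p₁ p) ⊗ₜ[k] 1 + 1 ⊗ₜ[k] ι χ₂ (p₂ p) := by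
  obtain ⟨f₁, hf₁⟩ := exists_sh_hom χ₁
  obtain ⟨f₂, hf₂⟩ := exists_sh_hom χ₂
  let φ : V →ₗ[k] NicholsAlgebra χ₁ ⊗[k] NicholsAlgebra χ₂ :=
    Algebra.TensorProduct.includeLeft.toLinearMap ∘ₗ ι χ₁ ∘ₗ p₁ +
      Algebra.TensorProduct.includeRight.toLinearMap ∘ₗ ι χ₂ ∘ₗ p₂
  let Δ : TensorAlgebra k V →ₐ[k] TensorAlgebra k V₁ ⊗[k] TensorAlgebra k V₂ :=
    TensorAlgebra.lift k (Algebra.TensorProduct.includeLeft.toLinearMap ∘ₗ TensorAlgebra.ι k ∘ₗ p₁ +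
      Algebra.TensorProduct.includeRight.toLinearMap ∘ₗ TensorAlgebra.ι k ∘ₗ p₂)
  refine h.isFock.exists_algHom φ (TensorProduct.map f₁ f₂) fun t => ?_
  have h1 : TensorAlgebra.lift k φ = (Algebra.TensorProduct.map (mkB χ₁) (mkB χ₂)).comp Δ := by
    ext p
    simp [φ, Δ, mkB_ι]
  have h2 : TensorAlgebra.lift k (L χ₁ χ₂ p₁ p₂) =
      ((Module.endTensorEndAlgHom (R := k) (S := k) (A := k) (M := Sh k V₁) (N := Sh k V₂)).comp
        (Algebra.TensorProduct.map (TensorAlgebra.lift k (Sh.L χ₁))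
          (TensorAlgebra.lift k (Sh.L χ₂)))).comp Δ := by
    apply TensorAlgebra.hom_ext
    refine LinearMap.ext fun p => ?_
    simp [Δ, L_apply, Module.endTensorEndAlgHom_apply]
    rfl
  rw [h1, h2, AlgHom.comp_apply, AlgHom.comp_apply, AlgHom.comp_apply]
  induction Δ t with
  | zero => simp
  | add s t hs ht => simp only [map_add, LinearMap.add_apply, hs, ht]
  | tmul s t =>
    simp [Module.endTensorEndAlgHom_apply, hf₁, hf₂]

/-- The Nichols algebra of a direct sum. -/
theorem exists_algEquiv (h : IsFlipSum χ χ₁ χ₂ i₁ i₂ p₁ p₂) :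
    ∃ Φ : NicholsAlgebra χ₁ ⊗[k] NicholsAlgebra χ₂ ≃ₐ[k] NicholsAlgebra χ,
      (∀ p, Φ (ι χ₁ p ⊗ₜ[k] 1) = ι χ (i₁ p)) ∧ (∀ p, Φ (1 ⊗ₜ[k] ι χ₂ p) = ι χ (i₂ p)) := by
  obtain ⟨G, hG⟩ := h.exists_toTensor
  obtain ⟨F₁, hF₁⟩ := exists_map i₁ h.χ₁₁
  obtain ⟨F₂, hF₂⟩ := exists_map i₂ h.χ₂₂
  -- Commutation of the two images need only be checked on generators, where it is the flip.
  have hc (s : NicholsAlgebra χ₁) (t : NicholsAlgebra χ₂) : Commute (F₁ s) (F₂ t) := by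
    obtain ⟨s, rfl⟩ := mkB_surjective χ₁ s
    obtain ⟨t, rfl⟩ := mkB_surjective χ₂ t
    induction s using TensorAlgebra.induction with
    | algebraMap r => simpa using Algebra.commute_algebraMap_left _ _
    | mul s s' hs hs' => rw [map_mul, map_mul]; exact hs.mul_left hs'
    | add s s' hs hs' => rw [map_add, map_add]; exact hs.add_left hs'
    | ι p =>
      induction t using TensorAlgebra.induction with
      | algebraMap r => simpa using Algebra.commute_algebraMap_right _ _
      | mul s s' hs hs' => rw [map_mul, map_mul]; exact hs.mul_right hs'
      | add s s' hs hs' => rw [map_add, map_add]; exact hs.add_right hs'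
      | ι q =>
        rw [mkB_ι, mkB_ι, hF₁, hF₂]
        exact ι_mul_ι_comm χ (h.χ₁₂ p q) (h.χ₂₁ q p)
  refine ⟨AlgEquiv.ofAlgHom (Algebra.TensorProduct.lift F₁ F₂ hc) G ?_ ?_, fun p => ?_, fun p => ?_⟩
  · apply hom_ext
    intro p
    rw [AlgHom.comp_apply, hG, map_add, Algebra.TensorProduct.lift_tmul,
      Algebra.TensorProduct.lift_tmul, hF₁, hF₂, map_one, map_one, mul_one, one_mul, ← map_add,
      ← h.eq_add, AlgHom.id_apply]
  · apply Algebra.TensorProduct.ext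
    · apply hom_ext
      intro p
      simp [hG, hF₁, h.p₁_i₁, h.p₂_i₁]
    · apply hom_ext
      intro p
      simp [hG, hF₂, h.p₁_i₂, h.p₂_i₂]
  · simp [hF₁]
  · simp [hF₂]

end IsFlipSum

end Nichols

/-! ### Splitting the Nichols algebra of `Ã` into its three factors. -/

namespace SkewPrim

universe u v

variable {k : Type u} [Field k] {H : Type v} [Ring H] [HopfAlgebra k H]

/-- The projection of `V(H)` onto `V_g(H)`. -/
def comp (g : GroupLike k H) : V k H →ₗ[k] VG k g :=
  DirectSum.component k (GroupLike k H) (fun g => VG k g) g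

theorem comp_incl (g : GroupLike k H) (p : VG k g) : comp g (incl g p) = p := by
  classical
  exact DirectSum.component.lof_self k (M := fun g : GroupLike k H => VG k g) g p

theorem comp_incl_of_ne {g h : GroupLike k H} (hgh : g ≠ h) (p : VG k h) :
    comp g (incl h p) = 0 := by
  classical
  refine (DirectSum.component.of k (M := fun g : GroupLike k H => VG k g) g h p).trans ?_
  rw [dif_neg hgh.symm]

end SkewPrim

namespace NodalCubic

open Atilde SkewPrim Nichols

namespace Model

universe u
variable {k : Type u} [Field k]

variable (k) in
/-- The inclusion of `V_1 ⊕ V_a`. -/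
def incl₁ₐ : V1 k × Va k →ₗ[k] VAll k := (incl 1).coprod (incl (ga k))

variable (k) in
/-- The projection onto `V_1 ⊕ V_a`. -/
def comp₁ₐ : VAll k →ₗ[k] V1 k × Va k := (comp 1).prod (comp (ga k))

variable (k) in
/-- The braiding of `V_1 ⊕ V_a`. -/
def braiding₁ₐ : (V1 k × Va k) ⊗[k] (V1 k × Va k) →ₗ[k] (V1 k × Va k) ⊗[k] (V1 k × Va k) :=
  TensorProduct.map (comp₁ₐ k) (comp₁ₐ k) ∘ₗ braiding k (Atilde k) ∘ₗ
    TensorProduct.map (incl₁ₐ k) (incl₁ₐ k)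

theorem comp₁ₐ_incl_one (p : V1 k) : comp₁ₐ k (incl 1 p) = (p, 0) := by
  simp [comp₁ₐ, comp_incl, comp_incl_of_ne ga_ne_one]

theorem comp₁ₐ_incl_a (p : Va k) : comp₁ₐ k (incl (ga k) p) = (0, p) := by
  simp [comp₁ₐ, comp_incl, comp_incl_of_ne ga_ne_one.symm]

theorem comp₁ₐ_incl_b (p : Vb k) : comp₁ₐ k (incl (gb k) p) = 0 := by
  simp [comp₁ₐ, comp_incl_of_ne gb_ne_one.symm, comp_incl_of_ne ga_ne_gb]

theorem incl₁ₐ_inl (p : V1 k) : incl₁ₐ k (LinearMap.inl k _ _ p) = incl 1 p := by simp [incl₁ₐ]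

theorem incl₁ₐ_inr (p : Va k) : incl₁ₐ k (LinearMap.inr k _ _ p) = incl (ga k) p := by
  simp [incl₁ₐ]

theorem isFlipSum₁ₐ : IsFlipSum (braiding₁ₐ k) (braidingVG 1) (braidingVG (ga k))
    (LinearMap.inl k (V1 k) (Va k)) (LinearMap.inr k (V1 k) (Va k)) (LinearMap.fst k (V1 k) (Va k))
    (LinearMap.snd k (V1 k) (Va k)) where
  p₁_i₁ p := rfl
  p₁_i₂ p := rfl
  p₂_i₁ p := rfl
  p₂_i₂ p := rfl
  eq_add p := by simp
  χ₁₁ p q := by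
    rw [braiding₁ₐ, LinearMap.comp_apply, LinearMap.comp_apply, TensorProduct.map_tmul, incl₁ₐ_inl,
      incl₁ₐ_inl, braiding_incl_incl, ← LinearMap.comp_apply, ← TensorProduct.map_comp,
      show comp₁ₐ k ∘ₗ incl 1 = LinearMap.inl k _ _ from LinearMap.ext comp₁ₐ_incl_one]
  χ₂₂ p q := by
    rw [braiding₁ₐ, LinearMap.comp_apply, LinearMap.comp_apply, TensorProduct.map_tmul, incl₁ₐ_inr,
      incl₁ₐ_inr, braiding_incl_incl, ← LinearMap.comp_apply, ← TensorProduct.map_comp,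
      show comp₁ₐ k ∘ₗ incl (ga k) = LinearMap.inr k _ _ from LinearMap.ext comp₁ₐ_incl_a]
  χ₁₂ p q := by
    rw [braiding₁ₐ, LinearMap.comp_apply, LinearMap.comp_apply, TensorProduct.map_tmul, incl₁ₐ_inl,
      incl₁ₐ_inr, braiding_of_ne ga_ne_one.symm, TensorProduct.map_tmul, comp₁ₐ_incl_one,
      comp₁ₐ_incl_a]
    rfl
  χ₂₁ p q := by
    rw [braiding₁ₐ, LinearMap.comp_apply, LinearMap.comp_apply, TensorProduct.map_tmul, incl₁ₐ_inl,
      incl₁ₐ_inr, braiding_of_ne ga_ne_one, TensorProduct.map_tmul, comp₁ₐ_incl_one,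
      comp₁ₐ_incl_a]
    rfl

theorem eq_incl_add (p : VAll k) : p = incl₁ₐ k (comp₁ₐ k p) + incl (gb k) (comp (gb k) p) := by
  induction p using V_induction with
  | h0 => simp
  | ha p q hp hq =>
    rw [map_add, map_add, map_add, map_add]
    conv_lhs => rw [hp, hq]
    abel
  | hi g p =>
    by_cases h1 : g = 1
    · subst h1
      rw [comp₁ₐ_incl_one, comp_incl_of_ne gb_ne_one]
      simp [incl₁ₐ]
    by_cases ha : g = ga k
    · subst ha
      rw [comp₁ₐ_incl_a, comp_incl_of_ne ga_ne_gb.symm]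
      simp [incl₁ₐ]
    by_cases hb : g = gb k
    · subst hb
      rw [comp₁ₐ_incl_b, comp_incl]
      simp
    have := subsingleton_VG h1 ha hb
    rw [Subsingleton.elim p 0]
    simp

theorem isFlipSum : IsFlipSum (braiding k (Atilde k)) (braiding₁ₐ k) (braidingVG (gb k))
    (incl₁ₐ k) (incl (gb k)) (comp₁ₐ k) (comp (gb k)) where
  p₁_i₁ p := by simp [incl₁ₐ, comp₁ₐ_incl_one, comp₁ₐ_incl_a]
  p₁_i₂ p := comp₁ₐ_incl_b p
  p₂_i₁ p := by simp [incl₁ₐ, comp_incl_of_ne gb_ne_one, comp_incl_of_ne ga_ne_gb.symm]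
  p₂_i₂ p := comp_incl _ p
  eq_add p := eq_incl_add p
  χ₁₁ p q := by
    have e (p : V1 k × Va k) : p = LinearMap.inl k _ _ p.1 + LinearMap.inr k _ _ p.2 := by simp
    rw [e p, e q]
    generalize p.1 = a, p.2 = b, q.1 = c, q.2 = d
    simp only [map_add, TensorProduct.add_tmul, TensorProduct.tmul_add]
    have h1 := isFlipSum₁ₐ (k := k)
    have c1 : incl₁ₐ k ∘ₗ LinearMap.inl k _ _ = incl 1 := LinearMap.ext incl₁ₐ_inl
    have c2 : incl₁ₐ k ∘ₗ LinearMap.inr k _ _ = incl (ga k) := LinearMap.ext incl₁ₐ_inr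
    rw [h1.χ₁₁, h1.χ₂₂, h1.χ₁₂, h1.χ₂₁, ← LinearMap.comp_apply (TensorProduct.map _ _),
      ← LinearMap.comp_apply (TensorProduct.map _ _), ← TensorProduct.map_comp,
      ← TensorProduct.map_comp, c1, c2, TensorProduct.map_tmul, TensorProduct.map_tmul]
    simp only [incl₁ₐ_inl, incl₁ₐ_inr]
    rw [braiding_incl_incl, braiding_incl_incl, braiding_of_ne ga_ne_one,
      braiding_of_ne ga_ne_one.symm]
  χ₂₂ p q := braiding_incl_incl _ p q
  χ₁₂ p q := by
    rw [incl₁ₐ, LinearMap.coprod_apply, TensorProduct.add_tmul, TensorProduct.tmul_add, map_add,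
      braiding_of_ne gb_ne_one.symm, braiding_of_ne ga_ne_gb]
  χ₂₁ p q := by
    rw [incl₁ₐ, LinearMap.coprod_apply, TensorProduct.add_tmul, TensorProduct.tmul_add, map_add,
      braiding_of_ne gb_ne_one, braiding_of_ne ga_ne_gb.symm]

theorem exists_tensor_algEquiv : ∃ Φ : (B1 k ⊗[k] Ba k) ⊗[k] Bb k ≃ₐ[k] BAll k,
    (∀ p, Φ ((j1 k p ⊗ₜ[k] 1) ⊗ₜ[k] 1) = jAll k (incl _ p)) ∧
    (∀ p, Φ ((1 ⊗ₜ[k] ja k p) ⊗ₜ[k] 1) = jAll k (incl _ p)) ∧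
    (∀ p, Φ ((1 ⊗ₜ[k] 1) ⊗ₜ[k] jb k p) = jAll k (incl _ p)) := by
  obtain ⟨Φ, h1, h2⟩ := (isFlipSum₁ₐ (k := k)).exists_algEquiv
  obtain ⟨Ψ, h3, h4⟩ := (isFlipSum (k := k)).exists_algEquiv
  refine ⟨(Algebra.TensorProduct.congr Φ AlgEquiv.refl).trans Ψ, fun p => ?_, fun p => ?_,
    fun p => ?_⟩
  · rw [AlgEquiv.trans_apply, Algebra.TensorProduct.congr_apply, Algebra.TensorProduct.map_tmul]
    simp [h1, h3, incl₁ₐ]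
  · rw [AlgEquiv.trans_apply, Algebra.TensorProduct.congr_apply, Algebra.TensorProduct.map_tmul]
    simp [h2, h3, incl₁ₐ]
  · rw [AlgEquiv.trans_apply, Algebra.TensorProduct.congr_apply, Algebra.TensorProduct.map_tmul]
    simp [h4, ← Algebra.TensorProduct.one_def]

end Model
end NodalCubic

namespace NodalCubic

open Atilde SkewPrim Nichols

namespace Model

universe u
variable {k : Type u} [Field k]

/-! ### A nine-dimensional module with skew derivations -/

variable (k) in
/-- The regular representation of `B(V_a)`. -/
abbrev Reg : Type u := Fin 9 → k

namespace Reg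

variable (k) in
/-- Left multiplication by `u`. -/
def Lu : Module.End k (Reg k) where
  toFun f := ![0, f 0, 0, f 1 - f 2, 0, -f 2, -f 5, -f 4 - f 5, f 7 - f 6]
  map_add' f g := by ext i; fin_cases i <;> simp <;> ring
  map_smul' r f := by ext i; fin_cases i <;> simp <;> ring

variable (k) in
/-- Left multiplication by `v`. -/
def Lv : Module.End k (Reg k) where
  toFun f := ![0, 0, f 0, 0, f 1, f 2, -f 3, f 4, f 6]
  map_add' f g := by ext i; fin_cases i <;> simp <;> ring
  map_smul' r f := by ext i; fin_cases i <;> simp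

variable (k) in
/-- The skew derivation dual to `u`. -/
def Du : Module.End k (Reg k) where
  toFun f := ![f 1, f 3, -f 5, 0, f 6 - f 7, -f 7, -f 8, 0, 0]
  map_add' f g := by ext i; fin_cases i <;> simp <;> ring
  map_smul' r f := by ext i; fin_cases i <;> simp <;> ring

variable (k) in
/-- The skew derivation dual to `v`. -/
def Dv : Module.End k (Reg k) where
  toFun f := ![f 2, f 3 + f 4, f 4, -f 6, 0, -f 7, 0, f 8, 0]
  map_add' f g := by ext i; fin_cases i <;> simp <;> ring
  map_smul' r f := by ext i; fin_cases i <;> simp <;> ring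

theorem Lu_apply (f : Reg k) :
    Lu k f = ![0, f 0, 0, f 1 - f 2, 0, -f 2, -f 5, -f 4 - f 5, f 7 - f 6] := rfl
theorem Lv_apply (f : Reg k) : Lv k f = ![0, 0, f 0, 0, f 1, f 2, -f 3, f 4, f 6] := rfl
theorem Du_apply (f : Reg k) : Du k f = ![f 1, f 3, -f 5, 0, f 6 - f 7, -f 7, -f 8, 0, 0] := rfl
theorem Dv_apply (f : Reg k) : Dv k f = ![f 2, f 3 + f 4, f 4, -f 6, 0, -f 7, 0, f 8, 0] := rfl

theorem Lu_pow : Lu k ^ 3 = 0 := by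
  ext f i; fin_cases i <;> simp [pow_succ, Lu_apply]

theorem Lv_pow : Lv k ^ 3 = 0 := by
  ext f i; fin_cases i <;> simp [pow_succ, Lv_apply]

theorem uuv : Lu k ^ 2 * Lv k + Lu k * Lv k * Lu k + Lv k * Lu k ^ 2 = 0 := by
  refine LinearMap.ext fun f => ?_
  ext i; fin_cases i <;> simp [pow_succ, Lu_apply, Lv_apply] <;> ring

theorem uv : Lu k ^ 2 + Lu k * Lv k + Lv k ^ 2 = 0 := by
  refine LinearMap.ext fun f => ?_
  ext i; fin_cases i <;> simp [pow_succ, Lu_apply, Lv_apply] <;> ring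

/-- These four rules come from χ(p ⊗ u) = v ⊗ p and χ(p ⊗ v) = -u ⊗ p - v ⊗ p. Inserting p into u ⊗
s + v ⊗ t contributes -(p inserted in t) after the first letter u and (p inserted in s - t) after
the first letter v. -/
theorem Du_Lu (f : Reg k) : Du k (Lu k f) = f - Lu k (Dv k f) := by
  ext i; fin_cases i <;> simp [Lu_apply, Du_apply, Dv_apply] <;> ring

theorem Du_Lv (f : Reg k) : Du k (Lv k f) = - Lv k (Dv k f) := by
  ext i; fin_cases i <;> simp [Lv_apply, Du_apply, Dv_apply] <;> ring

theorem Dv_Lu (f : Reg k) : Dv k (Lu k f) = Lu k (Du k f - Dv k f) := by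
  ext i; fin_cases i <;> simp [Lu_apply, Du_apply, Dv_apply] <;> ring

theorem Dv_Lv (f : Reg k) : Dv k (Lv k f) = f + Lv k (Du k f - Dv k f) := by
  ext i; fin_cases i <;> simp [Lv_apply, Du_apply, Dv_apply] <;> ring

/-- The degrees of the basis vectors. -/
def deg : Fin 9 → ℕ := ![0, 1, 1, 2, 2, 2, 3, 3, 4]

variable (k) in
/-- The homogeneous elements of degree `d`. -/
def Homog (d : ℕ) (f : Reg k) : Prop := ∀ i, deg i ≠ d → f i = 0

theorem Homog.forall {d : ℕ} {f : Reg k} (h : Homog k d f) :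
    (0 ≠ d → f 0 = 0) ∧ (1 ≠ d → f 1 = 0) ∧ (1 ≠ d → f 2 = 0) ∧ (2 ≠ d → f 3 = 0) ∧
      (2 ≠ d → f 4 = 0) ∧ (2 ≠ d → f 5 = 0) ∧ (3 ≠ d → f 6 = 0) ∧ (3 ≠ d → f 7 = 0) ∧
      (4 ≠ d → f 8 = 0) :=
  ⟨h 0, h 1, h 2, h 3, h 4, h 5, h 6, h 7, h 8⟩

theorem Homog.Lu {d : ℕ} {f : Reg k} (h : Homog k d f) : Homog k (d + 1) (Lu k f) := by
  obtain ⟨h0, h1, h2, h3, h4, h5, h6, h7, h8⟩ := h.forall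
  intro i
  fin_cases i <;> simp [deg, Lu_apply] <;> grind

theorem Homog.Lv {d : ℕ} {f : Reg k} (h : Homog k d f) : Homog k (d + 1) (Lv k f) := by
  obtain ⟨h0, h1, h2, h3, h4, h5, h6, h7, h8⟩ := h.forall
  intro i
  fin_cases i <;> simp [deg, Lv_apply] <;> grind

theorem Homog.Du {d : ℕ} {f : Reg k} (h : Homog k (d + 1) f) : Homog k d (Du k f) := by
  obtain ⟨h0, h1, h2, h3, h4, h5, h6, h7, h8⟩ := h.forall
  intro i
  fin_cases i <;> simp [deg, Du_apply] <;> grind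

theorem Homog.Dv {d : ℕ} {f : Reg k} (h : Homog k (d + 1) f) : Homog k d (Dv k f) := by
  obtain ⟨h0, h1, h2, h3, h4, h5, h6, h7, h8⟩ := h.forall
  intro i
  fin_cases i <;> simp [deg, Dv_apply] <;> grind

/-- Only constants are annihilated by both derivations, the property that characterises Nichols
algebras among graded quotients. -/
theorem eq_zero_of_derivations {f : Reg k} (h0 : f 0 = 0) (hu : Du k f = 0) (hv : Dv k f = 0) :
    f = 0 := by
  have e := fun i => congrFun hu i
  have e' := fun i => congrFun hv i
  have h1 := e 0
  have h3 := e 1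
  have h5 := e 2
  have h6 := e 4
  have h7 := e 5
  have h8 := e 6
  have h2 := e' 0
  have h4 := e' 2
  simp [Du_apply, Dv_apply] at h1 h2 h3 h4 h5 h6 h7 h8
  rw [h7, sub_zero] at h6
  ext i
  fin_cases i <;> simp [*]

variable (k) in
/-- The vacuum vector. -/
def e0 : Reg k := Pi.single 0 1

theorem homog_e0 : Homog k 0 (e0 k) := by
  intro i
  fin_cases i <;> simp [deg, e0]

variable (k) in
/-- A basis `u, v` of `V_a`. -/
def basisA : Module.Basis (Fin 2) k (Va k) := (exists_basis_a (k := k)).choose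

theorem basisA_zero : basisA k 0 = u k := (exists_basis_a (k := k)).choose_spec.1
theorem basisA_one : basisA k 1 = v k := (exists_basis_a (k := k)).choose_spec.2

variable (k) in
/-- The coordinate of `u`. -/
def cu : Va k →ₗ[k] k := (basisA k).coord 0

variable (k) in
/-- The coordinate of `v`. -/
def cv : Va k →ₗ[k] k := (basisA k).coord 1

@[simp] theorem cu_u : cu k (u k) = 1 := by simp [cu, ← basisA_zero]
@[simp] theorem cv_u : cv k (u k) = 0 := by simp [cv, ← basisA_zero]
@[simp] theorem cu_v : cu k (v k) = 0 := by simp [cu, ← basisA_one]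
@[simp] theorem cv_v : cv k (v k) = 1 := by simp [cv, ← basisA_one]

theorem eq_uv (p : Va k) : p = cu k p • u k + cv k p • v k := by
  obtain ⟨r, s, rfl⟩ := span_uv p
  simp

/-- The linear map on `V_a` with prescribed values at `u` and `v`. -/
def ofUV {X : Type*} [AddCommGroup X] [Module k X] (s t : X) : Va k →ₗ[k] X :=
  (cu k).smulRight s + (cv k).smulRight t

section
variable {X : Type*} [AddCommGroup X] [Module k X] (s t : X)

theorem ofUV_apply (p : Va k) : ofUV s t p = cu k p • s + cv k p • t := rfl
@[simp] theorem ofUV_u : ofUV s t (u k) = s := by simp [ofUV_apply]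
@[simp] theorem ofUV_v : ofUV s t (v k) = t := by simp [ofUV_apply]
end

variable (k) in
/-- Left multiplication by an element of `V_a`. -/
def L : Va k →ₗ[k] Module.End k (Reg k) := ofUV (Lu k) (Lv k)

theorem Du_L (p : Va k) (f : Reg k) : Du k (L k p f) = cu k p • f - L k p (Dv k f) := by
  simp only [L, ofUV_apply, LinearMap.add_apply, LinearMap.smul_apply, map_add, map_smul, Du_Lu,
    Du_Lv]
  module

theorem Dv_L (p : Va k) (f : Reg k) :
    Dv k (L k p f) = cv k p • f + L k p (Du k f - Dv k f) := by
  simp only [L, ofUV_apply, LinearMap.add_apply, LinearMap.smul_apply, map_add, map_smul, Dv_Lu,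
    Dv_Lv]
  module

theorem Homog.L {d : ℕ} {f : Reg k} (h : Homog k d f) (p : Va k) : Homog k (d + 1) (L k p f) := by
  intro i hi
  simp [Reg.L, ofUV_apply, h.Lu i hi, h.Lv i hi]

variable (k) in
/-- The embedding of the regular representation into the tensor powers of `V_a`. -/
def θ : (n : ℕ) → (Reg k →ₗ[k] TPow k (Va k) n)
  | 0 => single.toLinearMap ∘ₗ
      ((LinearMap.proj 0 ∘ₗ Du k).smulRight (u k) + (LinearMap.proj 0 ∘ₗ Dv k).smulRight (v k))
  | n + 1 => (glue n).toLinearMap ∘ₗ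
      (TensorProduct.mk k (Va k) (TPow k (Va k) n) (u k) ∘ₗ θ n ∘ₗ Du k +
        TensorProduct.mk k (Va k) (TPow k (Va k) n) (v k) ∘ₗ θ n ∘ₗ Dv k)

theorem θ_zero (f : Reg k) : θ k 0 f = single (f 1 • u k + f 2 • v k) := rfl

theorem θ_succ (n : ℕ) (f : Reg k) :
    θ k (n + 1) f = glue n (u k ⊗ₜ[k] θ k n (Du k f) + v k ⊗ₜ[k] θ k n (Dv k f)) := rfl

theorem braidingVG_u (p : Va k) : braidingVG (ga k) (p ⊗ₜ[k] u k) = v k ⊗ₜ[k] p := by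
  rw [braidingVG_tmul, conjV_u]

theorem braidingVG_v (p : Va k) :
    braidingVG (ga k) (p ⊗ₜ[k] v k) = - (u k ⊗ₜ[k] p) - v k ⊗ₜ[k] p := by
  rw [braidingVG_tmul, conjV_v, TensorProduct.sub_tmul, TensorProduct.neg_tmul]

theorem θ_zero_L (p : Va k) (f : Reg k) : θ k 0 (L k p f) = single (f 0 • p) := by
  rw [θ_zero]
  congr 1
  conv_rhs => rw [eq_uv p]
  simp [L, ofUV_apply, Lu_apply, Lv_apply, mul_smul, smul_comm (f 0)]

theorem tmul_eq_uv {X : Type u} [AddCommGroup X] [Module k X] (p : Va k) (t : X) :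
    p ⊗ₜ[k] t = cu k p • (u k ⊗ₜ[k] t) + cv k p • (v k ⊗ₜ[k] t) := by
  conv_lhs => rw [eq_uv p]
  rw [TensorProduct.add_tmul, TensorProduct.smul_tmul', TensorProduct.smul_tmul']

/-- `θ` splits off the first letter by the two derivations. Under it, `Du_L` and `Dv_L` are the u-
and v-components of the recursion of `insertion`. -/
theorem insertion_θ (n : ℕ) (p : Va k) (f : Reg k) :
    glue n (insertion (braidingVG (ga k)) n (p ⊗ₜ[k] θ k n f)) = θ k (n + 1) (L k p f) := by
  induction n generalizing f with
  | zero =>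
    have e1 : θ k 0 (cu k p • f - L k p (Dv k f)) =
        single (cu k p • (f 1 • u k + f 2 • v k) - Dv k f 0 • p) := by
      rw [map_sub, θ_zero_L, map_smul, θ_zero]
      simp only [map_smul, map_add, map_sub]
    have e2 : θ k 0 (cv k p • f + L k p (Du k f - Dv k f)) =
        single (cv k p • (f 1 • u k + f 2 • v k) + (Du k f - Dv k f) 0 • p) := by
      rw [map_add (θ k 0), θ_zero_L, map_smul, θ_zero]
      simp only [map_smul, map_add]
    rw [θ_succ, Du_L, Dv_L, e1, e2, θ_zero, glue_insertion_zero, map_add (glue 0), glue_zero_tmul,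
      glue_zero_tmul, ← map_add glue₀]
    congr 1
    simp only [TensorProduct.tmul_add, TensorProduct.tmul_smul, TensorProduct.tmul_sub, map_add,
      map_smul, braidingVG_u, braidingVG_v]
    rw [tmul_eq_uv p (u k), tmul_eq_uv p (v k)]
    simp [Du_apply, Dv_apply]
    module
  | succ n ih =>
    have hu (s : TPow k (Va k) n) : insertion (braidingVG (ga k)) (n + 1)
        (p ⊗ₜ[k] glue n (u k ⊗ₜ[k] s)) = p ⊗ₜ[k] glue n (u k ⊗ₜ[k] s) +
          v k ⊗ₜ[k] glue n (insertion (braidingVG (ga k)) n (p ⊗ₜ[k] s)) := by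
      rw [insertion_glue, braidingVG_u]
      simp
    have hv (s : TPow k (Va k) n) : insertion (braidingVG (ga k)) (n + 1)
        (p ⊗ₜ[k] glue n (v k ⊗ₜ[k] s)) = p ⊗ₜ[k] glue n (v k ⊗ₜ[k] s) -
          u k ⊗ₜ[k] glue n (insertion (braidingVG (ga k)) n (p ⊗ₜ[k] s)) -
          v k ⊗ₜ[k] glue n (insertion (braidingVG (ga k)) n (p ⊗ₜ[k] s)) := by
      rw [insertion_glue, braidingVG_v, TensorProduct.sub_tmul, TensorProduct.neg_tmul, map_sub,
        map_neg, map_sub, map_neg]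
      simp only [TensorProduct.assoc_tmul, LinearMap.lTensor_tmul, LinearMap.comp_apply,
        LinearEquiv.coe_coe]
      abel
    have h : insertion (braidingVG (ga k)) (n + 1) (p ⊗ₜ[k] θ k (n + 1) f) =
        p ⊗ₜ[k] θ k (n + 1) f + v k ⊗ₜ[k] θ k (n + 1) (L k p (Du k f)) -
          u k ⊗ₜ[k] θ k (n + 1) (L k p (Dv k f)) - v k ⊗ₜ[k] θ k (n + 1) (L k p (Dv k f)) := by
      rw [θ_succ n f]
      simp only [map_add, TensorProduct.tmul_add, hu, hv, ih]
      abel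
    rw [h, θ_succ (n + 1), Du_L, Dv_L]
    congr 1
    rw [tmul_eq_uv p]
    simp only [map_add, map_sub, map_smul, TensorProduct.tmul_add, TensorProduct.tmul_sub,
      TensorProduct.tmul_smul]
    abel

/-- The symmetriser factors through the nine-dimensional space: multiply the letters onto the
vacuum, then expand by derivations. -/
theorem quantumSymmetriser_eq (n : ℕ) (t : TPow k (Va k) n) :
    quantumSymmetriser (braidingVG (ga k)) n t =
      θ k n (TensorAlgebra.lift k (L k) (toTensorAlgebra k (Va k) n t) (e0 k)) := by
  induction n with
  | zero =>
    obtain ⟨p, hp⟩ := exists_single t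
    rw [quantumSymmetriser_zero, hp, toTensorAlgebra_single, TensorAlgebra.lift_ι_apply, θ_zero]
    conv_lhs => rw [eq_uv p]
    simp [L, ofUV_apply, Lu_apply, Lv_apply, e0]
  | succ n ih =>
    induction t using TPow_induction with
    | h0 => simp
    | ha s t hs ht => simp only [map_add, LinearMap.add_apply, hs, ht]
    | hi q s =>
      rw [quantumSymmetriser_glue, ih, insertion_θ, toTensorAlgebra_glue]
      simp

/-- `TPow` starts in degree one, hence the shift to n + 1. -/
theorem homog_lift (n : ℕ) (t : TPow k (Va k) n) :
    Homog k (n + 1) (TensorAlgebra.lift k (L k) (toTensorAlgebra k (Va k) n t) (e0 k)) := by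
  induction n with
  | zero =>
    obtain ⟨p, hp⟩ := exists_single t
    rw [hp, toTensorAlgebra_single, TensorAlgebra.lift_ι_apply]
    exact homog_e0.L p
  | succ n ih =>
    induction t using TPow_induction with
    | h0 => intro i; simp
    | ha s t hs ht => intro i hi; simp [hs i hi, ht i hi]
    | hi q s =>
      rw [toTensorAlgebra_glue, map_mul, TensorAlgebra.lift_ι_apply]
      exact (ih s).L q

/-- Independence of u and v makes both derivatives of f vanish under `θ`, so induction and
`eq_zero_of_derivations` apply. Homogeneity supplies the vanishing constant term. -/
theorem eq_zero_of_θ (n : ℕ) {f : Reg k} (hf : Homog k (n + 1) f) (h : θ k n f = 0) : f = 0 := by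
  induction n generalizing f with
  | zero =>
    rw [θ_zero, LinearEquiv.map_eq_zero_iff] at h
    obtain ⟨h1, h2⟩ := linearIndependent_uv h
    obtain ⟨h0, -, -, h3, h4, h5, h6, h7, h8⟩ := hf.forall
    ext i
    fin_cases i <;> simp_all
  | succ n ih =>
    rw [θ_succ, LinearEquiv.map_eq_zero_iff] at h
    refine eq_zero_of_derivations (hf 0 (by simp [deg])) (ih hf.Du ?_) (ih hf.Dv ?_)
    · simpa using congrArg (fun t => TensorProduct.lid k _ ((cu k).rTensor _ t)) h
    · simpa using congrArg (fun t => TensorProduct.lid k _ ((cv k).rTensor _ t)) h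

theorem quantumSymmetriser_eq_zero_iff (n : ℕ) (t : TPow k (Va k) n) :
    quantumSymmetriser (braidingVG (ga k)) n t = 0 ↔
      TensorAlgebra.lift k (L k) (toTensorAlgebra k (Va k) n t) (e0 k) = 0 := by
  rw [quantumSymmetriser_eq]
  exact ⟨eq_zero_of_θ n (homog_lift n t), fun h => by rw [h, map_zero]⟩

end Reg

end Model
end NodalCubic

/-! ### The presentation and the basis of B(V_a). -/

namespace NodalCubic

open Atilde SkewPrim Nichols

namespace Model

universe u
variable {k : Type u} [Field k]

/-- The defining relations of `B(V_a)` for two elements of a ring. -/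
structure RelsUV {A : Type*} [Ring A] (u v : A) : Prop where
  uuu : u ^ 3 = 0
  vvv : v ^ 3 = 0
  uuv : u ^ 2 * v + u * v * u + v * u ^ 2 = 0
  uv : u ^ 2 + u * v + v ^ 2 = 0

theorem v_vu {A : Type*} [Ring A] (u v : A) : v * (v * u) = v ^ 2 * u := by
  rw [pow_two, mul_assoc]

namespace RelsUV

variable {A : Type*} [Ring A] {u v : A}

/-- This and the following identities rewrite u and v times each of the nine words as combinations
of these words. They are the columns of `Reg.Lu` and `Reg.Lv`. -/
theorem u_v (h : RelsUV u v) : u * v = -u ^ 2 - v ^ 2 := by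
  have := h.uv
  rw [← sub_eq_zero, ← this]
  abel

theorem u_uu (h : RelsUV u v) : u * u ^ 2 = 0 := by rw [← pow_succ', h.uuu]

theorem v_vv (h : RelsUV u v) : v * v ^ 2 = 0 := by rw [← pow_succ', h.vvv]

theorem u_vu (h : RelsUV u v) : u * (v * u) = -(v ^ 2 * u) := by
  rw [← mul_assoc, h.u_v, sub_mul, neg_mul, ← pow_succ, h.uuu]
  abel

theorem v_uu (h : RelsUV u v) : v * u ^ 2 = -(v * u * v) := by
  have e : u ^ 2 = -(u * v) - v ^ 2 := by rw [h.u_v]; abel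
  rw [e, mul_sub, h.v_vv, mul_neg, mul_assoc, sub_zero]

theorem u_vv (h : RelsUV u v) : u * v ^ 2 = -(v * u * v) - v ^ 2 * u := by
  have e : u ^ 2 * v = v ^ 2 * u + v * u * v := by
    have h1 := h.uuv
    rw [mul_assoc, h.u_vu, h.v_uu] at h1
    rw [← sub_eq_zero, ← h1]
    abel
  rw [show u * v ^ 2 = u * v * v by rw [pow_two, mul_assoc], h.u_v, sub_mul, neg_mul, e, ← pow_succ,
    h.vvv]
  abel

theorem u_vuv (h : RelsUV u v) : u * (v * u * v) = -(v ^ 2 * u * v) := by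
  rw [← mul_assoc, h.u_vu, neg_mul]

theorem v_vuv (h : RelsUV u v) : v * (v * u * v) = v ^ 2 * u * v := by rw [← mul_assoc, ← mul_assoc, ← pow_two]

theorem v_vvu (h : RelsUV u v) : v * (v ^ 2 * u) = 0 := by rw [← mul_assoc, h.v_vv, zero_mul]

theorem v_vvuv (h : RelsUV u v) : v * (v ^ 2 * u * v) = 0 := by rw [← mul_assoc, h.v_vvu, zero_mul]

theorem u_vvu (h : RelsUV u v) : u * (v ^ 2 * u) = v ^ 2 * u * v := by
  rw [← mul_assoc, h.u_vv, sub_mul, neg_mul, mul_assoc (v * u) v u, mul_assoc v u (v * u), h.u_vu,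
    mul_neg, h.v_vvu, mul_assoc (v ^ 2) u u, ← pow_two u, pow_two v, mul_assoc v v, h.v_uu, mul_neg,
    h.v_vuv, pow_two]
  abel

theorem vuvv (h : RelsUV u v) : v * u * v ^ 2 = -(v ^ 2 * u * v) := by
  rw [mul_assoc, h.u_vv, mul_sub, mul_neg, h.v_vuv, h.v_vvu, sub_zero]

theorem u_vvuv (h : RelsUV u v) : u * (v ^ 2 * u * v) = 0 := by
  rw [← mul_assoc, h.u_vvu, mul_assoc, ← pow_two, pow_two v, mul_assoc v v u, mul_assoc v, ← pow_two,
    h.vuvv, mul_neg, h.v_vvuv, neg_zero]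

end RelsUV

variable (k) in
/-- The algebra presented by the relations of `B(V_a)`. -/
abbrev PA : Type u := RingQuot (RelA k)

variable (k) in
/-- The generator `u` of the presented algebra. -/
def pu : PA k := RingQuot.mkAlgHom k (RelA k) (U k)
variable (k) in
/-- The generator `v` of the presented algebra. -/
def pv : PA k := RingQuot.mkAlgHom k (RelA k) (W k)

theorem relsUV_p : RelsUV (pu k) (pv k) where
  uuu := by simpa [pu, pv] using RingQuot.mkAlgHom_rel k (RelA.uuu (k := k))
  vvv := by simpa [pu, pv] using RingQuot.mkAlgHom_rel k (RelA.vvv (k := k))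
  uuv := by simpa [pu, pv] using RingQuot.mkAlgHom_rel k (RelA.uuv (k := k))
  uv := by simpa [pu, pv] using RingQuot.mkAlgHom_rel k (RelA.uv (k := k))

theorem relsUV_Reg : RelsUV (Reg.Lu k) (Reg.Lv k) := ⟨Reg.Lu_pow, Reg.Lv_pow, Reg.uuv, Reg.uv⟩

theorem exists_hom_of_relsUV {A : Type*} [Ring A] [Algebra k A] {s t : A} (h : RelsUV s t) :
    ∃ F : PA k →ₐ[k] A, F (pu k) = s ∧ F (pv k) = t := by
  refine ⟨RingQuot.liftAlgHom k ⟨FreeAlgebra.lift k ![s, t], ?_⟩, ?_, ?_⟩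
  · obtain ⟨h1, h2, h3, h4⟩ := h
    intro p q hpq
    cases hpq <;> simpa
  · simp [pu, RingQuot.liftAlgHom_mkAlgHom_apply]
  · simp [pv, RingQuot.liftAlgHom_mkAlgHom_apply]

theorem PA_hom_ext {A : Type*} [Semiring A] [Algebra k A] {F G : PA k →ₐ[k] A}
    (hu : F (pu k) = G (pu k)) (hv : F (pv k) = G (pv k)) : F = G := by
  apply RingQuot.ringQuot_ext' (S := k)
  apply FreeAlgebra.hom_ext
  funext i
  fin_cases i
  · exact hu
  · exact hv

/-- The nine words that span the algebra generated by `u` and `v`. -/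
def words {A : Type*} [Ring A] (u v : A) : Fin 9 → A :=
  ![1, u, v, u ^ 2, v * u, v ^ 2, v * u * v, v ^ 2 * u, v ^ 2 * u * v]

/-- Linear combinations of the nine words. -/
def combWords {A : Type*} [Ring A] [Algebra k A] (u v : A) : Reg k →ₗ[k] A :=
  Fintype.linearCombination k (words u v)

theorem combWords_apply {A : Type*} [Ring A] [Algebra k A] (u v : A) (f : Reg k) :
    combWords u v f = f 0 • 1 + f 1 • u + f 2 • v + f 3 • u ^ 2 + f 4 • (v * u) + f 5 • v ^ 2 +
      f 6 • (v * u * v) + f 7 • (v ^ 2 * u) + f 8 • (v ^ 2 * u * v) := by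
  simp [combWords, Fintype.linearCombination_apply, Fin.sum_univ_succ, words, add_assoc]

theorem RelsUV.mul_combWords_u {A : Type*} [Ring A] [Algebra k A] {u v : A} (h : RelsUV u v)
    (f : Reg k) : u * combWords u v f = combWords u v (Reg.Lu k f) := by
  simp only [combWords_apply, Reg.Lu_apply, mul_add, mul_smul_comm, h.u_v, h.u_uu, h.u_vu, h.u_vv,
    h.u_vuv, h.u_vvu, h.u_vvuv, mul_one, ← pow_two]
  simp
  module

theorem RelsUV.mul_combWords_v {A : Type*} [Ring A] [Algebra k A] {u v : A} (h : RelsUV u v)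
    (f : Reg k) : v * combWords u v f = combWords u v (Reg.Lv k f) := by
  simp only [combWords_apply, Reg.Lv_apply, mul_add, mul_smul_comm, h.v_vv, h.v_uu, v_vu,
    h.v_vuv, h.v_vvu, h.v_vvuv, mul_one, ← pow_two]
  simp

variable (k) in
/-- The regular representation of the presented algebra. -/
def repA : PA k →ₐ[k] Module.End k (Reg k) := (exists_hom_of_relsUV relsUV_Reg).choose

theorem repA_pu : repA k (pu k) = Reg.Lu k := (exists_hom_of_relsUV relsUV_Reg).choose_spec.1
theorem repA_pv : repA k (pv k) = Reg.Lv k := (exists_hom_of_relsUV relsUV_Reg).choose_spec.2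

theorem mul_combWords (s : PA k) (f : Reg k) :
    s * combWords (pu k) (pv k) f = combWords (pu k) (pv k) (repA k s f) := by
  obtain ⟨s, rfl⟩ := RingQuot.mkAlgHom_surjective k (RelA k) s
  induction s using FreeAlgebra.induction generalizing f with
  | grade0 r =>
    rw [AlgHom.commutes, ← Algebra.smul_def, AlgHom.commutes, Module.algebraMap_end_apply, map_smul]
  | grade1 i =>
    fin_cases i
    · change pu k * _ = combWords _ _ (repA k (pu k) f)
      rw [repA_pu, relsUV_p.mul_combWords_u]
    · change pv k * _ = combWords _ _ (repA k (pv k) f)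
      rw [repA_pv, relsUV_p.mul_combWords_v]
  | mul p q hp hq => rw [map_mul, mul_assoc, hq, hp, map_mul, Module.End.mul_apply]
  | add p q hp hq => rw [map_add, add_mul, hp, hq, map_add, LinearMap.add_apply, map_add]

theorem combWords_e0 {A : Type*} [Ring A] [Algebra k A] (u v : A) :
    combWords u v (Reg.e0 k) = 1 := by
  simp [combWords_apply, Reg.e0]

/-- The nine words span, and an element of the presented algebra that kills the vacuum is zero. -/
theorem eq_combWords (s : PA k) : s = combWords (pu k) (pv k) (repA k s (Reg.e0 k)) := by
  rw [← mul_combWords, combWords_e0, mul_one]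

theorem repA_combWords (f : Reg k) : repA k (combWords (pu k) (pv k) f) (Reg.e0 k) = f := by
  simp only [combWords_apply, map_add, map_smul, map_mul, map_pow, repA_pu, repA_pv, map_one]
  have e : Reg.e0 k = ![1, 0, 0, 0, 0, 0, 0, 0, 0] := by
    ext i
    fin_cases i <;> rfl
  rw [e]
  ext i
  fin_cases i <;> simp [pow_two, Reg.Lu_apply, Reg.Lv_apply]

/-- The threefold tensor of three vectors. -/
def tensor₃ (p q r : Va k) : TPow k (Va k) 2 := glue 1 (p ⊗ₜ[k] glue₀ (q ⊗ₜ[k] r))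

theorem toTensorAlgebra_tensor₃ (p q r : Va k) : toTensorAlgebra k (Va k) 2 (tensor₃ p q r) =
    TensorAlgebra.ι k p * (TensorAlgebra.ι k q * TensorAlgebra.ι k r) := rfl

/-- A homogeneous relation holds in B(V_a) as soon as it holds for the operators on the
nine-dimensional space. -/
theorem mkB_eq_zero (n : ℕ) (t : TPow k (Va k) n)
    (ht : TensorAlgebra.lift k (Reg.L k) (toTensorAlgebra k (Va k) n t) = 0) :
    mkB (braidingVG (ga k)) (toTensorAlgebra k (Va k) n t) = 0 :=
  mkB_ker _ ((Reg.quantumSymmetriser_eq_zero_iff n t).2 (by rw [ht, LinearMap.zero_apply]))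

theorem relsUV_Ba : RelsUV (ja k (u k)) (ja k (v k)) where
  uuu := by
    have := mkB_eq_zero 2 (tensor₃ (u k) (u k) (u k)) (by
      simpa [toTensorAlgebra_tensor₃, Reg.L, pow_succ, mul_assoc] using Reg.Lu_pow (k := k))
    simpa [toTensorAlgebra_tensor₃, mkB_ι, pow_succ, mul_assoc] using this
  vvv := by
    have := mkB_eq_zero 2 (tensor₃ (v k) (v k) (v k)) (by
      simpa [toTensorAlgebra_tensor₃, Reg.L, pow_succ, mul_assoc] using Reg.Lv_pow (k := k))
    simpa [toTensorAlgebra_tensor₃, mkB_ι, pow_succ, mul_assoc] using this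
  uuv := by
    have := mkB_eq_zero 2 (tensor₃ (u k) (u k) (v k) + tensor₃ (u k) (v k) (u k) +
      tensor₃ (v k) (u k) (u k)) (by
      simpa [toTensorAlgebra_tensor₃, Reg.L, pow_succ, mul_assoc] using Reg.uuv (k := k))
    simpa [toTensorAlgebra_tensor₃, mkB_ι, pow_succ, mul_assoc] using this
  uv := by
    have := mkB_eq_zero 1 (glue₀ (u k ⊗ₜ[k] u k) + glue₀ (u k ⊗ₜ[k] v k) + glue₀ (v k ⊗ₜ[k] v k)) (by
      simpa [toTensorAlgebra_glue₀, Reg.L, pow_succ, mul_assoc] using Reg.uv (k := k))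
    simpa [toTensorAlgebra_glue₀, mkB_ι, pow_succ, mul_assoc] using this

/-- One direction is `relsUV_Ba`. Conversely, a tensor in the kernel of a symmetriser kills the
vacuum of `Reg`, so by `eq_combWords` its image in the presented algebra is zero. -/
theorem exists_presentation : ∃ Ψ : PA k ≃ₐ[k] Ba k,
    Ψ (pu k) = ja k (u k) ∧ Ψ (pv k) = ja k (v k) := by
  obtain ⟨F, hF, hF'⟩ := exists_hom_of_relsUV (k := k) (relsUV_Ba (k := k))
  have hφ : TensorAlgebra.lift k (Reg.L k) =
      (repA k).comp (TensorAlgebra.lift k (Reg.ofUV (pu k) (pv k))) := by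
    apply TensorAlgebra.hom_ext
    refine LinearMap.ext fun p => ?_
    simp [Reg.L, Reg.ofUV_apply, repA_pu, repA_pv]
  obtain ⟨G, hG⟩ := exists_lift (χ := braidingVG (ga k)) (Reg.ofUV (pu k) (pv k)) fun n t ht => by
    rw [Reg.quantumSymmetriser_eq_zero_iff, hφ, AlgHom.comp_apply] at ht
    rw [eq_combWords (TensorAlgebra.lift k _ _), ht, map_zero]
  have hG' (p : Va k) : G (ja k p) = Reg.ofUV (pu k) (pv k) p := by
    have := hG (TensorAlgebra.ι k p)
    rwa [TensorAlgebra.lift_ι_apply] at this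
  refine ⟨AlgEquiv.ofAlgHom F G ?_ ?_, hF, hF'⟩
  · apply Nichols.hom_ext
    intro p
    change F (G (ja k p)) = ja k p
    rw [hG', Reg.ofUV_apply, map_add, map_smul, map_smul, hF, hF']
    conv_rhs => rw [Reg.eq_uv p]
    rw [map_add, map_smul, map_smul]
  · apply PA_hom_ext
    · change G (F _) = _
      rw [hF, hG', Reg.ofUV_u]; rfl
    · change G (F _) = _
      rw [hF', hG', Reg.ofUV_v]; rfl

theorem exists_basis_Ba : ∃ e : Module.Basis (Fin 9) k (Ba k), ⇑e = words (ja k (u k)) (ja k (v k)) := by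
  obtain ⟨Ψ, hu, hv⟩ := exists_presentation (k := k)
  let σ : PA k ≃ₗ[k] Reg k := LinearEquiv.ofLinearMap
    (LinearMap.applyₗ (Reg.e0 k) ∘ₗ (repA k).toLinearMap) (combWords (pu k) (pv k))
    (LinearMap.ext repA_combWords) (LinearMap.ext fun s => (eq_combWords s).symm)
  refine ⟨Module.Basis.ofEquivFun (Ψ.symm.toLinearEquiv.trans σ), ?_⟩
  funext i
  rw [Module.Basis.coe_ofEquivFun]
  change Ψ (combWords (k := k) (pu k) (pv k) (Pi.single i 1)) = _
  rw [combWords, Fintype.linearCombination_apply_single, one_smul]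
  fin_cases i <;> simp [words, hu, hv]

end Model
end NodalCubic

/-! ### B(V_b), and the Nichols algebra of a flip in characteristic zero. -/

namespace NodalCubic

open Atilde SkewPrim Nichols

namespace Model

universe u
variable {k : Type u} [Field k]

/-- p ⊗ p is in the kernel of 1 + χ, so squares vanish in B(V_b). Since V_b is a line, every tensor
of degree at least two vanishes in the exterior algebra, and in degree one the symmetriser is the
identity. -/
theorem exists_exterior_algEquiv : ∃ Θ : ExteriorAlgebra k (Vb k) ≃ₐ[k] Bb k,
    ∀ p, Θ (ExteriorAlgebra.ι k p) = jb k p := by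
  have hsq (p : Vb k) : jb k p * jb k p = 0 := by
    have := ι_mul_ι (braidingVG (gb k)) (T := p ⊗ₜ[k] p) (by rw [braidingVG_b]; abel)
    simpa using this
  have hmul (p q : Vb k) : ExteriorAlgebra.ι k p * ExteriorAlgebra.ι k q = 0 := by
    obtain ⟨r, rfl⟩ := span_clsY p
    obtain ⟨s, rfl⟩ := span_clsY q
    simp
  have hdeg (n : ℕ) (p : Vb k) (t : TPow k (Vb k) n) : ExteriorAlgebra.ι k p *
      TensorAlgebra.lift k (ExteriorAlgebra.ι k) (toTensorAlgebra k (Vb k) n t) = 0 := by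
    cases n with
    | zero =>
      obtain ⟨q, hq⟩ := exists_single t
      rw [hq, toTensorAlgebra_single, TensorAlgebra.lift_ι_apply, hmul]
    | succ n =>
      induction t using TPow_induction with
      | h0 => simp
      | ha s t hs ht => rw [map_add, map_add, mul_add, hs, ht, add_zero]
      | hi q s =>
        rw [toTensorAlgebra_glue, map_mul, TensorAlgebra.lift_ι_apply, ← mul_assoc, hmul, zero_mul]
  obtain ⟨G, hG⟩ := exists_lift (χ := braidingVG (gb k)) (ExteriorAlgebra.ι k) fun n t ht => by
    cases n with
    | zero => rw [← quantumSymmetriser_zero (braidingVG (gb k)) t, ht, map_zero, map_zero]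
    | succ n =>
      clear ht
      induction t using TPow_induction with
      | h0 => simp
      | ha s t hs ht => rw [map_add, map_add, hs, ht, add_zero]
      | hi q s => rw [toTensorAlgebra_glue, map_mul, TensorAlgebra.lift_ι_apply, hdeg]
  have hG' (p : Vb k) : G (jb k p) = ExteriorAlgebra.ι k p := by
    have := hG (TensorAlgebra.ι k p)
    rwa [TensorAlgebra.lift_ι_apply] at this
  refine ⟨AlgEquiv.ofAlgHom (ExteriorAlgebra.lift k ⟨jb k, hsq⟩) G ?_ ?_, fun p => ?_⟩
  · apply Nichols.hom_ext
    intro p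
    change ExteriorAlgebra.lift k ⟨jb k, hsq⟩ (G (jb k p)) = jb k p
    rw [hG', ExteriorAlgebra.lift_ι_apply]
  · apply ExteriorAlgebra.hom_ext
    refine LinearMap.ext fun p => ?_
    simp [hG']
  · exact ExteriorAlgebra.lift_ι_apply k _ _ p

/-! ### Characteristic zero -/

/-- In a commutative algebra the n + 2 positions at which p can be inserted all give the same
product. -/
theorem lift_insertion_flip {V : Type u} [AddCommGroup V] [Module k V]
    {χ : V ⊗[k] V →ₗ[k] V ⊗[k] V} (hχ : ∀ p q, χ (p ⊗ₜ[k] q) = q ⊗ₜ[k] p) {A : Type*} [CommRing A]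
    [Algebra k A] (f : V →ₗ[k] A) (n : ℕ) (p : V) (t : TPow k V n) :
    TensorAlgebra.lift k f (toTensorAlgebra k V (n + 1) (glue n (insertion χ n (p ⊗ₜ[k] t)))) =
      (n + 2 : k) • (f p * TensorAlgebra.lift k f (toTensorAlgebra k V n t)) := by
  induction n with
  | zero =>
    obtain ⟨q, hq⟩ := exists_single t
    rw [hq, glue_insertion_zero, hχ, map_add, map_add, map_add, toTensorAlgebra_glue₀,
      toTensorAlgebra_glue₀, toTensorAlgebra_single]
    simp only [map_mul, TensorAlgebra.lift_ι_apply, mul_comm (f q)]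
    module
  | succ n ih =>
    induction t using TPow_induction with
    | h0 => simp
    | ha s t hs ht => simp only [map_add, TensorProduct.tmul_add, mul_add, hs, ht, smul_add]
    | hi q s =>
      rw [insertion_glue, hχ, TensorProduct.assoc_tmul, LinearMap.lTensor_tmul, map_add, map_add,
        map_add, toTensorAlgebra_glue, toTensorAlgebra_glue, toTensorAlgebra_glue]
      simp only [map_mul, TensorAlgebra.lift_ι_apply, LinearMap.comp_apply, LinearEquiv.coe_coe, ih,
        mul_smul_comm, mul_left_comm (f q)]
      push_cast
      module

theorem lift_quantumSymmetriser_flip {V : Type u} [AddCommGroup V] [Module k V]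
    {χ : V ⊗[k] V →ₗ[k] V ⊗[k] V} (hχ : ∀ p q, χ (p ⊗ₜ[k] q) = q ⊗ₜ[k] p) {A : Type*} [CommRing A]
    [Algebra k A] (f : V →ₗ[k] A) (n : ℕ) (t : TPow k V n) :
    TensorAlgebra.lift k f (toTensorAlgebra k V n (quantumSymmetriser χ n t)) =
      ((n + 1).factorial : k) • TensorAlgebra.lift k f (toTensorAlgebra k V n t) := by
  induction n with
  | zero => rw [quantumSymmetriser_zero]; simp
  | succ n ih =>
    induction t using TPow_induction with
    | h0 => simp
    | ha s t hs ht => simp only [map_add, hs, ht, smul_add]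
    | hi q s =>
      rw [quantumSymmetriser_glue, lift_insertion_flip hχ, ih, toTensorAlgebra_glue, map_mul,
        TensorAlgebra.lift_ι_apply, Nat.factorial_succ (n + 1), mul_smul_comm, smul_smul]
      push_cast
      congr 1
      ring

/-- The Nichols algebra of a flip in characteristic zero is a polynomial ring. -/
theorem exists_polynomial_algEquiv [CharZero k] {V : Type u} [AddCommGroup V] [Module k V]
    {χ : V ⊗[k] V →ₗ[k] V ⊗[k] V} (hχ : ∀ p q, χ (p ⊗ₜ[k] q) = q ⊗ₜ[k] p) {I : Type} [Fintype I]
    (e : Module.Basis I k V) : ∃ Ξ : MvPolynomial I k ≃ₐ[k] NicholsAlgebra χ,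
      ∀ i, Ξ (MvPolynomial.X i) = ι χ (e i) := by
  have hc (s t : NicholsAlgebra χ) : Commute s t := by
    obtain ⟨s, rfl⟩ := mkB_surjective χ s
    obtain ⟨t, rfl⟩ := mkB_surjective χ t
    induction s using TensorAlgebra.induction with
    | algebraMap r => simpa using Algebra.commute_algebraMap_left _ _
    | mul s s' hs hs' => rw [map_mul]; exact hs.mul_left hs'
    | add s s' hs hs' => rw [map_add]; exact hs.add_left hs'
    | ι p =>
      induction t using TensorAlgebra.induction with
      | algebraMap r => simpa using Algebra.commute_algebraMap_right _ _
      | mul s s' hs hs' => rw [map_mul]; exact hs.mul_right hs'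
      | add s s' hs hs' => rw [map_add]; exact hs.add_right hs'
      | ι q => exact ι_mul_ι_comm χ (hχ p q) (hχ q p)
  let f : V →ₗ[k] MvPolynomial I k := e.constr k MvPolynomial.X
  obtain ⟨G, hG⟩ := exists_lift (χ := χ) f fun n t ht => by
    have := lift_quantumSymmetriser_flip hχ f n t
    rw [ht, map_zero, map_zero, eq_comm, smul_eq_zero] at this
    -- Characteristic zero is needed here, to divide by the factorial.
    exact this.resolve_left (Nat.cast_ne_zero.2 (Nat.factorial_ne_zero _))
  have hG' (i : I) : G (ι χ (e i)) = MvPolynomial.X i := by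
    have := hG (TensorAlgebra.ι k (e i))
    rw [TensorAlgebra.lift_ι_apply] at this
    exact this.trans (e.constr_basis k _ i)
  let : CommRing (NicholsAlgebra χ) :=
    { (inferInstance : Ring (NicholsAlgebra χ)) with mul_comm := fun s t => hc s t }
  let F : MvPolynomial I k →ₐ[k] NicholsAlgebra χ := MvPolynomial.aeval fun i => ι χ (e i)
  have hF (i : I) : F (MvPolynomial.X i) = ι χ (e i) := MvPolynomial.aeval_X _ i
  refine ⟨AlgEquiv.ofAlgHom F G ?_ ?_, hF⟩
  · apply Nichols.hom_ext
    intro p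
    have : (F.comp G).toLinearMap ∘ₗ ι χ = ι χ := e.ext fun i => by
      change F (G (ι χ (e i))) = ι χ (e i)
      rw [hG', hF]
    exact LinearMap.congr_fun this p
  · apply MvPolynomial.algHom_ext
    intro i
    change G (F _) = _
    rw [hF, hG']
    rfl

end Model
end NodalCubic

namespace NodalCubic

open Atilde SkewPrim Nichols

namespace Model

universe u
variable {k : Type u} [Field k]

/-! ### The primitive elements in characteristic zero -/

/-- A Leibniz rule. When φ is a partial derivative at the origin in the direction of q and ψ is
evaluation there, id ⊗ φ becomes that partial derivative. -/
theorem mu_mul_deriv {φ ψ : Atilde k →ₗ[k] k} {q : Atilde k}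
    (hΔ : comulHom k q = 1 ⊗ₜ q + q ⊗ₜ 1) (hq : ∀ h, φ (q * h) = ψ h) (h : Atilde k) :
    mu φ (q * h) = mu ψ h + q * mu φ h := by
  simp only [mu, LinearMap.comp_apply, AlgHom.toLinearMap_apply, map_mul, hΔ]
  induction comulHom k h with
  | zero => simp
  | add s t hs ht => simp only [mul_add, map_add, hs, ht]; abel
  | tmul s t => simp [add_mul, hq]

theorem mu_one (φ : Atilde k →ₗ[k] k) : mu φ 1 = φ 1 • 1 := by
  have := mu_groupLike φ (1 : GroupLike k (Atilde k))
  rwa [GroupLike.val_one] at this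

theorem mu_pr_Z {p : S k} (hp : p ∈ Z k) : mu (pr k 0 0 0) (ev k p) = ev k p := by
  have := mu_Z_mul (pr_mul_z k 0 0 0) (pr_mul_c k 0 0 0) hp (1 : Atilde k)
  have e : mu (pr k 0 0 0) 1 = 1 := by
    rw [mu_one]
    simp [pr, fn, coef_one, eps]
  rwa [mul_one, e, mul_one] at this

/-- Polynomials in `z` and `c` as elements of the coordinate ring. -/
def ζ : R k →ₗ[k] S k where
  toFun q := sMk k (q.comp (zR k)) 0
  map_add' p q := by apply S_ext <;> simp
  map_smul' r p := by apply S_ext <;> simp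

theorem re_ζ (q : R k) : re (ζ q) = q.comp (zR k) := rfl
theorem im_ζ (q : R k) : im (ζ q) = 0 := rfl

theorem ζ_mul (p q : R k) : ζ (p * q) = ζ p * ζ q := by
  apply S_ext <;> simp [re_ζ, im_ζ]

theorem ζ_one : ζ (1 : R k) = 1 := by
  apply S_ext <;> simp [re_ζ, im_ζ]

theorem ζ_X : ζ (Polynomial.X : R k) = sZ k := by
  rw [sZ_eq]
  apply S_ext <;> simp [re_ζ, im_ζ]

theorem ζ_C : ζ (Polynomial.C Polynomial.X : R k) = sC k := by
  apply S_ext <;> simp [re_ζ, im_ζ, sC]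

theorem ζ_mem (q : R k) : ζ q ∈ Z k := by
  induction q using R_induction with
  | h0 => rw [ζ_one]; exact one_mem _
  | hadd p q hp hq => rw [map_add]; exact add_mem hp hq
  | hsmul r p hp => rw [map_smul]; exact Subalgebra.smul_mem _ hp r
  | hX p hp => rw [ζ_mul, ζ_X]; exact mul_mem sZ_mem hp
  | hc p hp => rw [ζ_mul, ζ_C]; exact mul_mem sC_mem hp

theorem exists_ζ {p : S k} (hp : p ∈ Z k) : ∃ q, p = ζ q := by
  induction hp using Algebra.adjoin_induction with
  | mem s hs =>
    rcases hs with rfl | rfl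
    · exact ⟨_, ζ_X.symm⟩
    · exact ⟨_, ζ_C.symm⟩
  | algebraMap r => exact ⟨r • 1, by rw [map_smul, ζ_one, Algebra.algebraMap_eq_smul_one]⟩
  | add p q _ _ hp hq =>
    obtain ⟨p, rfl⟩ := hp
    obtain ⟨q, rfl⟩ := hq
    exact ⟨p + q, (map_add _ _ _).symm⟩
  | mul p q _ _ hp hq =>
    obtain ⟨p, rfl⟩ := hp
    obtain ⟨q, rfl⟩ := hq
    exact ⟨p * q, (ζ_mul _ _).symm⟩

theorem ζ_injective : Function.Injective (ζ (k := k)) := by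
  rw [← LinearMap.ker_eq_bot, LinearMap.ker_eq_bot']
  intro q hq
  have h := congrArg re hq
  rw [re_ζ, re_zero, Polynomial.comp_eq_zero_iff] at h
  refine h.resolve_right fun ⟨_, h2⟩ => ?_
  have := congrArg (fun p => Polynomial.coeff p 2) h2
  simp [Polynomial.coeff_X_pow, Polynomial.coeff_C] at this

theorem ev_ζ_injective : Function.Injective fun q : R k => ev k (ζ q) :=
  (ev_injective k).comp ζ_injective

variable (k) in
/-- The derivative with respect to `z` at the origin. -/
def dz : S k →ₗ[k] k where
  toFun s := ((re s).coeff 2).coeff 0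
  map_add' s t := by simp
  map_smul' r s := by simp

variable (k) in
/-- The derivative with respect to `c` at the origin. -/
def dc : S k →ₗ[k] k where
  toFun s := ((re s).coeff 0).coeff 1
  map_add' s t := by simp
  map_smul' r s := by simp

/-- Since z = x² + x³, the coefficient of x² in zs is the constant term of s in x. This is why `dz`
reads off x². -/
theorem dz_Z (s : S k) : dz k (sZ k * s) = eps k s := by
  simp [dz, eps, sZ_eq, (zR_mul_coeff k _).2.2]
theorem dz_C (s : S k) : dz k (sC k * s) = 0 := by simp [dz, sC]
theorem dc_Z (s : S k) : dc k (sZ k * s) = 0 := by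
  simp [dc, sZ_eq, (zR_mul_coeff k _).1]
theorem dc_C (s : S k) : dc k (sC k * s) = eps k s := by
  simp [dc, eps, sC, Polynomial.coeff_X_mul]

theorem mu_dz (q : R k) :
    mu (fn (dz k) 0 0 0) (ev k (ζ q)) = ev k (ζ (Polynomial.derivative q)) := by
  induction q using R_induction with
  | h0 =>
    rw [ζ_one, ev_one, Polynomial.derivative_one, map_zero, map_zero, mu_one]
    simp [fn, coef_one, dz, Polynomial.coeff_one]
  | hadd p q hp hq => simp only [map_add, hp, hq]
  | hsmul r p hp =>
    rw [map_smul, map_smul, map_smul, hp, Polynomial.derivative_smul, map_smul, map_smul]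
  | hX p hp =>
    rw [ζ_mul, ζ_X, ev_mul, ev_sZ, mu_mul_deriv (ψ := pr k 0 0 0) comul_z
      (fun h => by rw [z_comm, ← ev_sZ, fn_mul_ev, dz_Z]; rfl), mu_pr_Z (ζ_mem _), hp,
      Polynomial.derivative_mul, Polynomial.derivative_X, one_mul, map_add, map_add, ζ_mul, ζ_X,
      ev_mul, ev_sZ]
  | hc p hp =>
    rw [ζ_mul, ζ_C, ev_mul, ev_sC, mu_mul_of comul_c
      (fun h => by rw [c_comm, ← ev_sC, fn_mul_ev, dz_C]), hp,
      Polynomial.derivative_C_mul, ζ_mul, ζ_C, ev_mul, ev_sC]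

theorem ζ_C_C (t : k) : ev k (ζ (Polynomial.C (Polynomial.C t))) = t • 1 := by
  rw [show (Polynomial.C (Polynomial.C t) : R k) = t • 1 by
    rw [Algebra.smul_def, mul_one]; rfl, map_smul, map_smul, ζ_one, ev_one]

theorem mu_dc (q : Polynomial k) : mu (fn (dc k) 0 0 0) (ev k (ζ (Polynomial.C q))) =
    ev k (ζ (Polynomial.C (Polynomial.derivative q))) := by
  induction q using Polynomial.induction_on' with
  | add p q hp hq => simp only [map_add, hp, hq]
  | monomial n r =>
    induction n with
    | zero =>
      rw [Polynomial.monomial_zero_left, ζ_C_C, map_smul, mu_one, Polynomial.derivative_C, map_zero,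
        map_zero, map_zero]
      simp [fn, coef_one, dc, Polynomial.coeff_one]
    | succ n ih =>
      rw [← Polynomial.X_mul_monomial, map_mul, ζ_mul, ζ_C, ev_mul, ev_sC,
        mu_mul_deriv (ψ := pr k 0 0 0) comul_c
          (fun h => by rw [c_comm, ← ev_sC, fn_mul_ev, dc_C]; rfl), mu_pr_Z (ζ_mem _), ih,
        Polynomial.derivative_mul, Polynomial.derivative_X, one_mul, map_add, map_add, map_add,
        map_mul, ζ_mul, ζ_C, ev_mul, ev_sC]

theorem eq_of_derivative_eq_C {D : Type*} [CommRing D] [IsDomain D] [CharZero D] {q : Polynomial D}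
    {t : D} (h : Polynomial.derivative q = Polynomial.C t) :
    q = Polynomial.C (q.coeff 0) + Polynomial.C t * Polynomial.X := by
  have hn (n : ℕ) : q.coeff (n + 1) * (n + 1) = (Polynomial.C t).coeff n := by
    rw [← h, Polynomial.coeff_derivative]
  ext n
  rcases n with _ | _ | n
  · simp
  · simpa using hn 0
  · have h2 := hn (n + 1)
    rw [Polynomial.coeff_C_succ] at h2
    have h3 := (mul_eq_zero.1 h2).resolve_right (by exact_mod_cast Nat.succ_ne_zero (n + 1))
    simp [h3, Polynomial.coeff_X]

/-- For a primitive polynomial in z and c the partial derivative in z is constant, so it is r(c) +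
tz. Now r(c) is primitive too, its derivative is constant, and the counit removes its constant term.
-/
theorem primitive_eq [CharZero k] {h : Atilde k} (hh : h ∈ P k (1 : GroupLike k (Atilde k))) :
    ∃ r s : k, h = r • z k + s • c k := by
  obtain ⟨p, hp, rfl⟩ := skew_one hh
  obtain ⟨q, rfl⟩ := exists_ζ hp
  have hφ (φ : S k →ₗ[k] k) (h1 : φ 1 = 0) {p : Atilde k}
      (hp : p ∈ P k (1 : GroupLike k (Atilde k))) : mu (fn φ 0 0 0) p = fn φ 0 0 0 p • 1 := by
    rw [mu_skew _ hp, GroupLike.val_one]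
    simp [fn, coef_one, h1]
  have h1 := hφ (dz k) (by simp [dz, Polynomial.coeff_one]) hh
  rw [mu_dz, ← ζ_C_C] at h1
  have h2 := eq_of_derivative_eq_C (ev_ζ_injective h1)
  generalize fn (dz k) 0 0 0 (ev k (ζ q)) = t at h2
  generalize q.coeff 0 = r at h2
  have e : ev k (ζ q) = ev k (ζ (Polynomial.C r)) + t • z k := by
    rw [h2, map_add, map_add, ζ_mul, ev_mul, ζ_C_C, ζ_X, ev_sZ, smul_mul_assoc, one_mul]
  have hr : ev k (ζ (Polynomial.C r)) ∈ P k (1 : GroupLike k (Atilde k)) := by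
    rw [← sub_eq_iff_eq_add] at e
    rw [← e]
    exact sub_mem hh (Submodule.smul_mem _ _ (x2x3_mem k))
  have h3 := hφ (dc k) (by simp [dc, Polynomial.coeff_one]) hr
  rw [mu_dc, ← ζ_C_C] at h3
  have h4 := eq_of_derivative_eq_C (Polynomial.C_injective (ev_ζ_injective h3))
  generalize fn (dc k) 0 0 0 (ev k (ζ (Polynomial.C r))) = s at h4
  generalize r.coeff 0 = w at h4
  have e' : ev k (ζ (Polynomial.C r)) = w • 1 + s • c k := by
    rw [h4, map_add, map_add, map_add, map_mul, ζ_mul, ev_mul, ζ_C_C, ζ_C_C, ζ_C, ev_sC,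
      smul_mul_assoc, one_mul]
  have hw : w = 0 := by
    have h5 := counit_skew hr
    rw [e', map_add, map_smul, map_smul, counit_skew (c_mem k), map_one] at h5
    simpa using h5
  exact ⟨t, s, by rw [e, e', hw, zero_smul, zero_add, add_comm]⟩

theorem exists_basis_one [CharZero k] :
    ∃ e : Module.Basis (Fin 2) k (V1 k), e 0 = clsX k ∧ e 1 = clsC k := by
  refine ⟨Module.Basis.mk (v := ![clsX k, clsC k]) (LinearIndependent.pair_iff.2 fun r s h => ?_)
    fun p _ => ?_, by simp, by simp⟩
  · obtain ⟨t, ht⟩ := (cls_eq_iff (hp := add_mem (Submodule.smul_mem _ _ (x2x3_mem k))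
      (Submodule.smul_mem _ _ (c_mem k))) (hq := zero_mem _)).1 h
    rw [GroupLike.val_one, sub_self, smul_zero, sub_zero, ← z, ← ev_sZ, ← ev_sC, ← map_smul, ← map_smul,
      ← map_add, eq_comm, ← map_zero (ev k)] at ht
    have h1 := ev_injective k ht
    constructor
    · have := congrArg (dz k) h1
      rw [map_add, map_smul, map_smul, ← mul_one (sZ k), ← mul_one (sC k), dz_Z, dz_C] at this
      simpa [eps] using this
    · have := congrArg (dc k) h1
      rw [map_add, map_smul, map_smul, ← mul_one (sZ k), ← mul_one (sC k), dc_Z, dc_C] at this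
      simpa [eps] using this
  · obtain ⟨p, hp, rfl⟩ := exists_cls p
    obtain ⟨r, s, rfl⟩ := primitive_eq hp
    have e : cls 1 _ hp = r • clsX k + s • clsC k := rfl
    rw [e]
    exact add_mem (Submodule.smul_mem _ _ (Submodule.subset_span ⟨0, rfl⟩))
      (Submodule.smul_mem _ _ (Submodule.subset_span ⟨1, rfl⟩))

theorem exists_total [CharZero k] :
    ∃ Φ : (MvPolynomial (Fin 2) k ⊗[k] ExteriorAlgebra k k) ⊗[k] Ba k ≃ₐ[k] BAll k,
      Φ ((MvPolynomial.X 0 ⊗ₜ[k] 1) ⊗ₜ[k] 1) = jAll k (incl _ (clsX k)) ∧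
      Φ ((MvPolynomial.X 1 ⊗ₜ[k] 1) ⊗ₜ[k] 1) = jAll k (incl _ (clsC k)) ∧
      Φ ((1 ⊗ₜ[k] ExteriorAlgebra.ι k 1) ⊗ₜ[k] 1) = jAll k (incl _ (clsY k)) ∧
      ∀ p, Φ ((1 ⊗ₜ[k] 1) ⊗ₜ[k] ja k p) = jAll k (incl _ p) := by
  obtain ⟨e, he0, he1⟩ := exists_basis_one (k := k)
  obtain ⟨Ξ, hΞ⟩ := exists_polynomial_algEquiv braidingVG_one e
  obtain ⟨Θ, hΘ⟩ := exists_exterior_algEquiv (k := k)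
  obtain ⟨Φ, h1, h2, h3⟩ := exists_tensor_algEquiv (k := k)
  obtain ⟨b, hb⟩ := exists_basis_b (k := k)
  let l : k ≃ₗ[k] Vb k := (LinearEquiv.funUnique (Fin 1) k k).symm.trans b.equivFun.symm
  have hl : l 1 = clsY k := by
    simp [l, Module.Basis.equivFun_symm_apply, ← hb]
  let Λ : ExteriorAlgebra k k ≃ₐ[k] ExteriorAlgebra k (Vb k) := AlgEquiv.ofAlgHom
    (ExteriorAlgebra.map l.toLinearMap) (ExteriorAlgebra.map l.symm.toLinearMap)
    (by rw [ExteriorAlgebra.map_comp_map]; simp) (by rw [ExteriorAlgebra.map_comp_map]; simp)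
  have hΛ : Λ (ExteriorAlgebra.ι k 1) = ExteriorAlgebra.ι k (clsY k) := by
    rw [← hl]
    exact ExteriorAlgebra.map_apply_ι _ _
  -- The factors for V_a and V_b are interchanged to match the order in `exists_tensor_algEquiv`.
  refine ⟨((Algebra.TensorProduct.congr (Algebra.TensorProduct.congr Ξ (Λ.trans Θ))
    AlgEquiv.refl).trans ((Algebra.TensorProduct.assoc k k k (B1 k) (Bb k) (Ba k)).trans
      ((Algebra.TensorProduct.congr AlgEquiv.refl
        (Algebra.TensorProduct.comm k (Bb k) (Ba k))).trans
          (Algebra.TensorProduct.assoc k k k (B1 k) (Ba k) (Bb k)).symm))).trans Φ, ?_, ?_, ?_, ?_⟩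
  · simp [hΞ, he0, ← h1]
  · simp [hΞ, he1, ← h1]
  · simp [hΛ, hΘ, ← h3]
  · simp [← h2]

end Model
end NodalCubic

end

theorem mainTheorem8 (k : Type*) [Field k] :
    -- the braided vector space of skew primitives is `V_1 ⊕ V_a ⊕ V_b`
    (NodalCubic.Atilde.ga k ≠ 1 ∧ NodalCubic.Atilde.gb k ≠ 1 ∧
      NodalCubic.Atilde.ga k ≠ NodalCubic.Atilde.gb k) ∧
    (∀ g : GroupLike k (NodalCubic.Atilde k), g ≠ 1 → g ≠ NodalCubic.Atilde.ga k →
      g ≠ NodalCubic.Atilde.gb k → Subsingleton (SkewPrim.VG k g)) ∧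
    Nichols.IsBraiding (SkewPrim.braiding k (NodalCubic.Atilde k)) ∧
    (∀ (g : GroupLike k (NodalCubic.Atilde k)) (p q : SkewPrim.VG k g),
      SkewPrim.braiding k (NodalCubic.Atilde k) (SkewPrim.incl g p ⊗ₜ[k] SkewPrim.incl g q) =
        TensorProduct.map (SkewPrim.incl g) (SkewPrim.incl g)
          (SkewPrim.braidingVG g (p ⊗ₜ[k] q))) ∧
    (∀ (g h : GroupLike k (NodalCubic.Atilde k)), g ≠ h →
      ∀ (p : SkewPrim.VG k g) (q : SkewPrim.VG k h),
        SkewPrim.braiding k (NodalCubic.Atilde k) (SkewPrim.incl g p ⊗ₜ[k] SkewPrim.incl h q) =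
          SkewPrim.incl h q ⊗ₜ[k] SkewPrim.incl g p) ∧
    -- the braiding is the flip on `V_1` and minus the flip on `V_b = k [y]`
    (∀ p q : NodalCubic.V1 k, SkewPrim.braidingVG 1 (p ⊗ₜ[k] q) = q ⊗ₜ[k] p) ∧
    (∀ p q : NodalCubic.Vb k,
      SkewPrim.braidingVG (NodalCubic.Atilde.gb k) (p ⊗ₜ[k] q) = -(q ⊗ₜ[k] p)) ∧
    (∃ e : Module.Basis (Fin 1) k (NodalCubic.Vb k), e 0 = NodalCubic.Atilde.clsY k) ∧
    -- the braided vector space `V_a`, with basis `u, v`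
    (∃ e : Module.Basis (Fin 2) k (NodalCubic.Va k),
      e 0 = NodalCubic.Atilde.u k ∧ e 1 = NodalCubic.Atilde.v k) ∧
    (let u := NodalCubic.Atilde.u k
     let v := NodalCubic.Atilde.v k
     let χ := SkewPrim.braidingVG (NodalCubic.Atilde.ga k)
     χ (u ⊗ₜ[k] u) = v ⊗ₜ[k] u ∧ χ (v ⊗ₜ[k] u) = v ⊗ₜ[k] v ∧
     χ (u ⊗ₜ[k] v) = -(u ⊗ₜ[k] u) - v ⊗ₜ[k] u ∧ χ (v ⊗ₜ[k] v) = -(u ⊗ₜ[k] v) - v ⊗ₜ[k] v ∧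
     ((∀ r : k, ¬ IsPrimitiveRoot r 3) → ¬ Nichols.IsDiagonalType χ)) ∧
    -- the presentation and a basis of `B(V_a)`
    (∃ Ψ : RingQuot (NodalCubic.RelA k) ≃ₐ[k] NodalCubic.Ba k,
      Ψ (RingQuot.mkAlgHom k (NodalCubic.RelA k) (NodalCubic.U k)) =
        NodalCubic.ja k (NodalCubic.Atilde.u k) ∧
      Ψ (RingQuot.mkAlgHom k (NodalCubic.RelA k) (NodalCubic.W k)) =
        NodalCubic.ja k (NodalCubic.Atilde.v k)) ∧
    (let u := NodalCubic.ja k (NodalCubic.Atilde.u k)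
     let v := NodalCubic.ja k (NodalCubic.Atilde.v k)
     Module.finrank k (NodalCubic.Ba k) = 9 ∧
     (∃ e : Module.Basis (Fin 9) k (NodalCubic.Ba k),
       ⇑e = ![1, u, v, u ^ 2, v * u, v ^ 2, v * u * v, v ^ 2 * u, v ^ 2 * u * v]) ∧
     v * u * v ^ 2 = -(v ^ 2 * u * v)) ∧
    -- `B(V_b)` is the exterior algebra of `V_b`
    (∃ Θ : ExteriorAlgebra k (NodalCubic.Vb k) ≃ₐ[k] NodalCubic.Bb k,
      ∀ p, Θ (ExteriorAlgebra.ι k p) = NodalCubic.jb k p) ∧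
    -- `B(V) = B(V_1) ⊗ B(V_a) ⊗ B(V_b)`
    (∃ Φ : (NodalCubic.B1 k ⊗[k] NodalCubic.Ba k) ⊗[k] NodalCubic.Bb k ≃ₐ[k] NodalCubic.BAll k,
      (∀ p, Φ ((NodalCubic.j1 k p ⊗ₜ[k] 1) ⊗ₜ[k] 1) = NodalCubic.jAll k (SkewPrim.incl _ p)) ∧
      (∀ p, Φ ((1 ⊗ₜ[k] NodalCubic.ja k p) ⊗ₜ[k] 1) = NodalCubic.jAll k (SkewPrim.incl _ p)) ∧
      (∀ p, Φ ((1 ⊗ₜ[k] 1) ⊗ₜ[k] NodalCubic.jb k p) = NodalCubic.jAll k (SkewPrim.incl _ p))) ∧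
    -- in characteristic zero, `B(V_1)` is a polynomial ring in two variables, and
    -- `B(V)` is the tensor product of it with an exterior algebra and `B(V_a)`
    (CharZero k →
      (∃ e : Module.Basis (Fin 2) k (NodalCubic.V1 k),
        e 0 = NodalCubic.Atilde.clsX k ∧ e 1 = NodalCubic.Atilde.clsC k) ∧
      (∃ Ξ : MvPolynomial (Fin 2) k ≃ₐ[k] NodalCubic.B1 k,
        Ξ (MvPolynomial.X 0) = NodalCubic.j1 k (NodalCubic.Atilde.clsX k) ∧
        Ξ (MvPolynomial.X 1) = NodalCubic.j1 k (NodalCubic.Atilde.clsC k)) ∧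
      (∃ Φ : (MvPolynomial (Fin 2) k ⊗[k] ExteriorAlgebra k k) ⊗[k] NodalCubic.Ba k ≃ₐ[k]
          NodalCubic.BAll k,
        Φ ((MvPolynomial.X 0 ⊗ₜ[k] 1) ⊗ₜ[k] 1) =
          NodalCubic.jAll k (SkewPrim.incl _ (NodalCubic.Atilde.clsX k)) ∧
        Φ ((MvPolynomial.X 1 ⊗ₜ[k] 1) ⊗ₜ[k] 1) =
          NodalCubic.jAll k (SkewPrim.incl _ (NodalCubic.Atilde.clsC k)) ∧
        Φ ((1 ⊗ₜ[k] ExteriorAlgebra.ι k 1) ⊗ₜ[k] 1) =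
          NodalCubic.jAll k (SkewPrim.incl _ (NodalCubic.Atilde.clsY k)) ∧
        (∀ p, Φ ((1 ⊗ₜ[k] 1) ⊗ₜ[k] NodalCubic.ja k p) =
          NodalCubic.jAll k (SkewPrim.incl _ p)))) := by
  exact ⟨⟨NodalCubic.Model.ga_ne_one, NodalCubic.Model.gb_ne_one, NodalCubic.Model.ga_ne_gb⟩,
    fun g h1 ha hb => NodalCubic.Model.subsingleton_VG h1 ha hb,
    SkewPrim.isBraiding_braiding,
    fun g p q => SkewPrim.braiding_incl_incl g p q,
    fun g h hgh p q => NodalCubic.Model.braiding_of_ne hgh p q,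
    NodalCubic.Model.braidingVG_one,
    NodalCubic.Model.braidingVG_b,
    NodalCubic.Model.exists_basis_b,
    NodalCubic.Model.exists_basis_a,
    ⟨NodalCubic.Model.Reg.braidingVG_u _, NodalCubic.Model.Reg.braidingVG_u _,
      NodalCubic.Model.Reg.braidingVG_v _, NodalCubic.Model.Reg.braidingVG_v _,
      NodalCubic.Model.not_isDiagonalType⟩,
    NodalCubic.Model.exists_presentation,
    ⟨by
      obtain ⟨e, -⟩ := NodalCubic.Model.exists_basis_Ba (k := k)
      rw [Module.finrank_eq_card_basis e, Fintype.card_fin],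
      NodalCubic.Model.exists_basis_Ba, NodalCubic.Model.relsUV_Ba.vuvv⟩,
    NodalCubic.Model.exists_exterior_algEquiv,
    NodalCubic.Model.exists_tensor_algEquiv,
    fun _ => ⟨NodalCubic.Model.exists_basis_one,
      by
        obtain ⟨e, h0, h1⟩ := NodalCubic.Model.exists_basis_one (k := k)
        obtain ⟨Ξ, h⟩ := NodalCubic.Model.exists_polynomial_algEquiv
          NodalCubic.Model.braidingVG_one e
        exact ⟨Ξ, by rw [h, h0], by rw [h, h1]⟩,
      NodalCubic.Model.exists_total⟩⟩
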